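/- Let $d\in\mathbf N$, $\mathfrak H=L^2(\mathbf R^d;\mathbf C)$, and let $\mathcal D(\mathfrak H)$ be the set of density operators, i.e. bounded operators $R=R^*\ge 0$ on $\mathfrak H$ with $\operatorname{trace}R=1$. For $\hbar>0$ and $x,\xi\in\mathbf R^d$ let $$c_\hbar(x,\xi):=\tfrac12\big(|x-y|^2+|\xi+i\hbar\nabla_y|^2\big),$$ a nonnegative unbounded self-adjoint operator on $\mathfrak H=L^2(\mathbf R^d_y)$. For a bounded operator $Q=Q^*\ge0$ put $\operatorname{trace}(c_\hbar Q):=\operatorname{trace}(Q^{1/2}c_\hbar Q^{1/2})\in[0,\infty]$, understood in the sense of quadratic forms: it is the sum over an orthonormal basis $(e_i)$ of $\mathfrak H$ of the values of the closed quadratic form of $c_\hbar$ at $Q^{1/2}e_i$, the form being $+\infty$ outside its domain. For a probability density $p$ on $\mathbf R^d\times\mathbf R^d$ and $R\in\mathcal D(\mathfrak H)$, let $\mathcal C(p,R)$ be the set of measurable maps $Q:\mathbf R^d\times\mathbf R^d\to\mathcal L(\mathfrak H)$ with $Q(x,\xi)=Q(x,\xi)^*\ge0$ and $\operatorname{trace}Q(x,\xi)=p(x,\xi)$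 for a.e. $(x,\xi)$, and $\int Q(x,\xi)\,dx\,d\xi=R$. Set $$E_\hbar(p,R):=\Big(\inf_{Q\in\mathcal C(p,R)}\int\operatorname{trace}\big(c_\hbar(x,\xi)Q(x,\xi)\big)\,dx\,d\xi\Big)^{1/2}\in[0,\infty].$$ For positive Borel measures $\mu,\nu$ on $\mathbf R^d\times\mathbf R^d$ set $$\operatorname{dist}_{MK,2}(\mu,\nu):=\Big(\inf_\pi\int\tfrac12\big(|x-y|^2+|\xi-\eta|^2\big)\,\pi(dx\,d\xi\,dy\,d\eta)\Big)^{1/2}\in[0,\infty],$$ where $\pi$ runs over the couplings of $\mu$ and $\nu$ (with the value $+\infty$ if there is none); a density is identified with the measure it defines. For $z=(x,\xi)$ let $|z,\hbar\rangle$ be the function $y\mapsto(\pi\hbar)^{-d/4}e^{-|y-x|^2/2\hbar}e^{i\xi\cdot(y-x)/\hbar}$, and for a finite positive Borel measure $\mu$ let $\operatorname{OP}^T_\hbar(\mu):=(2\pi\hbar)^{-d}\int|z,\hbar\rangle\langle z,\hbar|\,\mu(dz)$. For $R\in\mathcal D(\mathfrak H)$ with integral kernel $r$, define the Wigner and Husimi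 transforms $$W_\hbar[R](x,\xi):=\frac1{(2\pi)^d}\int_{\mathbf R^d}e^{-i\xi\cdot y}\,r\big(x+\tfrac12\hbar y,\,x-\tfrac12\hbar y\big)\,dy,\qquad \widetilde W_\hbar[R]:=e^{\hbar\Delta_{x,\xi}/4}\,W_\hbar[R].$$ **Theorem.** Let $p$ be a probability density on $\mathbf R^d\times\mathbf R^d$ with $\int(|x|^2+|\xi|^2)\,p(x,\xi)\,dx\,d\xi<\infty$. Then for all $\hbar>0$ and $R\in\mathcal D(\mathfrak H)$, $$E_\hbar(p,R)^2\ge\tfrac12d\hbar.$$ (1) For all $\hbar>0$ and every Borel probability measure $\mu$ on $\mathbf R^d\times\mathbf R^d$, the operator $R_\hbar:=\operatorname{OP}^T_\hbar((2\pi\hbar)^d\mu)$ belongs to $\mathcal D(\mathfrak H)$ and $$E_\hbar(p,R_\hbar)^2\le\operatorname{dist}_{MK,2}(p,\mu)^2+\tfrac12d\hbar.$$ (2) For all $\hbar>0$ and $R\in\mathcal D(\mathfrak H)$, $$E_\hbar(p,R)^2\ge\operatorname{dist}_{MK,2}(p,\widetilde W_\hbar[R])^2-\tfrac12d\hbar.$$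 (3) Let $R_\hbar\in\mathcal D(\mathfrak H)$ for all $\hbar>0$, and let $\mu$ be a tempered distribution such that $W_\hbar[R_\hbar]\to\mu$ in $\mathcal S'(\mathbf R^d\times\mathbf R^d)$ as $\hbar\to0^+$. Then $\mu$ is a positive Borel measure of total mass at most $1$, and $$\operatorname{dist}_{MK,2}(p,\mu)\le\varliminf_{\hbar\to0^+}E_\hbar(p,R_\hbar).$$ If moreover $\varliminf_{\hbar\to0^+}E_\hbar(p,R_\hbar)<\infty$, then $\mu$ is a Borel probability measure. -/

import Mathlib

open MeasureTheory Filter Topology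
open scoped ENNReal SchwartzMap LineDeriv InnerProductSpace

noncomputable section

namespace HybridTransport

/-- Configuration (or momentum) space `ℝᵈ` with its Euclidean norm. -/
abbrev Pos (d : ℕ) : Type := EuclideanSpace ℝ (Fin d)

/-- Phase space `ℝᵈ × ℝᵈ`, with points `z = (x, ξ)`. Its `volume` is Lebesgue measure `dx dξ`.
The sup norm of the product type is never used as a cost: all quadratic quantities below are
written `‖x‖² + ‖ξ‖²`. -/
abbrev Phase (d : ℕ) : Type := Pos d × Pos d

/-- The quantum state space `L²(ℝᵈ; ℂ)`. -/
abbrev StateSpace (d : ℕ) : Type := Lp ℂ 2 (volume : Measure (Pos d))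

variable {d : ℕ}

/-! ### Traces and density operators -/

/-- The trace of a (nonnegative) operator: the sum of its diagonal matrix elements in a Hilbert
basis, an element of `[0, ∞]`. For nonnegative operators it does not depend on the basis. -/
def opTrace (A : StateSpace d →L[ℂ] StateSpace d) : ℝ≥0∞ :=
  ∑' i : (exists_hilbertBasis ℂ (StateSpace d)).choose,
    ENNReal.ofReal
      (RCLike.re (⟪(i : StateSpace d), A (i : StateSpace d)⟫_ℂ))

/-- Density operators: bounded operators `R = R* ≥ 0` on `L²(ℝᵈ)` with `trace R = 1`. -/
structure IsDensityOperator (R : StateSpace d →L[ℂ] StateSpace d) : Prop where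
  isPositive : R.IsPositive
  trace_eq_one : opTrace R = 1

/-! ### Probability densities on phase space -/

/-- `p` is a probability density with respect to Lebesgue measure on phase space. -/
structure IsProbabilityDensity (p : Phase d → ℝ) : Prop where
  nonneg : 0 ≤ᵐ[volume] p
  integrable : Integrable p
  integral_eq_one : ∫ z, p z = 1

/-- Finiteness of `∫ (|x|² + |ξ|²) p(x, ξ) dx dξ`. -/
def HasFiniteSecondMoment (p : Phase d → ℝ) : Prop :=
  Integrable (fun z : Phase d => (‖z.1‖ ^ 2 + ‖z.2‖ ^ 2) * p z)

/-- The measure `p(x, ξ) dx dξ`. -/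
def densityMeasure (p : Phase d → ℝ) : Measure (Phase d) :=
  volume.withDensity fun z => ENNReal.ofReal (p z)

/-! ### The quadratic Monge-Kantorovich distance -/

/-- Couplings of two Borel measures on phase space. -/
def IsMeasureCoupling (μ ν : Measure (Phase d)) (π : Measure (Phase d × Phase d)) : Prop :=
  π.map Prod.fst = μ ∧ π.map Prod.snd = ν

/-- The transport cost `Γ(x, ξ, y, η) = ½ (|x - y|² + |ξ - η|²)`. -/
def quadCost (z w : Phase d) : ℝ :=
  (1 / 2) * (‖z.1 - w.1‖ ^ 2 + ‖z.2 - w.2‖ ^ 2)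

/-- The Monge-Kantorovich distance of exponent `2` on phase space (in `[0, ∞]`), normalized by the
cost `½ (|x - y|² + |ξ - η|²)`. -/
def distMK (μ ν : Measure (Phase d)) : ℝ≥0∞ :=
  (⨅ (π : Measure (Phase d × Phase d)) (_ : IsMeasureCoupling μ ν π),
    ∫⁻ zw, ENNReal.ofReal (quadCost zw.1 zw.2) ∂π) ^ (1 / 2 : ℝ)

/-! ### The operator-valued cost `c_ħ(x, ξ) = ½ (|x - y|² + |ξ + iħ∇_y|²)` -/

/-- `g ∈ L²` is the `j`-th partial derivative of `φ ∈ L²` in the sense of distributions. -/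
def HasPartialDeriv (j : Fin d) (φ g : StateSpace d) : Prop :=
  ∂_{(EuclideanSpace.single j (1 : ℝ) : Pos d)} (Lp.toTemperedDistribution φ : 𝓢'(Pos d, ℂ)) =
    (Lp.toTemperedDistribution g : 𝓢'(Pos d, ℂ))

/-- `⟨φ, |x - y|² φ⟩ = ∫ |x - y|² |φ(y)|² dy`, in `[0, ∞]`. -/
def positionForm (x : Pos d) (φ : StateSpace d) : ℝ≥0∞ :=
  ∫⁻ y, ‖x - y‖ₑ ^ 2 * ‖φ y‖ₑ ^ 2

/-- `⟨φ, (ξ_j + iħ∂_j)² φ⟩ = ‖(ξ_j + iħ∂_j) φ‖²`, in `[0, ∞]`. The derivative `g` is unique when it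
exists in `L²`, and the value is `∞` (infimum of the empty set) when it does not. -/
def momentumForm (ħ : ℝ) (ξ : Pos d) (j : Fin d) (φ : StateSpace d) : ℝ≥0∞ :=
  ⨅ (g : StateSpace d) (_ : HasPartialDeriv j φ g),
    ‖((ξ j : ℝ) : ℂ) • φ + (Complex.I * (ħ : ℂ)) • g‖ₑ ^ 2

/-- The quadratic form `⟨φ, c_ħ(x, ξ) φ⟩ ∈ [0, ∞]` of the nonnegative unbounded self-adjoint
operator `c_ħ(x, ξ) = ½ (|x - y|² + |ξ + iħ∇_y|²)`; it is `∞` outside of the form domain. -/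
def costForm (ħ : ℝ) (z : Phase d) (φ : StateSpace d) : ℝ≥0∞ :=
  2⁻¹ * (positionForm z.1 φ + ∑ j, momentumForm ħ z.2 j φ)

/-- The square root `A^{1/2}` of a nonnegative bounded operator on a Hilbert space, by the
continuous functional calculus. -/
def posSqrt {H : Type*} [NormedAddCommGroup H] [InnerProductSpace ℂ H] [CompleteSpace H]
    (A : H →L[ℂ] H) : H →L[ℂ] H :=
  CFC.sqrt A

/-- `trace (c_ħ(x, ξ) Q) = trace (Q^{1/2} c_ħ(x, ξ) Q^{1/2}) ∈ [0, ∞]` for a nonnegative operator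
`Q`: the sum over a Hilbert basis `(e_i)` of the values of the form of `c_ħ(x, ξ)` at
`Q^{1/2} e_i`. -/
def costTrace (ħ : ℝ) (z : Phase d) (Q : StateSpace d →L[ℂ] StateSpace d) : ℝ≥0∞ :=
  ∑' i : (exists_hilbertBasis ℂ (StateSpace d)).choose,
    costForm ħ z (posSqrt Q (i : StateSpace d))

/-! ### Couplings of a classical density and a quantum density; the functional `E_ħ` -/

/-- Couplings of a probability density `p` and a density operator `R`. Since `‖Q‖ ≤ trace Q`
for `Q ≥ 0`, such a `Q` is Bochner integrable for the operator norm. -/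
structure IsCoupling (p : Phase d → ℝ) (R : StateSpace d →L[ℂ] StateSpace d)
    (Q : Phase d → (StateSpace d →L[ℂ] StateSpace d)) : Prop where
  aestronglyMeasurable : AEStronglyMeasurable Q volume
  isPositive : ∀ᵐ z, (Q z).IsPositive
  trace_eq : ∀ᵐ z, opTrace (Q z) = ENNReal.ofReal (p z)
  integral_eq : ∫ z, Q z = R

/-- The hybrid classical-quantum pseudo-distance `E_ħ(p, R) ∈ [0, ∞]`. -/
def hybridE (ħ : ℝ) (p : Phase d → ℝ) (R : StateSpace d →L[ℂ] StateSpace d) : ℝ≥0∞ :=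
  (⨅ (Q : Phase d → (StateSpace d →L[ℂ] StateSpace d)) (_ : IsCoupling p R Q),
    ∫⁻ z, costTrace ħ z (Q z)) ^ (1 / 2 : ℝ)

/-! ### Coherent states and Töplitz operators -/

/-- The wave function `y ↦ (πħ)^{-d/4} exp(-|y - x|² / 2ħ) exp(iξ·(y - x)/ħ)` of the coherent
state at `z = (x, ξ)`. -/
def coherentFun (ħ : ℝ) (z : Phase d) (y : Pos d) : ℂ :=
  (((Real.pi * ħ) ^ (-(d : ℝ) / 4) * Real.exp (-‖y - z.1‖ ^ 2 / (2 * ħ)) : ℝ) : ℂ) *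
    Complex.exp (Complex.I * ((⟪z.2, y - z.1⟫_ℝ / ħ : ℝ) : ℂ))

theorem memLp_coherentFun {ħ : ℝ} (hħ : 0 < ħ) (z : Phase d) :
    MemLp (coherentFun ħ z) 2 (volume : Measure (Pos d)) := by
  have hc : Continuous (coherentFun ħ z) := by
    unfold coherentFun
    fun_prop
  rw [memLp_two_iff_integrable_sq_norm hc.aestronglyMeasurable]
  have h1 : Integrable (fun y : Pos d => Real.exp (-(1 / ħ) * ‖y‖ ^ 2)) := by
    have h := (GaussianFourier.integrable_cexp_neg_mul_sq_norm_add (V := Pos d)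
      (b := ((1 / ħ : ℝ) : ℂ)) (by rw [Complex.ofReal_re]; positivity) 0 0).norm
    refine h.congr (Eventually.of_forall fun y => ?_)
    simp only [Complex.norm_exp]
    congr 1
    simp [← Complex.ofReal_pow]
  have h2 := ((h1.comp_sub_right z.1).const_mul (((Real.pi * ħ) ^ (-(d : ℝ) / 4)) ^ 2))
  refine h2.congr (Eventually.of_forall fun y => ?_)
  have h3 : ‖coherentFun ħ z y‖ =
      (Real.pi * ħ) ^ (-(d : ℝ) / 4) * Real.exp (-‖y - z.1‖ ^ 2 / (2 * ħ)) := by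
    unfold coherentFun
    rw [norm_mul, mul_comm Complex.I, Complex.norm_exp_ofReal_mul_I, mul_one,
      Complex.norm_real, Real.norm_of_nonneg]
    positivity
  simp only [h3, mul_pow, ← Real.exp_nat_mul]
  congr 2
  field_simp
  norm_num

open Classical in
/-- The coherent state `|x + iξ, ħ⟩` as an element of `L²(ℝᵈ)`; the condition always holds for
`ħ > 0`. -/
def coherentState (ħ : ℝ) (z : Phase d) : StateSpace d :=
  if h : MemLp (coherentFun ħ z) 2 (volume : Measure (Pos d)) then h.toLp _ else 0

/-- The Töplitz operator `OP^T_ħ(μ) = (2πħ)^{-d} ∫ |z, ħ⟩⟨z, ħ| μ(dz)` with symbol a finite Borel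
measure `μ`. -/
def toeplitz (ħ : ℝ) (μ : Measure (Phase d)) : StateSpace d →L[ℂ] StateSpace d :=
  (((2 * Real.pi * ħ) ^ d)⁻¹ : ℝ) •
    ∫ z, InnerProductSpace.rankOne ℂ (coherentState ħ z) (coherentState ħ z) ∂μ

/-! ### Wigner and Husimi transforms -/

/-- `r ∈ L²(ℝᵈ × ℝᵈ)` is an integral kernel of the operator `R`. -/
def IsIntegralKernel (R : StateSpace d →L[ℂ] StateSpace d) (r : Pos d × Pos d → ℂ) : Prop :=
  MemLp r 2 volume ∧ ∀ φ : StateSpace d, R φ =ᵐ[volume] fun x => ∫ y, r (x, y) * φ y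

open Classical in
/-- An integral kernel of `R`, unique up to null sets if there is one (as is the case for
density operators, which are Hilbert-Schmidt), and `0` otherwise. -/
def integralKernel (R : StateSpace d →L[ℂ] StateSpace d) : Pos d × Pos d → ℂ :=
  if h : ∃ r, IsIntegralKernel R r then h.choose else 0

/-- The Wigner transform
`W_ħ[R](x, ξ) = (2π)^{-d} ∫ exp(-iξ·y) r(x + ħy/2, x - ħy/2) dy`. -/
def wigner (ħ : ℝ) (R : StateSpace d →L[ℂ] StateSpace d) (z : Phase d) : ℂ :=
  (((2 * Real.pi) ^ d)⁻¹ : ℝ) •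
    ∫ y : Pos d, Complex.exp (-Complex.I * ((⟪z.2, y⟫_ℝ : ℝ) : ℂ)) *
      integralKernel R (z.1 + (ħ / 2) • y, z.1 - (ħ / 2) • y)

/-- The kernel `(4πt)^{-d} exp(-(|x|² + |ξ|²) / 4t)` of the heat semigroup `exp(tΔ_{x,ξ})` on
the `2d`-dimensional phase space. -/
def heatKernel (t : ℝ) (z : Phase d) : ℝ :=
  ((4 * Real.pi * t) ^ d)⁻¹ * Real.exp (-(‖z.1‖ ^ 2 + ‖z.2‖ ^ 2) / (4 * t))

/-- The Husimi transform `exp(ħΔ_{x,ξ}/4) W_ħ[R]`, the heat semigroup at time `ħ/4` applied to the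
(bounded) Wigner function. -/
def husimi (ħ : ℝ) (R : StateSpace d →L[ℂ] StateSpace d) (z : Phase d) : ℂ :=
  ∫ w, (heatKernel (ħ / 4) (z - w) : ℂ) * wigner ħ R w

/-- The measure with density the Husimi function (which is real and nonnegative when `R` is a
density operator). -/
def husimiMeasure (ħ : ℝ) (R : StateSpace d →L[ℂ] StateSpace d) : Measure (Phase d) :=
  densityMeasure fun z => (husimi ħ R z).re

/-- `W_ħ[R_ħ] → μ` in the space `𝓢'` of tempered distributions on phase space as `ħ → 0⁺`. -/
def WignerTendsto (R : ℝ → (StateSpace d →L[ℂ] StateSpace d)) (μ : 𝓢'(Phase d, ℂ)) : Prop :=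
  ∀ φ : 𝓢(Phase d, ℂ),
    Tendsto (fun ħ : ℝ => ∫ z, wigner ħ (R ħ) z * φ z) (𝓝[>] 0) (𝓝 (μ φ))

end HybridTransport

end

section

open MeasureTheory Filter Topology ProbabilityTheory
open scoped ENNReal SchwartzMap LineDeriv InnerProductSpace FourierTransform

noncomputable section

namespace HybridTransport

/-! ### Traces and square roots of nonnegative operators -/

section Traces

/-! Everything rests on three facts about the form of `c_ħ(z)`, and each of them carries the same
constant `dħ/2`. Heisenberg's inequality (`heisenberg`) says `c_ħ(z) ≥ dħ/2`. Coherent states are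
explicit Gaussians, so `⟨w|c_ħ(z)|w⟩ = quadCost z w + dħ/2` (`costForm_coherentState`). In the
opposite direction, averaging the classical cost over the Husimi density of `φ` gives `(2πħ)^{-d} ∫
quadCost z w |⟨w|φ⟩|² dw = ⟨φ, c_ħ(z) φ⟩ + dħ/2 ‖φ‖²` (`lintegral_quadCost_husimi`). Traces are
taken over the decomposition `Q = ∑ |Q^{1/2}eᵢ⟩⟨Q^{1/2}eᵢ|`, so each identity for vectors sums to
one for operators.

The general lower bound is Heisenberg's inequality summed over `Q(z)^{1/2}eᵢ` and integrated in `z`.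
For (1), a classical coupling is disintegrated as `p(z)dz π_z(dw)`, and `Q(z) = p(z) ∫ |w⟩⟨w|
π_z(dw)` couples `p` with the Töplitz operator. For (2), a quantum coupling `Q` yields the classical
coupling of density `(2πħ)^{-d} ⟨w|Q(z)|w⟩`. Its marginals are `p`, by the resolution of the
identity, and the Husimi function of `R`, because the latter is the coherent state expectation
(`IsDensityOperator.husimi_eq`).

For (3), Wigner and Husimi functions have the same limit. Write a Schwartz test function as the
Fourier transform of `ψ`. The Wigner function tested against such a transform is bounded by `∫ |ψ|`
uniformly in `ħ`, and the heat semigroup multiplies `ψ` by a Gaussian tending to `1`. Husimi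
functions are probability densities, so `μ` is a positive measure of mass at most `1`. If the lower
limit is finite, (2) supplies couplings of bounded cost along a sequence. Since `p` has a finite
second moment these couplings are tight. A limit point couples `p` with `μ`, no mass escapes, and
the cost is lower semicontinuous. -/

theorem enorm_sq_eq_ofReal {E : Type*} [NormedAddCommGroup E] (y : E) :
    ‖y‖ₑ ^ 2 = ENNReal.ofReal (‖y‖ ^ 2) := by
  rw [ENNReal.ofReal_pow (norm_nonneg _), ofReal_norm]

section Hilbert

variable {H : Type*} [NormedAddCommGroup H] [InnerProductSpace ℂ H]

theorem hilbertBasis_enorm_sq {ι : Type*} (b : HilbertBasis ι ℂ H) (x : H) :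
    ∑' i, ‖⟪b i, x⟫_ℂ‖ₑ ^ 2 = ‖x‖ₑ ^ 2 := by
  have h := (b.hasSum_inner_mul_inner x x).mapL Complex.reCLM
  have h2 : HasSum (fun i => ‖⟪b i, x⟫_ℂ‖ ^ 2) (‖x‖ ^ 2) := by
    convert h using 1
    · ext i
      rw [← inner_conj_symm x (b i), mul_comm, Complex.mul_conj, Complex.normSq_eq_norm_sq,
        Complex.reCLM_apply, Complex.ofReal_re]
    · rw [inner_self_eq_norm_sq_to_K]
      simp [← Complex.ofReal_pow]
  simp_rw [enorm_sq_eq_ofReal]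
  rw [← h2.tsum_eq, ENNReal.ofReal_tsum_of_nonneg (fun _ => by positivity) h2.summable]

theorem hilbertBasis_enorm_sq' {ι : Type*} (b : HilbertBasis ι ℂ H) (x : H) :
    ∑' i, ‖⟪x, b i⟫_ℂ‖ₑ ^ 2 = ‖x‖ₑ ^ 2 := by
  rw [← hilbertBasis_enorm_sq b x]
  refine tsum_congr fun i => ?_
  rw [← inner_conj_symm, ← ofReal_norm, RCLike.norm_conj, ofReal_norm]

/-- Distinct basis vectors lie at distance `√2`, so balls of radius `1/2` around them are disjoint
open sets in a separable space. Countability lets trace sums be exchanged with integrals and null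
sets be united over the basis. -/
theorem countable_of_hilbertBasis [TopologicalSpace.SeparableSpace H] {ι : Type*}
    (b : HilbertBasis ι ℂ H) : Countable ι := by
  have hd : Pairwise fun i j => Disjoint (Metric.ball (b i) (1 / 2)) (Metric.ball (b j) (1 / 2)) := by
    intro i j hij
    apply Metric.ball_disjoint_ball
    have h1 : ‖b i - b j‖ ^ 2 = 2 := by
      rw [@norm_sub_sq ℂ, b.orthonormal.2 hij]
      simp [b.orthonormal.1]; norm_num
    rw [dist_eq_norm]
    nlinarith [norm_nonneg (b i - b j)]
  have := Pairwise.countable_of_isOpen_disjoint hd (fun i => Metric.isOpen_ball)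
    (fun i => ⟨b i, by simp⟩)
  exact this

variable [CompleteSpace H]

theorem posSqrt_isPositive (A : H →L[ℂ] H) : (posSqrt A).IsPositive :=
  (ContinuousLinearMap.nonneg_iff_isPositive _).1 (CFC.sqrt_nonneg A)

theorem inner_posSqrt_left (A : H →L[ℂ] H) (x y : H) :
    ⟪posSqrt A x, y⟫_ℂ = ⟪x, posSqrt A y⟫_ℂ :=
  (posSqrt_isPositive A).isSymmetric x y

theorem posSqrt_apply_apply {A : H →L[ℂ] H} (hA : A.IsPositive) (x : H) :
    posSqrt A (posSqrt A x) = A x := by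
  have h := CFC.sqrt_mul_sqrt_self A ((ContinuousLinearMap.nonneg_iff_isPositive _).2 hA)
  exact congrArg (fun B : H →L[ℂ] H => B x) h

theorem re_inner_eq_enorm_posSqrt {A : H →L[ℂ] H} (hA : A.IsPositive) (x : H) :
    ENNReal.ofReal (RCLike.re ⟪x, A x⟫_ℂ) = ‖posSqrt A x‖ₑ ^ 2 := by
  rw [← posSqrt_apply_apply hA, ← inner_posSqrt_left, inner_self_eq_norm_sq,
    ENNReal.ofReal_pow (norm_nonneg _), ofReal_norm]

/-- The vectors `A^{1/2} bᵢ` need not be orthogonal, but `A = ∑ |A^{1/2}bᵢ⟩⟨A^{1/2}bᵢ|` still holds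
weakly. This decomposition replaces diagonalization everywhere below. -/
theorem tsum_inner_posSqrt {ι : Type*} (b : HilbertBasis ι ℂ H) {A : H →L[ℂ] H}
    (hA : A.IsPositive) (x : H) :
    ∑' i, ‖⟪x, posSqrt A (b i)⟫_ℂ‖ₑ ^ 2 = ENNReal.ofReal (RCLike.re ⟪x, A x⟫_ℂ) := by
  rw [re_inner_eq_enorm_posSqrt hA, ← hilbertBasis_enorm_sq' b]
  simp [inner_posSqrt_left]

/-- The trace of `T A T*` computed from the decomposition `A = ∑ |A^{1/2} bᵢ⟩⟨A^{1/2} bᵢ|`. -/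
theorem tsum_enorm_clm_posSqrt {ι : Type*} (b : HilbertBasis ι ℂ H) {A : H →L[ℂ] H}
    (hA : A.IsPositive) (T : H →L[ℂ] H) :
    ∑' i, ‖T (posSqrt A (b i))‖ₑ ^ 2 =
      ∑' j, ENNReal.ofReal (RCLike.re ⟪T.adjoint (b j), A (T.adjoint (b j))⟫_ℂ) := by
  simp_rw [← hilbertBasis_enorm_sq b (T _), ← tsum_inner_posSqrt b hA,
    ContinuousLinearMap.adjoint_inner_left]
  exact ENNReal.tsum_comm

end Hilbert

variable {d : ℕ}

/-- The Hilbert basis of `L²` in which the traces are computed. -/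
def stdBasis (d : ℕ) :
    HilbertBasis (exists_hilbertBasis ℂ (StateSpace d)).choose ℂ (StateSpace d) :=
  (exists_hilbertBasis ℂ (StateSpace d)).choose_spec.choose

theorem coe_stdBasis (i : (exists_hilbertBasis ℂ (StateSpace d)).choose) :
    stdBasis d i = (i : StateSpace d) :=
  congrFun (exists_hilbertBasis ℂ (StateSpace d)).choose_spec.choose_spec i

instance instCountableStdBasis :
    Countable (exists_hilbertBasis ℂ (StateSpace d)).choose :=
  haveI : Fact ((2 : ℝ≥0∞) ≠ ∞) := ⟨by simp⟩
  countable_of_hilbertBasis (stdBasis d)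

theorem opTrace_eq (A : StateSpace d →L[ℂ] StateSpace d) :
    opTrace A = ∑' i, ENNReal.ofReal (RCLike.re ⟪stdBasis d i, A (stdBasis d i)⟫_ℂ) := by
  simp_rw [coe_stdBasis]; rfl

theorem costTrace_eq (ħ : ℝ) (z : Phase d) (Q : StateSpace d →L[ℂ] StateSpace d) :
    costTrace ħ z Q = ∑' i, costForm ħ z (posSqrt Q (stdBasis d i)) := by
  simp_rw [coe_stdBasis]; rfl

theorem opTrace_eq_tsum_posSqrt {A : StateSpace d →L[ℂ] StateSpace d} (hA : A.IsPositive) :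
    opTrace A = ∑' i, ‖posSqrt A (stdBasis d i)‖ₑ ^ 2 := by
  rw [opTrace_eq]
  exact tsum_congr fun i => re_inner_eq_enorm_posSqrt hA _

/-- The operator norm of a nonnegative operator is at most its trace. -/
theorem enorm_le_opTrace {A : StateSpace d →L[ℂ] StateSpace d} (hA : A.IsPositive) :
    ‖A‖ₑ ≤ opTrace A := by
  -- Hilbert-Schmidt bound: Parseval for `A^{1/2}x`, then Cauchy-Schwarz in each coefficient
  -- `⟨A^{1/2}bᵢ, x⟩`. Using it twice bounds `A = A^{1/2}A^{1/2}`.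
  have h1 : ∀ x, ‖posSqrt A x‖ₑ ^ 2 ≤ opTrace A * ‖x‖ₑ ^ 2 := by
    intro x
    rw [← hilbertBasis_enorm_sq (stdBasis d), opTrace_eq_tsum_posSqrt hA, ← ENNReal.tsum_mul_right]
    refine ENNReal.tsum_le_tsum fun i => ?_
    rw [← mul_pow, ← inner_posSqrt_left]
    gcongr
    rw [← ofReal_norm, ← ofReal_norm, ← ofReal_norm, ← ENNReal.ofReal_mul (norm_nonneg _)]
    exact ENNReal.ofReal_le_ofReal (norm_inner_le_norm _ _)
  by_cases ht : opTrace A = ⊤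
  · simp [ht]
  lift opTrace A to NNReal using ht with t
  have h2 : ∀ x, ‖posSqrt A x‖ ≤ Real.sqrt t * ‖x‖ := by
    intro x
    have := h1 x
    rw [← Real.sqrt_sq (norm_nonneg x), ← Real.sqrt_mul t.coe_nonneg]
    apply Real.le_sqrt_of_sq_le
    rw [← ofReal_norm, ← ofReal_norm, ← ENNReal.ofReal_pow (norm_nonneg _),
      ← ENNReal.ofReal_pow (norm_nonneg _), ← ENNReal.ofReal_coe_nnreal,
      ← ENNReal.ofReal_mul (by positivity)] at this
    exact (ENNReal.ofReal_le_ofReal_iff (by positivity)).1 this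
  have h3 : ‖A‖ ≤ t := by
    refine A.opNorm_le_bound t.coe_nonneg fun x => ?_
    rw [← posSqrt_apply_apply hA]
    calc _ ≤ Real.sqrt t * (Real.sqrt t * ‖x‖) := (h2 _).trans (by gcongr; exact h2 x)
      _ = t * ‖x‖ := by rw [← mul_assoc, Real.mul_self_sqrt t.coe_nonneg]
  rw [← ofReal_norm, ← ENNReal.ofReal_coe_nnreal]
  exact ENNReal.ofReal_le_ofReal h3

end Traces

/-! ### Gaussian weights -/

section GaussianWeights

variable {d : ℕ}

/-- The centered Gaussian probability density of covariance `ħ/2` on `ℝᵈ`. -/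
def gaussWeight (ħ : ℝ) (y : Pos d) : ℝ :=
  (Real.pi * ħ) ^ (-(d : ℝ) / 2) * Real.exp (-‖y‖ ^ 2 / ħ)

theorem gaussWeight_nonneg {ħ : ℝ} (hħ : 0 < ħ) (y : Pos d) : 0 ≤ gaussWeight ħ y := by
  unfold gaussWeight; positivity

theorem gaussWeight_neg (ħ : ℝ) (y : Pos d) : gaussWeight ħ (-y) = gaussWeight ħ y := by
  simp [gaussWeight]

theorem continuous_gaussWeight (ħ : ℝ) : Continuous (gaussWeight ħ : Pos d → ℝ) := by
  unfold gaussWeight; fun_prop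

theorem integrable_exp_neg_mul_norm_sq {b : ℝ} (hb : 0 < b) :
    Integrable (fun y : Pos d => Real.exp (-b * ‖y‖ ^ 2)) := by
  have h := (GaussianFourier.integrable_cexp_neg_mul_sq_norm_add (V := Pos d)
    (b := (b : ℂ)) (by simpa using hb) 0 0).norm
  refine h.congr (Eventually.of_forall fun y => ?_)
  simp only [Complex.norm_exp]
  congr 1
  simp [← Complex.ofReal_pow]

theorem integrable_norm_sq_mul_exp {b : ℝ} (hb : 0 < b) :
    Integrable (fun y : Pos d => ‖y‖ ^ 2 * Real.exp (-b * ‖y‖ ^ 2)) := by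
  refine ((integrable_exp_neg_mul_norm_sq (d := d) (half_pos hb)).const_mul (2 / b)).mono'
    (by fun_prop) (Eventually.of_forall fun y => ?_)
  rw [Real.norm_of_nonneg (by positivity)]
  have h1 : b / 2 * ‖y‖ ^ 2 ≤ Real.exp (b / 2 * ‖y‖ ^ 2) := by
    linarith [Real.add_one_le_exp (b / 2 * ‖y‖ ^ 2)]
  have h2 : Real.exp (-(b / 2) * ‖y‖ ^ 2) =
      Real.exp (b / 2 * ‖y‖ ^ 2) * Real.exp (-b * ‖y‖ ^ 2) := by
    rw [← Real.exp_add]; congr 1; ring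
  calc ‖y‖ ^ 2 * Real.exp (-b * ‖y‖ ^ 2)
      = 2 / b * ((b / 2 * ‖y‖ ^ 2) * Real.exp (-b * ‖y‖ ^ 2)) := by field_simp
    _ ≤ _ := by rw [h2]; gcongr

/-- Integrate by parts in each coordinate: `∂_j e^{-b|y|²} = -2b y_j e^{-b|y|²}` is paired with
`y_j`, and the `d` equal contributions are added. -/
theorem integral_norm_sq_mul_exp {b : ℝ} (hb : 0 < b) :
    ∫ y : Pos d, ‖y‖ ^ 2 * Real.exp (-b * ‖y‖ ^ 2) =
      d / (2 * b) * ∫ y : Pos d, Real.exp (-b * ‖y‖ ^ 2) := by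
  have hder : ∀ (y v : Pos d), fderiv ℝ (fun y : Pos d => Real.exp (-b * ‖y‖ ^ 2)) y v =
      -(2 * b) * ⟪y, v⟫_ℝ * Real.exp (-b * ‖y‖ ^ 2) := by
    intro y v
    have h := (((hasStrictFDerivAt_norm_sq y).hasFDerivAt.const_mul (-b))).exp
    rw [h.fderiv]
    simp
    ring
  have hsq : ∀ (y : Pos d) (j : Fin d), y j ^ 2 ≤ ‖y‖ ^ 2 := fun y j => by
    have := PiLp.norm_apply_le y j
    rw [Real.norm_eq_abs] at this
    rw [← sq_abs (y j)]
    gcongr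
  have hi2 : ∀ j : Fin d, Integrable fun y : Pos d => y j ^ 2 * Real.exp (-b * ‖y‖ ^ 2) :=
    fun j => (integrable_norm_sq_mul_exp (d := d) hb).mono' (by fun_prop)
      (Eventually.of_forall fun y => by
        rw [Real.norm_of_nonneg (by positivity)]
        exact mul_le_mul_of_nonneg_right (hsq y j) (Real.exp_nonneg _))
  have hcoord : ∀ j : Fin d, ∫ y : Pos d, y j ^ 2 * Real.exp (-b * ‖y‖ ^ 2) =
      1 / (2 * b) * ∫ y : Pos d, Real.exp (-b * ‖y‖ ^ 2) := by
    intro j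
    have hfd : ∀ y : Pos d, fderiv ℝ (fun y : Pos d => y j) y (EuclideanSpace.single j 1) = 1 := by
      intro y
      have : HasFDerivAt (fun y : Pos d => y j)
          (EuclideanSpace.proj j : Pos d →L[ℝ] ℝ) y :=
        (EuclideanSpace.proj j : Pos d →L[ℝ] ℝ).hasFDerivAt
      rw [this.fderiv]; simp
    have hi1 : Integrable fun y : Pos d => y j * Real.exp (-b * ‖y‖ ^ 2) := by
      refine ((integrable_norm_sq_mul_exp (d := d) hb).add
        (integrable_exp_neg_mul_norm_sq (d := d) hb)).mono' (by fun_prop)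
        (Eventually.of_forall fun y => ?_)
      rw [norm_mul, Real.norm_eq_abs, Real.norm_eq_abs, Real.abs_exp]
      have : |y j| ≤ ‖y‖ ^ 2 + 1 := by
        have h1 := hsq y j
        rw [← sq_abs (y j)] at h1
        nlinarith [abs_nonneg (y j), sq_nonneg (|y j| - 1)]
      calc _ ≤ (‖y‖ ^ 2 + 1) * Real.exp (-b * ‖y‖ ^ 2) := by gcongr
        _ = _ := by simp [add_mul]
    have h := integral_mul_fderiv_eq_neg_fderiv_mul_of_integrable
      (μ := (volume : Measure (Pos d))) (f := fun y : Pos d => y j)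
      (g := fun y : Pos d => Real.exp (-b * ‖y‖ ^ 2)) (v := EuclideanSpace.single j 1)
      (by simpa [hfd] using integrable_exp_neg_mul_norm_sq (d := d) hb)
      (by
        simp only [hder]
        refine ((hi2 j).const_mul (-(2 * b))).congr (Eventually.of_forall fun y => ?_)
        simp [EuclideanSpace.inner_single_right]
        ring)
      hi1 (fun y _ => by fun_prop) (fun y _ => by
        exact ((hasStrictFDerivAt_norm_sq y).hasFDerivAt.const_mul (-b)).exp.differentiableAt)
    simp only [hder, hfd, one_mul] at h
    have h' : ∫ y : Pos d, -(2 * b) * (y j ^ 2 * Real.exp (-b * ‖y‖ ^ 2)) =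
        -∫ y : Pos d, Real.exp (-b * ‖y‖ ^ 2) := by
      rw [← h]
      refine integral_congr_ae (Eventually.of_forall fun y => ?_)
      simp [EuclideanSpace.inner_single_right]
      ring
    rw [integral_const_mul] at h'
    rw [eq_comm, div_mul_eq_mul_div, div_eq_iff (by positivity)]
    linarith
  have hi : ∀ j ∈ (Finset.univ : Finset (Fin d)),
      Integrable fun y : Pos d => y j ^ 2 * Real.exp (-b * ‖y‖ ^ 2) := fun j _ => hi2 j
  simp_rw [EuclideanSpace.real_norm_sq_eq] at hi ⊢
  simp_rw [Finset.sum_mul, integral_finsetSum _ hi]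
  simp_rw [EuclideanSpace.real_norm_sq_eq] at hcoord
  simp_rw [hcoord]
  simp
  ring

theorem gaussWeight_eq (ħ : ℝ) (y : Pos d) :
    gaussWeight ħ y = (Real.pi * ħ) ^ (-(d : ℝ) / 2) * Real.exp (-(1 / ħ) * ‖y‖ ^ 2) := by
  unfold gaussWeight; congr 2; ring

theorem integrable_gaussWeight {ħ : ℝ} (hħ : 0 < ħ) :
    Integrable (gaussWeight ħ : Pos d → ℝ) := by
  simp_rw [funext (gaussWeight_eq (d := d) ħ)]
  exact (integrable_exp_neg_mul_norm_sq (by positivity)).const_mul _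

theorem integral_gaussWeight {ħ : ℝ} (hħ : 0 < ħ) : ∫ y : Pos d, gaussWeight ħ y = 1 := by
  simp_rw [gaussWeight_eq]
  rw [integral_const_mul, GaussianFourier.integral_rexp_neg_mul_sq_norm (by positivity),
    finrank_euclideanSpace_fin]
  have : Real.pi / (1 / ħ) = Real.pi * ħ := by field_simp
  rw [this, ← Real.rpow_add (by positivity)]
  ring_nf
  simp

theorem integrable_norm_sq_mul_gaussWeight {ħ : ℝ} (hħ : 0 < ħ) :
    Integrable (fun y : Pos d => ‖y‖ ^ 2 * gaussWeight ħ y) := by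
  simp_rw [gaussWeight_eq]
  refine ((integrable_norm_sq_mul_exp (d := d) (b := 1 / ħ) (by positivity)).const_mul
    ((Real.pi * ħ) ^ (-(d : ℝ) / 2))).congr (Eventually.of_forall fun y => ?_)
  dsimp only; ring

theorem integral_norm_sq_mul_gaussWeight {ħ : ℝ} (hħ : 0 < ħ) :
    ∫ y : Pos d, ‖y‖ ^ 2 * gaussWeight ħ y = d * ħ / 2 := by
  have h1 := integral_gaussWeight (d := d) hħ
  simp_rw [gaussWeight_eq, integral_const_mul] at h1
  simp_rw [gaussWeight_eq, mul_left_comm (‖_‖ ^ 2), integral_const_mul]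
  rw [integral_norm_sq_mul_exp (by positivity), mul_left_comm, h1]
  field_simp

theorem integrable_norm_mul_gaussWeight {ħ : ℝ} (hħ : 0 < ħ) :
    Integrable (fun y : Pos d => ‖y‖ * gaussWeight ħ y) := by
  refine ((integrable_norm_sq_mul_gaussWeight (d := d) hħ).add
    (integrable_gaussWeight hħ)).mono' (by have := continuous_gaussWeight (d := d) ħ; fun_prop)
    (Eventually.of_forall fun y => ?_)
  have h0 := gaussWeight_nonneg hħ y
  rw [Real.norm_of_nonneg (by positivity)]
  have : ‖y‖ ≤ ‖y‖ ^ 2 + 1 := by nlinarith [sq_nonneg (‖y‖ - 1), norm_nonneg y]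
  calc _ ≤ (‖y‖ ^ 2 + 1) * gaussWeight ħ y := by gcongr
    _ = _ := by simp [add_mul]

theorem integrable_inner_mul_gaussWeight {ħ : ℝ} (hħ : 0 < ħ) (x : Pos d) :
    Integrable (fun y : Pos d => ⟪x, y⟫_ℝ * gaussWeight ħ y) := by
  refine ((integrable_norm_mul_gaussWeight (d := d) hħ).const_mul ‖x‖).mono'
    (by have := continuous_gaussWeight (d := d) ħ; fun_prop) (Eventually.of_forall fun y => ?_)
  have h0 := gaussWeight_nonneg hħ y
  rw [norm_mul, Real.norm_of_nonneg h0, ← mul_assoc]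
  gcongr
  exact norm_inner_le_norm _ _

theorem integral_inner_mul_gaussWeight {ħ : ℝ} (x : Pos d) :
    ∫ y : Pos d, ⟪x, y⟫_ℝ * gaussWeight ħ y = 0 := by
  have h := integral_neg_eq_self (fun y : Pos d => ⟪x, y⟫_ℝ * gaussWeight ħ y) volume
  simp only [inner_neg_right, gaussWeight_neg, neg_mul, integral_neg] at h
  linarith

theorem lintegral_gaussWeight {ħ : ℝ} (hħ : 0 < ħ) (a : Pos d) :
    ∫⁻ y : Pos d, ENNReal.ofReal (gaussWeight ħ (y - a)) = 1 := by
  rw [lintegral_sub_right_eq_self (fun y : Pos d => ENNReal.ofReal (gaussWeight ħ y)) a,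
    ← ofReal_integral_eq_lintegral_ofReal (integrable_gaussWeight hħ)
      (Eventually.of_forall (gaussWeight_nonneg hħ)), integral_gaussWeight hħ, ENNReal.ofReal_one]

/-- After translation the square is expanded: the cross term is odd and vanishes, and the variance
contributes `dħ/2`. Every `dħ/2` in the coherent state identities comes from here, once in position
and once in momentum, averaged by the factor `1/2` of the cost. -/
theorem lintegral_norm_sub_sq_gaussWeight {ħ : ℝ} (hħ : 0 < ħ) (x a : Pos d) :
    ∫⁻ y : Pos d, ‖x - y‖ₑ ^ 2 * ENNReal.ofReal (gaussWeight ħ (y - a)) =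
      ENNReal.ofReal (‖x - a‖ ^ 2 + d * ħ / 2) := by
  have h1 := integrable_gaussWeight (d := d) hħ
  have h2 := integrable_norm_sq_mul_gaussWeight (d := d) hħ
  have h3 := integrable_inner_mul_gaussWeight (d := d) hħ (x - a)
  have e : ∀ y : Pos d, ‖x - (y + a)‖ ^ 2 * gaussWeight ħ y =
      ‖x - a‖ ^ 2 * gaussWeight ħ y - 2 * (⟪x - a, y⟫_ℝ * gaussWeight ħ y) +
        ‖y‖ ^ 2 * gaussWeight ħ y := by
    intro y
    rw [show x - (y + a) = (x - a) - y by abel, @norm_sub_sq ℝ]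
    simp
    ring
  have hi : Integrable fun y : Pos d => ‖x - (y + a)‖ ^ 2 * gaussWeight ħ y := by
    simp_rw [e]
    exact ((h1.const_mul _).sub (h3.const_mul _)).add h2
  have h4 := lintegral_sub_right_eq_self (μ := volume)
    (fun y : Pos d => ‖x - (y + a)‖ₑ ^ 2 * ENNReal.ofReal (gaussWeight ħ y)) a
  simp only [sub_add_cancel] at h4
  have h5 : ∫ y : Pos d, ‖x - (y + a)‖ ^ 2 * gaussWeight ħ y = ‖x - a‖ ^ 2 + d * ħ / 2 := by
    simp_rw [e]
    have h6 : Integrable fun y : Pos d => ‖x - a‖ ^ 2 * gaussWeight ħ y -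
      2 * (⟪x - a, y⟫_ℝ * gaussWeight ħ y) := (h1.const_mul _).sub (h3.const_mul _)
    rw [integral_add h6 h2, integral_sub (h1.const_mul _) (h3.const_mul _), integral_const_mul,
      integral_const_mul, integral_gaussWeight hħ, integral_inner_mul_gaussWeight, integral_norm_sq_mul_gaussWeight hħ]
    ring
  rw [h4, ← h5, ofReal_integral_eq_lintegral_ofReal hi (Eventually.of_forall fun y =>
    mul_nonneg (sq_nonneg _) (gaussWeight_nonneg hħ y))]
  refine lintegral_congr fun y => ?_
  rw [ENNReal.ofReal_mul (sq_nonneg _), enorm_sq_eq_ofReal]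

end GaussianWeights

/-! ### Coherent states -/

section CoherentStates

variable {d : ℕ}

theorem continuous_coherentFun (ħ : ℝ) (z : Phase d) : Continuous (coherentFun ħ z) := by
  unfold coherentFun; fun_prop

theorem norm_coherentFun {ħ : ℝ} (hħ : 0 < ħ) (z : Phase d) (y : Pos d) :
    ‖coherentFun ħ z y‖ =
      (Real.pi * ħ) ^ (-(d : ℝ) / 4) * Real.exp (-‖y - z.1‖ ^ 2 / (2 * ħ)) := by
  unfold coherentFun
  rw [norm_mul, mul_comm Complex.I, Complex.norm_exp_ofReal_mul_I, mul_one,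
    Complex.norm_real, Real.norm_of_nonneg]
  positivity

theorem norm_coherentFun_sq {ħ : ℝ} (hħ : 0 < ħ) (z : Phase d) (y : Pos d) :
    ‖coherentFun ħ z y‖ ^ 2 = gaussWeight ħ (y - z.1) := by
  rw [norm_coherentFun hħ, mul_pow, ← Real.exp_nat_mul, ← Real.rpow_natCast, ← Real.rpow_mul
    (by positivity), gaussWeight]
  congr 2
  · push_cast; ring
  · push_cast; field_simp

theorem enorm_coherentFun_sq {ħ : ℝ} (hħ : 0 < ħ) (z : Phase d) (y : Pos d) :
    ‖coherentFun ħ z y‖ₑ ^ 2 = ENNReal.ofReal (gaussWeight ħ (y - z.1)) := by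
  rw [enorm_sq_eq_ofReal, norm_coherentFun_sq hħ]

theorem coherentState_coeFn {ħ : ℝ} (hħ : 0 < ħ) (z : Phase d) :
    coherentState ħ z =ᵐ[volume] coherentFun ħ z := by
  rw [coherentState, dif_pos (memLp_coherentFun hħ z)]
  exact MemLp.coeFn_toLp _

theorem enorm_Lp_two_sq (φ : StateSpace d) : ‖φ‖ₑ ^ 2 = ∫⁻ y, ‖φ y‖ₑ ^ 2 := by
  rw [Lp.enorm_def, eLpNorm_eq_lintegral_rpow_enorm_toReal (by simp) (by simp), ← ENNReal.rpow_natCast,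
    ← ENNReal.rpow_mul]
  simp

theorem norm_coherentState {ħ : ℝ} (hħ : 0 < ħ) (z : Phase d) : ‖coherentState ħ z‖ = 1 := by
  have h : ‖coherentState ħ z‖ₑ ^ 2 = 1 := by
    rw [enorm_Lp_two_sq, ← lintegral_gaussWeight hħ z.1]
    refine lintegral_congr_ae ?_
    filter_upwards [coherentState_coeFn hħ z] with y hy
    rw [hy, enorm_coherentFun_sq hħ]
  rw [enorm_sq_eq_ofReal, ENNReal.ofReal_eq_one] at h
  nlinarith [norm_nonneg (coherentState ħ z)]

theorem inner_Lp_eq (φ ψ : StateSpace d) :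
    ⟪φ, ψ⟫_ℂ = ∫ y, starRingEnd ℂ (φ y) * ψ y := by
  rw [L2.inner_def]
  exact integral_congr_ae (Eventually.of_forall fun y => by
    simp only [RCLike.inner_apply]; ring)

theorem inner_coherentState_eq {ħ : ℝ} (hħ : 0 < ħ) (z : Phase d) (φ : StateSpace d) :
    ⟪coherentState ħ z, φ⟫_ℂ = ∫ y, starRingEnd ℂ (coherentFun ħ z y) * φ y := by
  rw [inner_Lp_eq]
  refine integral_congr_ae ?_
  filter_upwards [coherentState_coeFn hħ z] with y hy
  rw [hy]

theorem integrable_coherentFun {ħ : ℝ} (hħ : 0 < ħ) (z : Phase d) :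
    Integrable (coherentFun ħ z) := by
  have h := ((integrable_exp_neg_mul_norm_sq (d := d) (b := 1 / (2 * ħ)) (by positivity)).comp_sub_right
    z.1).const_mul ((Real.pi * ħ) ^ (-(d : ℝ) / 4))
  refine h.mono' (continuous_coherentFun ħ z).aestronglyMeasurable (Eventually.of_forall fun y => ?_)
  rw [norm_coherentFun hħ]
  apply le_of_eq
  congr 2; ring

theorem continuous_inner_coherentState {ħ : ℝ} (hħ : 0 < ħ) (z : Phase d) :
    Continuous fun w : Phase d => ⟪coherentState ħ z, coherentState ħ w⟫_ℂ := by
  have e : ∀ w : Phase d, ⟪coherentState ħ z, coherentState ħ w⟫_ℂ =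
      ∫ y, starRingEnd ℂ (coherentFun ħ z y) * coherentFun ħ w y := by
    intro w
    rw [inner_coherentState_eq hħ]
    refine integral_congr_ae ?_
    filter_upwards [coherentState_coeFn hħ w] with y hy
    rw [hy]
  simp_rw [e]
  refine continuous_of_dominated
    (bound := fun y => ‖coherentFun ħ z y‖ * (Real.pi * ħ) ^ (-(d : ℝ) / 4)) ?_ ?_ ?_ ?_
  · intro w
    have h1 := continuous_coherentFun ħ z
    have h2 := continuous_coherentFun ħ w
    exact Continuous.aestronglyMeasurable (by fun_prop)
  · intro w
    refine Eventually.of_forall fun y => ?_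
    rw [norm_mul, RCLike.norm_conj, norm_coherentFun hħ w]
    gcongr
    refine mul_le_of_le_one_right (by positivity) (Real.exp_le_one_iff.2 ?_)
    rw [neg_div]
    exact neg_nonpos.2 (by positivity)
  · exact (integrable_coherentFun hħ z).norm.mul_const _
  · refine Eventually.of_forall fun y => ?_
    have h1 : Continuous fun w : Phase d => coherentFun ħ w y := by
      unfold coherentFun; fun_prop
    exact continuous_const.mul h1

/-- For unit vectors `‖u - v‖² = 2 - 2 Re⟨v, u⟩`, so norm continuity reduces to continuity of the
overlaps. -/
theorem continuous_coherentState {ħ : ℝ} (hħ : 0 < ħ) :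
    Continuous (coherentState ħ : Phase d → StateSpace d) := by
  rw [continuous_iff_continuousAt]
  intro z
  rw [ContinuousAt, tendsto_iff_norm_sub_tendsto_zero]
  have e : ∀ w : Phase d, ‖coherentState ħ w - coherentState ħ z‖ =
      Real.sqrt (2 - 2 * RCLike.re ⟪coherentState ħ z, coherentState ħ w⟫_ℂ) := by
    intro w
    rw [← Real.sqrt_sq (norm_nonneg (coherentState ħ w - coherentState ħ z)), norm_sub_rev,
      @norm_sub_sq ℂ, norm_coherentState hħ, norm_coherentState hħ]
    congr 1
    ring
  have hc : Continuous fun w : Phase d =>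
      Real.sqrt (2 - 2 * RCLike.re ⟪coherentState ħ z, coherentState ħ w⟫_ℂ) := by
    have h1 := RCLike.continuous_re.comp (continuous_inner_coherentState (d := d) hħ z)
    exact Real.continuous_sqrt.comp (continuous_const.sub (continuous_const.mul h1))
  have h := hc.tendsto z
  simp_rw [e]
  rwa [inner_self_eq_norm_sq, norm_coherentState hħ, one_pow, mul_one, sub_self,
    Real.sqrt_zero] at h

/-- Locally integrable functions with the same integrals against Schwartz functions agree a.e. -/
theorem ae_eq_of_integral_schwartz {u v : Pos d → ℂ} (hu : LocallyIntegrable u)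
    (hv : LocallyIntegrable v) (h : ∀ g : 𝓢(Pos d, ℂ), ∫ x, g x * u x = ∫ x, g x * v x) :
    u =ᵐ[volume] v := by
  refine ae_eq_of_integral_contDiff_smul_eq hu hv fun g hg hgc => ?_
  have h1 : HasCompactSupport (Complex.ofRealCLM ∘ g) := hgc.comp_left rfl
  have h2 : ContDiff ℝ (⊤ : ℕ∞) (Complex.ofRealCLM ∘ g) := by
    exact Complex.ofRealCLM.contDiff.comp hg
  have := h (h1.toSchwartzMap h2)
  simpa using this

/-- On `L¹ ∩ L²` the Fourier transform of `L²` is given by the Fourier integral. -/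
theorem fourier_toLp_coeFn {f : Pos d → ℂ} (hf1 : Integrable f) (hf2 : MemLp f 2) :
    (𝓕 (hf2.toLp f) : StateSpace d) =ᵐ[volume] 𝓕 f := by
  have hc : Continuous (𝓕 f) := VectorFourier.fourierIntegral_continuous
    Real.continuous_fourierChar continuous_inner hf1
  refine ae_eq_of_integral_schwartz ((Lp.memLp _).locallyIntegrable (by norm_num))
    hc.locallyIntegrable fun g => ?_
  have h1 := congrArg (fun T : 𝓢'(Pos d, ℂ) => T g)
    (Lp.fourier_toTemperedDistribution_eq (hf2.toLp f))
  simp only [TemperedDistribution.fourier_apply, Lp.toTemperedDistribution_apply, smul_eq_mul] at h1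
  rw [← h1]
  -- The Fourier integral moves from one factor to the other, which identifies both transforms as
  -- distributions.
  have h2 := VectorFourier.integral_fourierIntegral_smul_eq_flip (L := innerₗ (Pos d))
    (μ := volume) (ν := volume) Real.continuous_fourierChar continuous_inner g.integrable hf1
  rw [flip_innerₗ] at h2
  simp only [smul_eq_mul] at h2
  calc _ = ∫ x, (𝓕 g) x * f x := by
        refine integral_congr_ae ?_
        filter_upwards [hf2.coeFn_toLp] with x hx
        rw [hx]
    _ = _ := h2

end CoherentStates

/-! ### The quadratic form of the cost on coherent states -/

section CostOfCoherentStates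

variable {d : ℕ}

theorem enorm_ofReal_complex (r : ℝ) : ‖(r : ℂ)‖ₑ = ‖r‖ₑ := by
  rw [← ofReal_norm, ← ofReal_norm, Complex.norm_real]

/-- On the Fourier side `∂_j` is multiplication by `2πi k_j`. Having a weak derivative in `L²` thus
becomes a square integrability condition on `k_j 𝓕φ`. -/
theorem hasPartialDeriv_iff (j : Fin d) (φ g : StateSpace d) :
    HasPartialDeriv j φ g ↔ (𝓕 g : StateSpace d) =ᵐ[volume]
      fun k => (2 * Real.pi * Complex.I) * ((k j : ℝ) : ℂ) * (𝓕 φ : StateSpace d) k := by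
  have hT' : Function.HasTemperateGrowth (fun k : Pos d => ((k j : ℝ) : ℂ)) := by
    have : Function.HasTemperateGrowth (fun k : Pos d =>
      ((inner ℝ k (EuclideanSpace.single j (1 : ℝ) : Pos d) : ℝ) : ℂ)) := by fun_prop
    simpa [EuclideanSpace.inner_single_right] using this
  have key : ∀ u : 𝓢(Pos d, ℂ),
      (𝓕 (∂_{(EuclideanSpace.single j (1 : ℝ) : Pos d)}
        (Lp.toTemperedDistribution φ : 𝓢'(Pos d, ℂ)))) u =
      ∫ k, u k * ((2 * Real.pi * Complex.I) * ((k j : ℝ) : ℂ) * (𝓕 φ : StateSpace d) k) := by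
    intro u
    rw [TemperedDistribution.fourier_lineDerivOp_eq, Lp.fourier_toTemperedDistribution_eq]
    simp only [smul_apply, TemperedDistribution.smulLeftCLM_apply_apply,
      Lp.toTemperedDistribution_apply, smul_eq_mul]
    rw [← integral_const_mul]
    refine integral_congr_ae (Eventually.of_forall fun k => ?_)
    simp [SchwartzMap.smulLeftCLM_apply_apply hT', EuclideanSpace.inner_single_right]
    ring
  have key2 : ∀ u : 𝓢(Pos d, ℂ), (𝓕 (Lp.toTemperedDistribution g : 𝓢'(Pos d, ℂ))) u =
      ∫ k, u k * (𝓕 g : StateSpace d) k := by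
    intro u
    rw [Lp.fourier_toTemperedDistribution_eq]
    simp
  have hl : ∀ ψ : StateSpace d, LocallyIntegrable (ψ : Pos d → ℂ) := fun ψ =>
    (Lp.memLp ψ).locallyIntegrable (by norm_num)
  constructor
  · intro h
    refine ae_eq_of_integral_schwartz (hl _) ?_ fun u => ?_
    · rw [← locallyIntegrableOn_univ]
      exact LocallyIntegrableOn.continuousOn_mul ((hl _).locallyIntegrableOn _)
        (Continuous.continuousOn (by fun_prop)) isOpen_univ.isLocallyClosed
    · rw [← key, ← key2, h]
  · intro h
    have e : 𝓕 (∂_{(EuclideanSpace.single j (1 : ℝ) : Pos d)}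
        (Lp.toTemperedDistribution φ : 𝓢'(Pos d, ℂ))) =
        𝓕 (Lp.toTemperedDistribution g : 𝓢'(Pos d, ℂ)) := by
      ext u
      rw [key, key2]
      refine integral_congr_ae ?_
      filter_upwards [h] with k hk
      rw [hk]
    have e2 := congrArg (fun T : 𝓢'(Pos d, ℂ) => 𝓕⁻ T) e
    simp only [FourierTransform.fourierInv_fourier_eq] at e2
    exact e2

/-- Plancherel, with `iħ · 2πi k_j = -2πħ k_j`. The infimum also has the right value `∞`: if the
weighted integral is finite, the inverse transform of `2πi k_j 𝓕φ` is an admissible derivative, so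
the infimum is not over the empty set. -/
theorem momentumForm_eq {ħ : ℝ} (hħ : 0 < ħ) (ξ : Pos d) (j : Fin d) (φ : StateSpace d) :
    momentumForm ħ ξ j φ = ∫⁻ k, ‖ξ j - 2 * Real.pi * ħ * k j‖ₑ ^ 2 *
      ‖(𝓕 φ : StateSpace d) k‖ₑ ^ 2 := by
  have key : ∀ g : StateSpace d, HasPartialDeriv j φ g →
      ‖((ξ j : ℝ) : ℂ) • φ + (Complex.I * (ħ : ℂ)) • g‖ₑ ^ 2 =
        ∫⁻ k, ‖ξ j - 2 * Real.pi * ħ * k j‖ₑ ^ 2 * ‖(𝓕 φ : StateSpace d) k‖ₑ ^ 2 := by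
    intro g hg
    have e0 : ‖((ξ j : ℝ) : ℂ) • φ + (Complex.I * (ħ : ℂ)) • g‖ₑ =
        ‖((ξ j : ℝ) : ℂ) • (𝓕 φ : StateSpace d) + (Complex.I * (ħ : ℂ)) • (𝓕 g : StateSpace d)‖ₑ := by
      rw [← ofReal_norm, ← ofReal_norm, ← Lp.norm_fourier_eq]
      simp only [FourierTransform.fourier_add, FourierTransform.fourier_smul]
    rw [e0, enorm_Lp_two_sq]
    refine lintegral_congr_ae ?_
    filter_upwards [(hasPartialDeriv_iff j φ g).1 hg,
      Lp.coeFn_add (((ξ j : ℝ) : ℂ) • (𝓕 φ : StateSpace d)) ((Complex.I * (ħ : ℂ)) • (𝓕 g : StateSpace d)),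
      Lp.coeFn_smul ((ξ j : ℝ) : ℂ) (𝓕 φ : StateSpace d),
      Lp.coeFn_smul (Complex.I * (ħ : ℂ)) (𝓕 g : StateSpace d)] with k h1 h2 h3 h4
    rw [h2, Pi.add_apply, h3, h4, Pi.smul_apply, Pi.smul_apply, h1, ← mul_pow]
    congr 1
    rw [← enorm_ofReal_complex, ← enorm_mul]
    congr 1
    simp only [smul_eq_mul]
    push_cast
    linear_combination (ħ * 2 * Real.pi * (k j : ℂ) * (𝓕 φ : StateSpace d) k) * Complex.I_sq
  apply le_antisymm
  · by_cases ht : ∫⁻ k, ‖ξ j - 2 * Real.pi * ħ * k j‖ₑ ^ 2 * ‖(𝓕 φ : StateSpace d) k‖ₑ ^ 2 = ⊤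
    · rw [ht]; exact le_top
    have hm : AEStronglyMeasurable (fun k : Pos d =>
        ((ξ j - 2 * Real.pi * ħ * k j : ℝ) : ℂ) * (𝓕 φ : StateSpace d) k) volume :=
      AEStronglyMeasurable.mul (Continuous.aestronglyMeasurable (by fun_prop))
        (Lp.aestronglyMeasurable _)
    have h1 : MemLp (fun k : Pos d =>
        ((ξ j - 2 * Real.pi * ħ * k j : ℝ) : ℂ) * (𝓕 φ : StateSpace d) k) 2 volume := by
      refine ⟨hm, ?_⟩
      rw [eLpNorm_lt_top_iff_lintegral_rpow_enorm_lt_top (by simp) (by simp)]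
      refine lt_of_eq_of_lt ?_ (lt_top_iff_ne_top.2 ht)
      refine lintegral_congr fun k => ?_
      rw [enorm_mul, enorm_ofReal_complex, ENNReal.toReal_ofNat, ENNReal.rpow_ofNat, mul_pow]
    have h2 : MemLp (fun k : Pos d =>
        (2 * Real.pi * Complex.I) * ((k j : ℝ) : ℂ) * (𝓕 φ : StateSpace d) k) 2 volume := by
      -- `2πi k_j 𝓕φ` is recovered as `(i/ħ)(ξ_j 𝓕φ - (ξ_j - 2πħ k_j) 𝓕φ)`, a combination of two
      -- `L²` functions.
      have h3 := ((((Lp.memLp (𝓕 φ : StateSpace d)).const_mul ((ξ j : ℝ) : ℂ)).sub h1).const_mul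
        (Complex.I / ħ))
      refine (memLp_congr_ae (Eventually.of_forall fun k => ?_)).1 h3
      have : (ħ : ℂ) ≠ 0 := by exact_mod_cast hħ.ne'
      simp only [Pi.sub_apply]
      push_cast
      field_simp
      ring
    have hg : HasPartialDeriv j φ (𝓕⁻ (h2.toLp _)) := by
      rw [hasPartialDeriv_iff, FourierTransform.fourier_fourierInv_eq]
      exact h2.coeFn_toLp
    rw [← key _ hg]
    exact iInf₂_le _ hg
  · refine le_iInf₂ fun g hg => ?_
    rw [key g hg]

theorem enorm_sq_euclidean (x : Pos d) : ‖x‖ₑ ^ 2 = ∑ j, ‖x j‖ₑ ^ 2 := by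
  simp_rw [enorm_sq_eq_ofReal]
  rw [EuclideanSpace.norm_sq_eq, ENNReal.ofReal_sum_of_nonneg fun _ _ => sq_nonneg _]

/-- The form of `c_ħ(x, ξ)` is the sum of a multiplication operator in position and of a
multiplication operator in momentum. -/
theorem costForm_eq {ħ : ℝ} (hħ : 0 < ħ) (z : Phase d) (φ : StateSpace d) :
    costForm ħ z φ = 2⁻¹ * ((∫⁻ y, ‖z.1 - y‖ₑ ^ 2 * ‖φ y‖ₑ ^ 2) +
      ∫⁻ k, ‖z.2 - (2 * Real.pi * ħ) • k‖ₑ ^ 2 * ‖(𝓕 φ : StateSpace d) k‖ₑ ^ 2) := by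
  unfold costForm positionForm
  congr 2
  simp_rw [momentumForm_eq hħ, enorm_sq_euclidean, Finset.sum_mul]
  rw [lintegral_finsetSum']
  · simp
  · intro j _
    have hm : Measurable fun k : Pos d => ‖z.2 j - 2 * Real.pi * ħ * k j‖ₑ ^ 2 :=
      (Continuous.measurable (by fun_prop : Continuous fun k : Pos d =>
        z.2 j - 2 * Real.pi * ħ * k j)).enorm.pow_const 2
    refine AEMeasurable.mul (μ := volume) hm.aemeasurable ?_
    exact ((Lp.aestronglyMeasurable (𝓕 φ : StateSpace d)).enorm.pow_const 2)

theorem enorm_fourier_sq (φ : StateSpace d) : ‖(𝓕 φ : StateSpace d)‖ₑ = ‖φ‖ₑ := by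
  rw [← ofReal_norm, ← ofReal_norm, Lp.norm_fourier_eq]

/-- The semiclassical parameter of the Fourier transforms of the coherent states. -/
def dualHbar (ħ : ℝ) : ℝ := 1 / (4 * Real.pi ^ 2 * ħ)

theorem dualHbar_pos {ħ : ℝ} (hħ : 0 < ħ) : 0 < dualHbar ħ := by
  unfold dualHbar; positivity

/-- The center of the Fourier transform of a coherent state. -/
def dualPoint (ħ : ℝ) (z : Phase d) : Phase d :=
  ((2 * Real.pi * ħ)⁻¹ • z.2, -(2 * Real.pi * ħ)⁻¹ • z.1)

/-- Up to a unimodular phase, the Fourier transform of a coherent state is a coherent state for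
`1/(4π²ħ)` with position and momentum exchanged. Momentum estimates thereby become position
estimates with another parameter. -/
theorem fourier_coherentFun {ħ : ℝ} (hħ : 0 < ħ) (z : Phase d) (w : Pos d) :
    𝓕 (coherentFun ħ z) w =
      Complex.exp (((-(⟪z.1, z.2⟫_ℝ / ħ) : ℝ) : ℂ) * Complex.I) *
        coherentFun (dualHbar ħ) (dualPoint ħ z) w := by
  have hb : 0 < (((1 / (2 * ħ) : ℝ) : ℂ)).re := by rw [Complex.ofReal_re]; positivity
  have h := fourier_gaussian_innerProductSpace' hb ((2 * Real.pi * ħ)⁻¹ • z.2) w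
  have e1 : coherentFun ħ z = (fun u : Pos d => (((Real.pi * ħ) ^ (-(d : ℝ) / 4) : ℝ) : ℂ) *
      Complex.exp (-((1 / (2 * ħ) : ℝ) : ℂ) * (‖u‖ : ℂ) ^ 2 + 2 * Real.pi * Complex.I *
        ((⟪(2 * Real.pi * ħ)⁻¹ • z.2, u⟫_ℝ : ℝ) : ℂ))) ∘ fun y => y + (-z.1) := by
    ext y
    have hħ' : (ħ : ℂ) ≠ 0 := by exact_mod_cast hħ.ne'
    have hπ : (Real.pi : ℂ) ≠ 0 := by exact_mod_cast Real.pi_ne_zero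
    simp only [coherentFun, Function.comp_apply, Complex.ofReal_mul, Complex.ofReal_exp,
      mul_assoc, ← Complex.exp_add, inner_smul_left, ← sub_eq_add_neg]
    congr 2
    push_cast
    simp
    field_simp
  rw [e1]
  have h2 := VectorFourier.fourierIntegral_comp_add_right Real.fourierChar
    (volume : Measure (Pos d)) (innerₗ (Pos d))
    (fun u : Pos d => (((Real.pi * ħ) ^ (-(d : ℝ) / 4) : ℝ) : ℂ) *
      Complex.exp (-((1 / (2 * ħ) : ℝ) : ℂ) * (‖u‖ : ℂ) ^ 2 + 2 * Real.pi * Complex.I *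
        ((⟪(2 * Real.pi * ħ)⁻¹ • z.2, u⟫_ℝ : ℝ) : ℂ))) (-z.1)
  refine (congrFun h2 w).trans ?_
  have h3 : VectorFourier.fourierIntegral Real.fourierChar (volume : Measure (Pos d))
      (innerₗ (Pos d)) (fun u : Pos d => (((Real.pi * ħ) ^ (-(d : ℝ) / 4) : ℝ) : ℂ) *
      Complex.exp (-((1 / (2 * ħ) : ℝ) : ℂ) * (‖u‖ : ℂ) ^ 2 + 2 * Real.pi * Complex.I *
        ((⟪(2 * Real.pi * ħ)⁻¹ • z.2, u⟫_ℝ : ℝ) : ℂ))) w = _ :=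
    (congrFun (VectorFourier.fourierIntegral_const_smul Real.fourierChar
      (volume : Measure (Pos d)) (innerₗ (Pos d)) _
      (((Real.pi * ħ) ^ (-(d : ℝ) / 4) : ℝ) : ℂ)) w).trans
      (congrArg ((((Real.pi * ħ) ^ (-(d : ℝ) / 4) : ℝ) : ℂ) • ·) h)
  rw [h3]
  -- Normalizations match: the Gaussian integral contributes `(2πħ)^{d/2}`, and `π · dualHbar ħ =
  -- 1/(4πħ)`. Both sides are written with powers of `4` and `πħ`.
  have hconst : (((Real.pi * ħ) ^ (-(d : ℝ) / 4) : ℝ) : ℂ) *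
      (Real.pi / ((1 / (2 * ħ) : ℝ) : ℂ)) ^ (Module.finrank ℝ (Pos d) / 2 : ℂ) =
      (((Real.pi * dualHbar ħ) ^ (-(d : ℝ) / 4) : ℝ) : ℂ) := by
    rw [← Complex.ofReal_div, finrank_euclideanSpace_fin,
      show ((d : ℂ) / 2) = ((d / 2 : ℝ) : ℂ) by push_cast; rfl,
      ← Complex.ofReal_cpow (by positivity), ← Complex.ofReal_mul]
    congr 1
    have e2 : Real.pi * dualHbar ħ = (4 * (Real.pi * ħ))⁻¹ := by
      unfold dualHbar; field_simp
    have e3 : Real.pi / (1 / (2 * ħ)) = (4 * (Real.pi * ħ) ^ 2) ^ (1 / 2 : ℝ) := by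
      rw [← Real.sqrt_eq_rpow, show 4 * (Real.pi * ħ) ^ 2 = (2 * (Real.pi * ħ)) ^ 2 by ring,
        Real.sqrt_sq (by positivity)]
      field_simp
    have hs : 0 < Real.pi * ħ := by positivity
    rw [e2, e3]
    generalize Real.pi * ħ = s at hs
    rw [← Real.rpow_mul (by positivity), Real.inv_rpow (by positivity),
      ← Real.rpow_neg (by positivity), Real.mul_rpow (by positivity) (by positivity),
      Real.mul_rpow (by positivity) (by positivity), ← Real.rpow_natCast, ← Real.rpow_mul
      (by positivity), mul_left_comm, ← Real.rpow_add (by positivity)]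
    congr 2 <;> push_cast <;> ring
  have hħ' : (ħ : ℂ) ≠ 0 := by exact_mod_cast hħ.ne'
  have hπ : (Real.pi : ℂ) ≠ 0 := by exact_mod_cast Real.pi_ne_zero
  rw [Circle.smul_def, smul_eq_mul, smul_eq_mul, ← mul_assoc (Complex.ofReal _), hconst,
    Real.fourierChar_apply]
  simp only [coherentFun, dualPoint, Complex.ofReal_mul, Complex.ofReal_exp]
  rw [mul_left_comm, ← Complex.exp_add, mul_left_comm, ← Complex.exp_add,
    mul_assoc (Complex.ofReal _) (Complex.exp _), ← Complex.exp_add]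
  congr 2
  simp only [innerₗ_apply_apply, inner_neg_left, inner_smul_left, inner_sub_right,
    inner_smul_right, dualHbar, norm_sub_rev w]
  rw [real_inner_comm z.2 z.1]
  push_cast
  simp
  field_simp
  ring

theorem fourier_coherentState {ħ : ℝ} (hħ : 0 < ħ) (z : Phase d) :
    (𝓕 (coherentState ħ z) : StateSpace d) =
      Complex.exp (((-(⟪z.1, z.2⟫_ℝ / ħ) : ℝ) : ℂ) * Complex.I) •
        coherentState (dualHbar ħ) (dualPoint ħ z) := by
  have h0 : coherentState ħ z = (memLp_coherentFun hħ z).toLp _ := by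
    rw [coherentState, dif_pos (memLp_coherentFun hħ z)]
  apply Lp.ext
  rw [h0]
  filter_upwards [fourier_toLp_coeFn (integrable_coherentFun hħ z) (memLp_coherentFun hħ z),
    Lp.coeFn_smul (Complex.exp (((-(⟪z.1, z.2⟫_ℝ / ħ) : ℝ) : ℂ) * Complex.I))
      (coherentState (dualHbar ħ) (dualPoint ħ z)),
    coherentState_coeFn (dualHbar_pos hħ) (dualPoint ħ z)] with k h1 h2 h3
  rw [h1, h2, Pi.smul_apply, h3, fourier_coherentFun hħ, smul_eq_mul]

end CostOfCoherentStates

/-! ### Moments of Husimi functions -/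

section HusimiMoments

variable {d : ℕ}

theorem lintegral_comp_inv_smul {r : ℝ} (hr : r ≠ 0) (f : Pos d → ℝ≥0∞) :
    ∫⁻ x, f (r⁻¹ • x) = ENNReal.ofReal (|r| ^ d) * ∫⁻ x, f x := by
  have h := Measure.map_addHaar_smul (volume : Measure (Pos d)) (inv_ne_zero hr)
  have e : MeasurableEmbedding fun x : Pos d => r⁻¹ • x :=
    (Homeomorph.smulOfNeZero r⁻¹ (inv_ne_zero hr)).measurableEmbedding
  rw [← e.lintegral_map, h, lintegral_smul_measure, finrank_euclideanSpace_fin, inv_pow, inv_inv,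
    abs_pow, smul_eq_mul]

theorem aemeasurable_enorm_sq_coeFn (φ : StateSpace d) :
    AEMeasurable (fun y => ‖φ y‖ₑ ^ 2) volume :=
  (Lp.aestronglyMeasurable φ).enorm.pow_const 2

theorem quadCost_nonneg (z w : Phase d) : 0 ≤ quadCost z w := by
  unfold quadCost; positivity

theorem ofReal_quadCost (z w : Phase d) :
    ENNReal.ofReal (quadCost z w) = 2⁻¹ * (‖z.1 - w.1‖ₑ ^ 2 + ‖z.2 - w.2‖ₑ ^ 2) := by
  rw [quadCost, ENNReal.ofReal_mul (by norm_num), ENNReal.ofReal_add (sq_nonneg _) (sq_nonneg _),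
    enorm_sq_eq_ofReal, enorm_sq_eq_ofReal]
  congr 1
  rw [one_div, ENNReal.ofReal_inv_of_pos (by norm_num)]
  simp

theorem enorm_sub_smul_sq {r : ℝ} (hr : 0 < r) (x k : Pos d) :
    ‖x - r • k‖ₑ ^ 2 = ENNReal.ofReal (r ^ 2) * ‖r⁻¹ • x - k‖ₑ ^ 2 := by
  have : x - r • k = r • (r⁻¹ • x - k) := by
    rw [smul_sub, smul_inv_smul₀ hr.ne']
  rw [this, enorm_smul, mul_pow, Real.enorm_eq_ofReal hr.le, ← ENNReal.ofReal_pow hr.le]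

/-- The position and momentum densities are Gaussians centered at `w.1` and, after rescaling, at
`w.2`, each adding `dħ/2` to the squared distance. At `w = z` this is the equality case of
`heisenberg`. -/
theorem costForm_coherentState {ħ : ℝ} (hħ : 0 < ħ) (z w : Phase d) :
    costForm ħ z (coherentState ħ w) = ENNReal.ofReal (quadCost z w + d * ħ / 2) := by
  have h1 : ∫⁻ y, ‖z.1 - y‖ₑ ^ 2 * ‖coherentState ħ w y‖ₑ ^ 2 =
      ENNReal.ofReal (‖z.1 - w.1‖ ^ 2 + d * ħ / 2) := by
    rw [← lintegral_norm_sub_sq_gaussWeight hħ]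
    refine lintegral_congr_ae ?_
    filter_upwards [coherentState_coeFn hħ w] with y hy
    rw [hy, enorm_coherentFun_sq hħ]
  have h2 : ∫⁻ k, ‖z.2 - (2 * Real.pi * ħ) • k‖ₑ ^ 2 *
      ‖(𝓕 (coherentState ħ w) : StateSpace d) k‖ₑ ^ 2 =
      ENNReal.ofReal (‖z.2 - w.2‖ ^ 2 + d * ħ / 2) := by
    have hr : 0 < 2 * Real.pi * ħ := by positivity
    have e : ∀ᵐ k, ‖z.2 - (2 * Real.pi * ħ) • k‖ₑ ^ 2 *
      ‖(𝓕 (coherentState ħ w) : StateSpace d) k‖ₑ ^ 2 = ENNReal.ofReal ((2 * Real.pi * ħ) ^ 2) *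
        (‖(2 * Real.pi * ħ)⁻¹ • z.2 - k‖ₑ ^ 2 *
          ENNReal.ofReal (gaussWeight (dualHbar ħ) (k - (dualPoint ħ w).1))) := by
      rw [fourier_coherentState hħ]
      filter_upwards [Lp.coeFn_smul (Complex.exp (((-(⟪w.1, w.2⟫_ℝ / ħ) : ℝ) : ℂ) * Complex.I))
        (coherentState (dualHbar ħ) (dualPoint ħ w)),
        coherentState_coeFn (dualHbar_pos hħ) (dualPoint ħ w)] with k h2 h3
      rw [h2, Pi.smul_apply, h3, enorm_smul, ← ofReal_norm (Complex.exp _),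
        Complex.norm_exp_ofReal_mul_I, ENNReal.ofReal_one, one_mul,
        enorm_coherentFun_sq (dualHbar_pos hħ), enorm_sub_smul_sq hr, mul_assoc]
    rw [lintegral_congr_ae e, lintegral_const_mul' _ _ ENNReal.ofReal_ne_top,
      lintegral_norm_sub_sq_gaussWeight (dualHbar_pos hħ), ← ENNReal.ofReal_mul (sq_nonneg _)]
    congr 1
    rw [dualPoint, ← smul_sub, norm_smul, norm_inv, Real.norm_of_nonneg hr.le, dualHbar]
    field_simp
    ring
  rw [costForm_eq hħ, h1, h2, ← ENNReal.ofReal_add (by positivity) (by positivity)]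
  rw [show (2⁻¹ : ℝ≥0∞) = ENNReal.ofReal (1 / 2) by
    rw [one_div, ENNReal.ofReal_inv_of_pos (by norm_num)]; simp,
    ← ENNReal.ofReal_mul (by norm_num), quadCost]
  congr 1
  ring

theorem memLp_coherentFun_mul (ħ : ℝ) (hħ : 0 < ħ) (w : Phase d) (φ : StateSpace d) :
    MemLp (fun y => coherentFun ħ w y * φ y) 2 := by
  have h1 : ∀ y, ‖coherentFun ħ w y‖ ≤ (Real.pi * ħ) ^ (-(d : ℝ) / 4) := fun y => by
    rw [norm_coherentFun hħ w]
    refine mul_le_of_le_one_right (by positivity) (Real.exp_le_one_iff.2 ?_)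
    rw [neg_div]
    exact neg_nonpos.2 (by positivity)
  refine (Lp.memLp φ).of_le_mul (c := (Real.pi * ħ) ^ (-(d : ℝ) / 4))
    ((continuous_coherentFun ħ w).aestronglyMeasurable.mul (Lp.aestronglyMeasurable φ))
    (Eventually.of_forall fun y => ?_)
  rw [norm_mul]
  gcongr
  exact h1 y

/-- For fixed `a`, the overlap is up to a phase the Fourier transform at `α/(2πħ)` of `φ` times a
Gaussian centered at `a`. Plancherel gives the integral, and the rescaling gives the factor
`(2πħ)^d`. -/
theorem lintegral_enorm_inner_coherentState_momentum {ħ : ℝ} (hħ : 0 < ħ) (a : Pos d)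
    (φ : StateSpace d) :
    ∫⁻ α, ‖⟪coherentState ħ (a, α), φ⟫_ℂ‖ₑ ^ 2 = ENNReal.ofReal ((2 * Real.pi * ħ) ^ d) *
      ∫⁻ y, ENNReal.ofReal (gaussWeight ħ (y - a)) * ‖φ y‖ₑ ^ 2 := by
  have hr : 0 < 2 * Real.pi * ħ := by positivity
  set h : Pos d → ℂ := fun y => coherentFun ħ (a, 0) y * φ y with hh
  have h1 : Integrable h := by
    have := (memLp_coherentFun hħ ((a, 0) : Phase d)).integrable_mul (Lp.memLp φ)
    exact this
  have h2 : MemLp h 2 := memLp_coherentFun_mul ħ hħ (a, 0) φ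
  have e : ∀ α, ‖⟪coherentState ħ (a, α), φ⟫_ℂ‖ₑ ^ 2 = ‖𝓕 h ((2 * Real.pi * ħ)⁻¹ • α)‖ₑ ^ 2 := by
    intro α
    congr 1
    rw [inner_coherentState_eq hħ, Real.fourier_eq']
    have : ∀ y, starRingEnd ℂ (coherentFun ħ (a, α) y) * φ y =
        Complex.exp (((⟪α, a⟫_ℝ / ħ : ℝ) : ℂ) * Complex.I) *
          (Complex.exp (((-2 * Real.pi * ⟪y, (2 * Real.pi * ħ)⁻¹ • α⟫_ℝ : ℝ) : ℂ) * Complex.I) •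
            h y) := by
      intro y
      have hħ' : (ħ : ℂ) ≠ 0 := by exact_mod_cast hħ.ne'
      have hπ : (Real.pi : ℂ) ≠ 0 := by exact_mod_cast Real.pi_ne_zero
      simp only [hh, coherentFun, map_mul, Complex.conj_ofReal, ← Complex.exp_conj, Complex.conj_I,
        inner_zero_left, zero_div, Complex.ofReal_zero, mul_zero, Complex.exp_zero, mul_one,
        smul_eq_mul]
      rw [← mul_assoc, ← Complex.exp_add, ← mul_assoc, mul_comm (Complex.exp _) (Complex.ofReal _)]
      congr 3
      rw [inner_sub_right, inner_smul_right, real_inner_comm y]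
      push_cast
      field_simp
      ring
    simp_rw [this]
    rw [integral_const_mul, enorm_mul, ← ofReal_norm (Complex.exp _),
        Complex.norm_exp_ofReal_mul_I, ENNReal.ofReal_one, one_mul]
  simp_rw [e]
  rw [lintegral_comp_inv_smul hr.ne' (fun k => ‖𝓕 h k‖ₑ ^ 2), abs_of_pos hr]
  congr 1
  calc ∫⁻ k, ‖𝓕 h k‖ₑ ^ 2 = ‖(𝓕 (h2.toLp h) : StateSpace d)‖ₑ ^ 2 := by
        rw [enorm_Lp_two_sq]
        refine lintegral_congr_ae ?_
        filter_upwards [fourier_toLp_coeFn h1 h2] with k hk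
        rw [hk]
    _ = ‖h2.toLp h‖ₑ ^ 2 := by rw [enorm_fourier_sq]
    _ = _ := by
        rw [enorm_Lp_two_sq]
        refine lintegral_congr_ae ?_
        filter_upwards [h2.coeFn_toLp] with y hy
        rw [hy, hh]
        simp only
        rw [enorm_mul, mul_pow, enorm_coherentFun_sq hħ]

theorem continuous_inner_coherentState_left {ħ : ℝ} (hħ : 0 < ħ) (φ : StateSpace d) :
    Continuous fun w : Phase d => ⟪coherentState ħ w, φ⟫_ℂ :=
  (continuous_coherentState hħ).inner continuous_const

/-- Integrals over phase space of functions of the position against a Husimi density. -/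
theorem lintegral_mul_enorm_inner_coherentState {ħ : ℝ} (hħ : 0 < ħ) {m : Pos d → ℝ≥0∞}
    (hm : Measurable m) (φ : StateSpace d) :
    ∫⁻ w : Phase d, m w.1 * ‖⟪coherentState ħ w, φ⟫_ℂ‖ₑ ^ 2 =
      ENNReal.ofReal ((2 * Real.pi * ħ) ^ d) *
        ∫⁻ y, (∫⁻ a, m a * ENNReal.ofReal (gaussWeight ħ (a - y))) * ‖φ y‖ₑ ^ 2 := by
  have hmeas : Measurable fun w : Phase d => ‖⟪coherentState ħ w, φ⟫_ℂ‖ₑ ^ 2 :=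
    (continuous_inner_coherentState_left hħ φ).measurable.enorm.pow_const 2
  have hmm : Measurable fun w : Phase d => m w.1 * ‖⟪coherentState ħ w, φ⟫_ℂ‖ₑ ^ 2 :=
    (hm.comp measurable_fst).mul hmeas
  rw [Measure.volume_eq_prod, lintegral_prod _ hmm.aemeasurable]
  have e : ∀ a, ∫⁻ α, m a * ‖⟪coherentState ħ (a, α), φ⟫_ℂ‖ₑ ^ 2 =
      ENNReal.ofReal ((2 * Real.pi * ħ) ^ d) *
      ∫⁻ y, (m a * ENNReal.ofReal (gaussWeight ħ (a - y))) * ‖φ y‖ₑ ^ 2 := by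
    intro a
    have hg1 : AEMeasurable (fun y => ENNReal.ofReal (gaussWeight ħ (y - a)) * ‖φ y‖ₑ ^ 2) :=
      (Measurable.aemeasurable ((continuous_gaussWeight ħ).measurable.comp
        (measurable_id.sub_const a)).ennreal_ofReal).mul (aemeasurable_enorm_sq_coeFn φ)
    have hma : Measurable fun α : Pos d => ‖⟪coherentState ħ (a, α), φ⟫_ℂ‖ₑ ^ 2 :=
      hmeas.comp measurable_prodMk_left
    rw [lintegral_const_mul _ hma,
      lintegral_enorm_inner_coherentState_momentum hħ, mul_left_comm,
      ← lintegral_const_mul'' _ hg1]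
    congr 1
    refine lintegral_congr fun y => ?_
    rw [← mul_assoc, ← gaussWeight_neg, neg_sub]
  simp_rw [e]
  have hg : Measurable fun p : Pos d × Pos d => ENNReal.ofReal (gaussWeight ħ (p.1 - p.2)) :=
    ((continuous_gaussWeight ħ).measurable.comp (measurable_fst.sub measurable_snd)).ennreal_ofReal
  rw [lintegral_const_mul' _ _ ENNReal.ofReal_ne_top, lintegral_lintegral_swap]
  · congr 1
    refine lintegral_congr fun y => ?_
    have hmy : Measurable fun a : Pos d => m a * ENNReal.ofReal (gaussWeight ħ (a - y)) :=
      hm.mul ((continuous_gaussWeight ħ).measurable.comp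
        (measurable_id.sub_const y)).ennreal_ofReal
    rw [lintegral_mul_const _ hmy]
  · have h1 := aemeasurable_enorm_sq_coeFn φ
    have h2 : AEMeasurable (fun p : Pos d × Pos d => ‖φ p.2‖ₑ ^ 2) (volume.prod volume) :=
      h1.comp_quasiMeasurePreserving Measure.quasiMeasurePreserving_snd
    have h3 : Measurable fun p : Pos d × Pos d =>
        m p.1 * ENNReal.ofReal (gaussWeight ħ (p.1 - p.2)) := (hm.comp measurable_fst).mul hg
    exact h3.aemeasurable.mul h2

/-- The resolution of the identity by coherent states. -/
theorem lintegral_enorm_inner_coherentState {ħ : ℝ} (hħ : 0 < ħ) (φ : StateSpace d) :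
    ∫⁻ w : Phase d, ‖⟪coherentState ħ w, φ⟫_ℂ‖ₑ ^ 2 =
      ENNReal.ofReal ((2 * Real.pi * ħ) ^ d) * ‖φ‖ₑ ^ 2 := by
  have h := lintegral_mul_enorm_inner_coherentState hħ (m := fun _ => 1) measurable_const φ
  simpa [lintegral_gaussWeight hħ, enorm_Lp_two_sq] using h

/-- Up to `(2πħ)^d`, the position marginal of the Husimi density is `|φ|²` convolved with a
Gaussian, which adds the Gaussian's variance to the second moment. -/
theorem lintegral_position_husimi {ħ : ℝ} (hħ : 0 < ħ) (x : Pos d) (φ : StateSpace d) :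
    ∫⁻ w : Phase d, ‖x - w.1‖ₑ ^ 2 * ‖⟪coherentState ħ w, φ⟫_ℂ‖ₑ ^ 2 =
      ENNReal.ofReal ((2 * Real.pi * ħ) ^ d) * ((∫⁻ y, ‖x - y‖ₑ ^ 2 * ‖φ y‖ₑ ^ 2) +
        ENNReal.ofReal (d * ħ / 2) * ‖φ‖ₑ ^ 2) := by
  have hm : Measurable fun a : Pos d => ‖x - a‖ₑ ^ 2 :=
    (measurable_const.sub measurable_id).enorm.pow_const 2
  rw [lintegral_mul_enorm_inner_coherentState hħ hm]
  congr 1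
  rw [enorm_Lp_two_sq, ← lintegral_const_mul' _ _ ENNReal.ofReal_ne_top, ← lintegral_add_left']
  · refine lintegral_congr fun y => ?_
    rw [lintegral_norm_sub_sq_gaussWeight hħ, ENNReal.ofReal_add (by positivity) (by positivity),
      add_mul, enorm_sq_eq_ofReal (x - y)]
  · exact hm.aemeasurable.mul ((Lp.aestronglyMeasurable φ).enorm.pow_const 2)

theorem lintegral_comp_dualPoint {ħ : ℝ} (hħ : 0 < ħ) {f : Phase d → ℝ≥0∞} (hf : Measurable f) :
    ∫⁻ w, f (dualPoint ħ w) = ENNReal.ofReal ((2 * Real.pi * ħ) ^ d) ^ 2 * ∫⁻ w, f w := by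
  have hr : 0 < 2 * Real.pi * ħ := by positivity
  have hd : Measurable (dualPoint (d := d) ħ) := by
    refine Continuous.measurable ?_
    unfold dualPoint
    fun_prop
  have hfd : Measurable fun w => f (dualPoint ħ w) := hf.comp hd
  rw [Measure.volume_eq_prod, lintegral_prod _ hfd.aemeasurable]
  have e1 : ∀ a : Pos d, ∫⁻ α : Pos d, f (dualPoint ħ (a, α)) =
      ENNReal.ofReal ((2 * Real.pi * ħ) ^ d) *
        ∫⁻ α : Pos d, f (α, (-(2 * Real.pi * ħ))⁻¹ • a) := by
    intro a
    have := lintegral_comp_inv_smul hr.ne' fun α : Pos d => f (α, (-(2 * Real.pi * ħ))⁻¹ • a)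
    rw [abs_of_pos hr] at this
    rw [← this]
    simp [dualPoint, inv_neg]
  simp_rw [e1]
  rw [lintegral_const_mul' _ _ ENNReal.ofReal_ne_top, 
    lintegral_comp_inv_smul (neg_ne_zero.2 hr.ne') (fun a : Pos d => ∫⁻ α : Pos d, f (α, a)),
    abs_neg, abs_of_pos hr, sq, mul_assoc (ENNReal.ofReal _), lintegral_prod_symm _ hf.aemeasurable]

/-- The Fourier transform is unitary and exchanges position and momentum, so this is
`lintegral_position_husimi` for `𝓕 φ` at the parameter `dualHbar ħ`. -/
theorem lintegral_momentum_husimi {ħ : ℝ} (hħ : 0 < ħ) (ξ : Pos d) (φ : StateSpace d) :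
    ∫⁻ w : Phase d, ‖ξ - w.2‖ₑ ^ 2 * ‖⟪coherentState ħ w, φ⟫_ℂ‖ₑ ^ 2 =
      ENNReal.ofReal ((2 * Real.pi * ħ) ^ d) *
        ((∫⁻ k, ‖ξ - (2 * Real.pi * ħ) • k‖ₑ ^ 2 * ‖(𝓕 φ : StateSpace d) k‖ₑ ^ 2) +
          ENNReal.ofReal (d * ħ / 2) * ‖φ‖ₑ ^ 2) := by
  have hr : 0 < 2 * Real.pi * ħ := by positivity
  set F : Phase d → ℝ≥0∞ := fun w => ‖(2 * Real.pi * ħ)⁻¹ • ξ - w.1‖ₑ ^ 2 *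
    ‖⟪coherentState (dualHbar ħ) w, (𝓕 φ : StateSpace d)⟫_ℂ‖ₑ ^ 2 with hF
  have hFm : Measurable F :=
    ((measurable_const.sub measurable_fst).enorm.pow_const 2).mul
      ((continuous_inner_coherentState_left (dualHbar_pos hħ) _).measurable.enorm.pow_const 2)
  have e : ∀ w : Phase d, ‖ξ - w.2‖ₑ ^ 2 * ‖⟪coherentState ħ w, φ⟫_ℂ‖ₑ ^ 2 =
      ENNReal.ofReal ((2 * Real.pi * ħ) ^ 2) * F (dualPoint ħ w) := by
    intro w
    have e1 := enorm_sub_smul_sq hr ξ ((2 * Real.pi * ħ)⁻¹ • w.2)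
    rw [smul_inv_smul₀ hr.ne'] at e1
    rw [← Lp.inner_fourier_eq, fourier_coherentState hħ, inner_smul_left, e1, hF, enorm_mul,
      ← ofReal_norm (starRingEnd ℂ _), RCLike.norm_conj, Complex.norm_exp_ofReal_mul_I,
      ENNReal.ofReal_one, one_mul]
    simp only [dualPoint, mul_assoc]
  have e2 : ∫⁻ k, ‖ξ - (2 * Real.pi * ħ) • k‖ₑ ^ 2 * ‖(𝓕 φ : StateSpace d) k‖ₑ ^ 2 =
      ENNReal.ofReal ((2 * Real.pi * ħ) ^ 2) *
        ∫⁻ k, ‖(2 * Real.pi * ħ)⁻¹ • ξ - k‖ₑ ^ 2 * ‖(𝓕 φ : StateSpace d) k‖ₑ ^ 2 := by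
    rw [← lintegral_const_mul' _ _ ENNReal.ofReal_ne_top]
    refine lintegral_congr fun k => ?_
    rw [enorm_sub_smul_sq hr, mul_assoc]
  simp_rw [e]
  rw [lintegral_const_mul' _ _ ENNReal.ofReal_ne_top, lintegral_comp_dualPoint hħ hFm,
    lintegral_position_husimi (dualHbar_pos hħ), enorm_fourier_sq, e2]
  have c1 : ENNReal.ofReal (d * ħ / 2) =
      ENNReal.ofReal ((2 * Real.pi * ħ) ^ 2) * ENNReal.ofReal (d * dualHbar ħ / 2) := by
    rw [← ENNReal.ofReal_mul (by positivity), dualHbar]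
    congr 1; field_simp; ring
  -- `2π · dualHbar ħ = 1/(2πħ)`, so the Jacobian `(2πħ)^{2d}` of `dualPoint` loses half of its
  -- exponent.
  have c2 : ENNReal.ofReal ((2 * Real.pi * ħ) ^ d) ^ 2 *
      ENNReal.ofReal ((2 * Real.pi * dualHbar ħ) ^ d) = ENNReal.ofReal ((2 * Real.pi * ħ) ^ d) := by
    rw [← ENNReal.ofReal_pow (by positivity), ← ENNReal.ofReal_mul (by positivity), ← pow_mul,
      mul_comm d 2, pow_mul, ← mul_pow, dualHbar]
    congr 2; field_simp; ring
  rw [c1, mul_assoc (ENNReal.ofReal ((2 * Real.pi * ħ) ^ 2)) _ (‖φ‖ₑ ^ 2), ← mul_add,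
    ← mul_assoc (ENNReal.ofReal ((2 * Real.pi * ħ) ^ d) ^ 2), c2]
  ring

/-- In operator terms, the Töplitz quantization of `quadCost z` is `c_ħ(z) + dħ/2`. The identity
holds in `[0, ∞]`, so no domain condition on `φ` is needed. -/
theorem lintegral_quadCost_husimi {ħ : ℝ} (hħ : 0 < ħ) (z : Phase d) (φ : StateSpace d) :
    ∫⁻ w : Phase d, ENNReal.ofReal (quadCost z w) * ‖⟪coherentState ħ w, φ⟫_ℂ‖ₑ ^ 2 =
      ENNReal.ofReal ((2 * Real.pi * ħ) ^ d) *
        (costForm ħ z φ + ENNReal.ofReal (d * ħ / 2) * ‖φ‖ₑ ^ 2) := by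
  have hmeas : Measurable fun w : Phase d => ‖⟪coherentState ħ w, φ⟫_ℂ‖ₑ ^ 2 :=
    (continuous_inner_coherentState_left hħ φ).measurable.enorm.pow_const 2
  have hm1 : Measurable fun w : Phase d =>
      ‖z.1 - w.1‖ₑ ^ 2 * ‖⟪coherentState ħ w, φ⟫_ℂ‖ₑ ^ 2 :=
    Measurable.mul ((Continuous.measurable (by fun_prop :
      Continuous fun w : Phase d => z.1 - w.1)).enorm.pow_const 2) hmeas
  have e : ∀ w : Phase d, ENNReal.ofReal (quadCost z w) * ‖⟪coherentState ħ w, φ⟫_ℂ‖ₑ ^ 2 =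
      2⁻¹ * (‖z.1 - w.1‖ₑ ^ 2 * ‖⟪coherentState ħ w, φ⟫_ℂ‖ₑ ^ 2 +
        ‖z.2 - w.2‖ₑ ^ 2 * ‖⟪coherentState ħ w, φ⟫_ℂ‖ₑ ^ 2) := fun w => by
    rw [ofReal_quadCost, mul_assoc, add_mul]
  simp_rw [e]
  rw [lintegral_const_mul' _ _ (by simp), lintegral_add_left hm1, lintegral_position_husimi hħ, lintegral_momentum_husimi hħ, costForm_eq hħ]
  have h2 : (2⁻¹ : ℝ≥0∞) * 2 = 1 := ENNReal.inv_mul_cancel (by simp) (by simp)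
  have h3 : ∀ C A B N : ℝ≥0∞, 2⁻¹ * (C * (A + N) + C * (B + N)) = C * (2⁻¹ * (A + B) + N) := by
    intro C A B N
    calc _ = C * (2⁻¹ * (A + B) + (2⁻¹ * 2) * N) := by ring
      _ = _ := by rw [h2, one_mul]
  exact h3 _ _ _ _

end HusimiMoments

/-! ### The uncertainty inequality -/

section Heisenberg

variable {d : ℕ}

/-- The `n`-th derivative is bounded by `|ε|^n`, so plane waves multiply Schwartz functions and
hence tempered distributions. -/
theorem hasTemperateGrowth_cexp_mul_I (ε : ℝ) :
    Function.HasTemperateGrowth fun t : ℝ => Complex.exp (((ε * t : ℝ) : ℂ) * Complex.I) := by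
  have hit : ∀ n : ℕ, iteratedDeriv n (fun t : ℝ => Complex.exp (((ε * t : ℝ) : ℂ) * Complex.I)) =
      fun t : ℝ => (ε * Complex.I) ^ n * Complex.exp (((ε * t : ℝ) : ℂ) * Complex.I) := by
    intro n
    induction n with
    | zero => simp
    | succ n ih =>
      rw [iteratedDeriv_succ, ih]
      ext t
      have h1 : HasDerivAt (fun t : ℝ => ((ε * t : ℝ) : ℂ) * Complex.I) (ε * Complex.I) t := by
        have := (((hasDerivAt_id t).const_mul ε).ofReal_comp).mul_const Complex.I
        simpa using this
      rw [(h1.cexp.const_mul _).deriv]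
      ring
  refine ⟨?_, fun n => ⟨0, |ε| ^ n, fun t => ?_⟩⟩
  · exact ((Complex.ofRealCLM.contDiff.comp (contDiff_const.mul contDiff_id)).mul contDiff_const).cexp
  · rw [norm_iteratedFDeriv_eq_norm_iteratedDeriv, hit, norm_mul, Complex.norm_exp_ofReal_mul_I]
    simp

theorem hasTemperateGrowth_cexp_coord (ε : ℝ) (j : Fin d) :
    Function.HasTemperateGrowth fun y : Pos d => Complex.exp (((ε * y j : ℝ) : ℂ) * Complex.I) :=
  (hasTemperateGrowth_cexp_mul_I ε).comp
    (EuclideanSpace.proj j : Pos d →L[ℝ] ℝ).hasTemperateGrowth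

theorem memLp_cexp_mul (ε : ℝ) (j : Fin d) (φ : StateSpace d) :
    MemLp (fun y => Complex.exp (((ε * y j : ℝ) : ℂ) * Complex.I) * φ y) 2 := by
  refine (Lp.memLp φ).of_le (AEStronglyMeasurable.mul (Continuous.aestronglyMeasurable (by fun_prop))
    (Lp.aestronglyMeasurable φ)) (Eventually.of_forall fun y => ?_)
  rw [norm_mul, Complex.norm_exp_ofReal_mul_I, one_mul]

/-- The Leibniz rule for the multiplication by a plane wave. -/
theorem hasPartialDeriv_cexp_mul (ε : ℝ) {j : Fin d} {φ g : StateSpace d}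
    (hg : HasPartialDeriv j φ g) :
    HasPartialDeriv j ((memLp_cexp_mul ε j φ).toLp _)
      ((memLp_cexp_mul ε j (g + (ε * Complex.I) • φ)).toLp _) := by
  have hT := hasTemperateGrowth_cexp_coord (d := d) ε j
  ext u
  have hg' := congrArg (fun T : 𝓢'(Pos d, ℂ) => T (SchwartzMap.smulLeftCLM ℂ
    (fun y : Pos d => Complex.exp (((ε * y j : ℝ) : ℂ) * Complex.I)) u)) hg
  simp only [TemperedDistribution.lineDerivOp_apply_apply, Lp.toTemperedDistribution_apply,
    smul_eq_mul, neg_apply, SchwartzMap.smulLeftCLM_apply_apply hT] at hg' ⊢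
  have hder : ∀ y : Pos d, (∂_{(EuclideanSpace.single j (1 : ℝ) : Pos d)}
      (SchwartzMap.smulLeftCLM ℂ (fun y : Pos d =>
        Complex.exp (((ε * y j : ℝ) : ℂ) * Complex.I)) u)) y =
      Complex.exp (((ε * y j : ℝ) : ℂ) * Complex.I) *
        ((∂_{(EuclideanSpace.single j (1 : ℝ) : Pos d)} u) y + ε * Complex.I * u y) := by
    intro y
    rw [SchwartzMap.lineDerivOp_apply_eq_fderiv, SchwartzMap.lineDerivOp_apply_eq_fderiv,
      SchwartzMap.smulLeftCLM_apply hT]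
    have h1 : HasFDerivAt (fun y : Pos d => y j) (EuclideanSpace.proj j : Pos d →L[ℝ] ℝ) y :=
      (EuclideanSpace.proj j : Pos d →L[ℝ] ℝ).hasFDerivAt
    have h2 := (Complex.ofRealCLM.hasFDerivAt.comp y (h1.const_mul ε)).mul_const Complex.I
    have h3 := (h2.cexp.smul (u.differentiableAt (x := y)).hasFDerivAt)
    have h4 : fderiv ℝ (fun x : Pos d => Complex.exp (((ε * x j : ℝ) : ℂ) * Complex.I) • u x) y = _ :=
      h3.fderiv
    rw [h4]
    simp
    ring
  have i1 : ∀ (v : 𝓢(Pos d, ℂ)) (ψ : StateSpace d), Integrable fun y => v y * ψ y := fun v ψ =>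
    (v.memLp 2).integrable_mul (Lp.memLp ψ)
  simp_rw [hder] at hg'
  have e1 : ∫ y, -(∂_{(EuclideanSpace.single j (1 : ℝ) : Pos d)} u) y *
      (memLp_cexp_mul ε j φ).toLp _ y =
      (∫ y, -(Complex.exp (((ε * y j : ℝ) : ℂ) * Complex.I) *
        ((∂_{(EuclideanSpace.single j (1 : ℝ) : Pos d)} u) y + ε * Complex.I * u y)) * φ y) +
      ∫ y, ε * Complex.I * (SchwartzMap.smulLeftCLM ℂ (fun y : Pos d =>
        Complex.exp (((ε * y j : ℝ) : ℂ) * Complex.I)) u) y * φ y := by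
    rw [← integral_add]
    · refine integral_congr_ae ?_
      filter_upwards [(memLp_cexp_mul ε j φ).coeFn_toLp] with y hy
      rw [hy, SchwartzMap.smulLeftCLM_apply_apply hT, smul_eq_mul]
      ring
    · refine ((i1 (∂_{(EuclideanSpace.single j (1 : ℝ) : Pos d)} (SchwartzMap.smulLeftCLM ℂ
        (fun y : Pos d => Complex.exp (((ε * y j : ℝ) : ℂ) * Complex.I)) u)) φ).neg).congr
        (Eventually.of_forall fun y => ?_)
      simp only [Pi.neg_apply, hder]
      ring
    · refine ((i1 (SchwartzMap.smulLeftCLM ℂ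
        (fun y : Pos d => Complex.exp (((ε * y j : ℝ) : ℂ) * Complex.I)) u) φ).const_mul
        (ε * Complex.I)).congr (Eventually.of_forall fun y => ?_)
      simp only
      ring
  rw [e1, hg', ← integral_add]
  · refine integral_congr_ae ?_
    filter_upwards [(memLp_cexp_mul ε j (g + (ε * Complex.I) • φ)).coeFn_toLp,
      Lp.coeFn_add g ((ε * Complex.I) • φ), Lp.coeFn_smul (ε * Complex.I : ℂ) φ] with y h1 h2 h3
    rw [h1, h2, Pi.add_apply, h3, Pi.smul_apply, SchwartzMap.smulLeftCLM_apply_apply hT,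
      smul_eq_mul, smul_eq_mul]
    ring
  · refine (i1 (SchwartzMap.smulLeftCLM ℂ
        (fun y : Pos d => Complex.exp (((ε * y j : ℝ) : ℂ) * Complex.I)) u) g).congr
        (Eventually.of_forall fun y => ?_)
    simp only [SchwartzMap.smulLeftCLM_apply_apply hT, smul_eq_mul]
  · refine ((i1 (SchwartzMap.smulLeftCLM ℂ
        (fun y : Pos d => Complex.exp (((ε * y j : ℝ) : ℂ) * Complex.I)) u) φ).const_mul
        (ε * Complex.I)).congr (Eventually.of_forall fun y => ?_)
    simp only
    ring

/-- Integration by parts without boundary terms: on the Fourier side the multiplier `2πi k_j` is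
purely imaginary. -/
theorem inner_partialDeriv {j : Fin d} {φ g φ' g' : StateSpace d} (h : HasPartialDeriv j φ g)
    (h' : HasPartialDeriv j φ' g') : ⟪φ, g'⟫_ℂ = -⟪g, φ'⟫_ℂ := by
  rw [← Lp.inner_fourier_eq, ← Lp.inner_fourier_eq g, inner_Lp_eq, inner_Lp_eq, ← integral_neg]
  refine integral_congr_ae ?_
  filter_upwards [(hasPartialDeriv_iff j φ g).1 h, (hasPartialDeriv_iff j φ' g').1 h'] with k h1 h2
  rw [h1, h2]
  simp only [map_mul, Complex.conj_ofReal, Complex.conj_I, map_ofNat]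
  ring

/-- `i ε ∫ e^{iεy_j} |φ|² = -2 ∫ e^{iεy_j} Re (φ̄ ∂_jφ)`. -/
theorem integral_cexp_mul_norm_sq (ε : ℝ) {j : Fin d} {φ g : StateSpace d}
    (hg : HasPartialDeriv j φ g) :
    ε * Complex.I * ∫ y, Complex.exp (((ε * y j : ℝ) : ℂ) * Complex.I) * ((‖φ y‖ ^ 2 : ℝ) : ℂ) =
      -2 * ∫ y, Complex.exp (((ε * y j : ℝ) : ℂ) * Complex.I) *
        (((starRingEnd ℂ (φ y) * g y).re : ℝ) : ℂ) := by
  have h := inner_partialDeriv hg (hasPartialDeriv_cexp_mul ε hg)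
  rw [inner_Lp_eq, inner_Lp_eq] at h
  have i0 : ∀ (u v : StateSpace d), Integrable fun y =>
      Complex.exp (((ε * y j : ℝ) : ℂ) * Complex.I) * (starRingEnd ℂ (u y) * v y) := by
    intro u v
    have := (Lp.memLp u).star.integrable_mul (memLp_cexp_mul ε j v)
    refine this.congr (Eventually.of_forall fun y => ?_)
    simp only [Pi.mul_apply, Pi.star_apply, RCLike.star_def]
    ring
  have e1 : ∫ y, starRingEnd ℂ (φ y) * (memLp_cexp_mul ε j (g + (ε * Complex.I) • φ)).toLp _ y =
      (∫ y, Complex.exp (((ε * y j : ℝ) : ℂ) * Complex.I) * (starRingEnd ℂ (φ y) * g y)) +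
      ε * Complex.I * ∫ y, Complex.exp (((ε * y j : ℝ) : ℂ) * Complex.I) *
        ((‖φ y‖ ^ 2 : ℝ) : ℂ) := by
    rw [← integral_const_mul, ← integral_add (i0 φ g)]
    · refine integral_congr_ae ?_
      filter_upwards [(memLp_cexp_mul ε j (g + (ε * Complex.I) • φ)).coeFn_toLp,
        Lp.coeFn_add g ((ε * Complex.I) • φ), Lp.coeFn_smul (ε * Complex.I : ℂ) φ] with y h1 h2 h3
      rw [h1, h2, Pi.add_apply, h3, Pi.smul_apply, smul_eq_mul, Complex.ofReal_pow,
        ← Complex.conj_mul']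
      ring
    · refine ((i0 φ φ).const_mul (ε * Complex.I)).congr (Eventually.of_forall fun y => ?_)
      simp only [Complex.ofReal_pow, ← Complex.conj_mul']
  have e2 : ∫ y, starRingEnd ℂ (g y) * (memLp_cexp_mul ε j φ).toLp _ y =
      ∫ y, Complex.exp (((ε * y j : ℝ) : ℂ) * Complex.I) * (starRingEnd ℂ (g y) * φ y) := by
    refine integral_congr_ae ?_
    filter_upwards [(memLp_cexp_mul ε j φ).coeFn_toLp] with y h1
    rw [h1]; ring
  rw [e1, e2] at h
  have e3 : (2 : ℂ) * ∫ y, Complex.exp (((ε * y j : ℝ) : ℂ) * Complex.I) *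
        (((starRingEnd ℂ (φ y) * g y).re : ℝ) : ℂ) =
      (∫ y, Complex.exp (((ε * y j : ℝ) : ℂ) * Complex.I) * (starRingEnd ℂ (φ y) * g y)) +
      ∫ y, Complex.exp (((ε * y j : ℝ) : ℂ) * Complex.I) * (starRingEnd ℂ (g y) * φ y) := by
    rw [← integral_const_mul, ← integral_add (i0 φ g) (i0 g φ)]
    refine integral_congr_ae (Eventually.of_forall fun y => ?_)
    simp only
    rw [← mul_add, mul_left_comm]
    congr 1
    have := Complex.add_conj (starRingEnd ℂ (φ y) * g y)
    rw [map_mul, Complex.conj_conj, mul_comm (φ y)] at this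
    rw [this]; push_cast; ring
  rw [neg_mul, e3]
  linear_combination h

theorem integrable_norm_sq_coeFn (φ : StateSpace d) : Integrable fun y => ‖φ y‖ ^ 2 :=
  (memLp_two_iff_integrable_sq_norm (Lp.aestronglyMeasurable φ)).1 (Lp.memLp φ)

theorem norm_sq_eq_integral (φ : StateSpace d) : ‖φ‖ ^ 2 = ∫ y, ‖φ y‖ ^ 2 := by
  have h := @inner_self_eq_norm_sq_to_K ℂ _ _ _ _ φ
  rw [inner_Lp_eq] at h
  have h2 : ∫ y, starRingEnd ℂ (φ y) * φ y = ((∫ y, ‖φ y‖ ^ 2 : ℝ) : ℂ) := by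
    rw [← integral_complex_ofReal]
    refine integral_congr_ae (Eventually.of_forall fun y => ?_)
    simp only [Complex.conj_mul', Complex.ofReal_pow]
  rw [h2] at h
  exact Complex.ofReal_injective (by rw [h]; simp)

theorem integrable_conj_mul_re (φ g : StateSpace d) :
    Integrable fun y => (starRingEnd ℂ (φ y) * g y).re := by
  have h : Integrable fun y => starRingEnd ℂ (φ y) * g y :=
    (Lp.memLp φ).star.integrable_mul (Lp.memLp g)
  exact h.re

theorem integral_conj_mul_partialDeriv_re {j : Fin d} {φ g : StateSpace d}
    (hg : HasPartialDeriv j φ g) : ∫ y, (starRingEnd ℂ (φ y) * g y).re = 0 := by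
  have h := integral_cexp_mul_norm_sq 0 hg
  simp only [zero_mul, Complex.ofReal_zero, Complex.exp_zero, one_mul, integral_complex_ofReal] at h
  have : (∫ y, (starRingEnd ℂ (φ y) * g y).re : ℂ) = 0 := by
    rw [integral_complex_ofReal]
    linear_combination (1 / 2 : ℂ) * h
  rw [integral_complex_ofReal] at this
  exact_mod_cast this

/-- Formally this integrates `y_j` against `Re(φ̄ ∂_jφ) = ½ ∂_j|φ|²` by parts. The unbounded `y_j`
is approached by `(e^{iεy_j} - 1)/(iε)`, for which the Leibniz rule stays inside `L²`, and `ε → 0`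
by dominated convergence. -/
theorem integral_coord_mul_conj_mul_partialDeriv {j : Fin d} {φ g : StateSpace d}
    (hg : HasPartialDeriv j φ g)
    (hi : Integrable fun y : Pos d => y j * (starRingEnd ℂ (φ y) * g y).re) :
    ∫ y : Pos d, y j * (starRingEnd ℂ (φ y) * g y).re = -(1 / 2) * ‖φ‖ ^ 2 := by
  set s : Pos d → ℝ := fun y => (starRingEnd ℂ (φ y) * g y).re with hs
  have hsi : Integrable s := integrable_conj_mul_re φ g
  have hsc : Integrable fun y => ((s y : ℝ) : ℂ) := hsi.ofReal
  have key : ∀ ε : ℝ, ε ≠ 0 → Complex.I * ∫ y, Complex.exp (((ε * y j : ℝ) : ℂ) * Complex.I) *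
      ((‖φ y‖ ^ 2 : ℝ) : ℂ) = -2 * ∫ y, ((Complex.exp (((ε * y j : ℝ) : ℂ) * Complex.I) - 1) / ε) *
        ((s y : ℝ) : ℂ) := by
    intro ε hε
    have hε' : (ε : ℂ) ≠ 0 := by exact_mod_cast hε
    have h := integral_cexp_mul_norm_sq ε hg
    -- Since `s` has integral zero, `1` may be subtracted from the plane wave at no cost; this makes
    -- the difference quotient appear.
    have h0 : ∫ y, ((s y : ℝ) : ℂ) = 0 := by
      rw [integral_complex_ofReal, integral_conj_mul_partialDeriv_re hg, Complex.ofReal_zero]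
    have hE : Integrable fun y : Pos d => Complex.exp (((ε * y j : ℝ) : ℂ) * Complex.I) *
        ((s y : ℝ) : ℂ) := by
      refine hsc.mono (AEStronglyMeasurable.mul
        (Continuous.aestronglyMeasurable (by fun_prop)) hsc.aestronglyMeasurable)
        (Eventually.of_forall fun y => ?_)
      rw [norm_mul, Complex.norm_exp_ofReal_mul_I, one_mul]
    have h2 : ∫ y, ((Complex.exp (((ε * y j : ℝ) : ℂ) * Complex.I) - 1) / ε) * ((s y : ℝ) : ℂ) =
        (1 / ε) * ((∫ y, Complex.exp (((ε * y j : ℝ) : ℂ) * Complex.I) * ((s y : ℝ) : ℂ)) -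
          ∫ y, ((s y : ℝ) : ℂ)) := by
      rw [← integral_sub hE hsc, ← integral_const_mul]
      refine integral_congr_ae (Eventually.of_forall fun y => ?_)
      simp only
      field_simp
    rw [h2, h0, sub_zero]
    apply mul_left_cancel₀ hε'
    rw [← mul_assoc, h, mul_left_comm, one_div, mul_inv_cancel_left₀ hε']
  have t1 : Tendsto (fun ε : ℝ => Complex.I * ∫ y : Pos d,
      Complex.exp (((ε * y j : ℝ) : ℂ) * Complex.I) * ((‖φ y‖ ^ 2 : ℝ) : ℂ)) (𝓝[≠] 0)
      (𝓝 (Complex.I * ∫ y : Pos d, ((‖φ y‖ ^ 2 : ℝ) : ℂ))) := by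
    refine Tendsto.const_mul _ (tendsto_integral_filter_of_dominated_convergence
      (fun y => ‖φ y‖ ^ 2) ?_ ?_ (integrable_norm_sq_coeFn φ) ?_)
    · exact Eventually.of_forall fun ε => AEStronglyMeasurable.mul
        (Continuous.aestronglyMeasurable (by fun_prop))
        (integrable_norm_sq_coeFn φ).ofReal.aestronglyMeasurable
    · refine Eventually.of_forall fun ε => Eventually.of_forall fun y => ?_
      rw [norm_mul, Complex.norm_exp_ofReal_mul_I, one_mul, Complex.norm_real, Real.norm_of_nonneg]
      positivity
    · refine Eventually.of_forall fun y => ?_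
      have hc : Continuous fun ε : ℝ => Complex.exp (((ε * y j : ℝ) : ℂ) * Complex.I) *
        ((‖φ y‖ ^ 2 : ℝ) : ℂ) := by fun_prop
      have := (hc.tendsto 0).mono_left (nhdsWithin_le_nhds (s := {0}ᶜ))
      simpa using this
  have t2 : Tendsto (fun ε : ℝ => -2 * ∫ y : Pos d,
      ((Complex.exp (((ε * y j : ℝ) : ℂ) * Complex.I) - 1) / ε) * ((s y : ℝ) : ℂ)) (𝓝[≠] 0)
      (𝓝 (-2 * ∫ y : Pos d, (y j * Complex.I) * ((s y : ℝ) : ℂ))) := by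
    -- The difference quotients are dominated by `|y_j|`, from `|e^{it} - 1| ≤ |t|`; the hypothesis
    -- `hi` makes this an integrable bound.
    refine Tendsto.const_mul _ (tendsto_integral_filter_of_dominated_convergence
      (fun y => ‖y j * s y‖) ?_ ?_ hi.norm ?_)
    · exact Eventually.of_forall fun ε => AEStronglyMeasurable.mul
        (Continuous.aestronglyMeasurable (by fun_prop)) hsc.aestronglyMeasurable
    · refine Eventually.of_forall fun ε => Eventually.of_forall fun y => ?_
      rw [norm_mul, norm_mul, Complex.norm_real, norm_div, Complex.norm_real]
      gcongr
      by_cases hε : ε = 0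
      · simp [hε]
      rw [div_le_iff₀ (norm_pos_iff.2 hε), mul_comm (Complex.ofReal _)]
      refine (Real.norm_exp_I_mul_ofReal_sub_one_le).trans ?_
      rw [norm_mul, mul_comm]
    · refine Eventually.of_forall fun y => Tendsto.mul_const _ ?_
      have h1 : HasDerivAt (fun ε : ℝ => Complex.exp (((ε * y j : ℝ) : ℂ) * Complex.I))
          (y j * Complex.I) 0 := by
        have := ((((hasDerivAt_id (0 : ℝ)).mul_const (y j)).ofReal_comp).mul_const Complex.I).cexp
        simpa using this
      have h2 := h1.tendsto_slope
      refine h2.congr fun ε => ?_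
      simp [slope_def_module, div_eq_inv_mul]
  have h := tendsto_nhds_unique (t1.congr' (by
    filter_upwards [self_mem_nhdsWithin] with ε hε using key ε hε)) t2
  have h3 : ∫ y : Pos d, (y j * Complex.I) * ((s y : ℝ) : ℂ) =
      Complex.I * ((∫ y : Pos d, y j * s y : ℝ) : ℂ) := by
    rw [← integral_complex_ofReal, ← integral_const_mul]
    refine integral_congr_ae (Eventually.of_forall fun y => ?_)
    simp only [Complex.ofReal_mul]; ring
  rw [h3, integral_complex_ofReal, ← norm_sq_eq_integral] at h
  have h4 : ((‖φ‖ ^ 2 : ℝ) : ℂ) = ((-2 * ∫ y : Pos d, y j * s y : ℝ) : ℂ) := by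
    apply mul_left_cancel₀ Complex.I_ne_zero
    rw [h]; push_cast; ring
  have h5 : ‖φ‖ ^ 2 = -2 * ∫ y : Pos d, y j * s y := by exact_mod_cast h4
  linarith

/-- With `t = x_j - y_j` and `v = (ξ_j + iħ∂_j)φ`, integrate `|tφ + iv|² ≥ 0`. The cross term is `2ħ
t Re(φ̄ ∂_jφ)`, whose integral is `ħ‖φ‖²` by the commutator computation
`integral_coord_mul_conj_mul_partialDeriv`. -/
theorem heisenberg_coord {ħ : ℝ} (hħ : 0 < ħ) (z : Phase d) (j : Fin d) (φ : StateSpace d) :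
    ENNReal.ofReal ħ * ‖φ‖ₑ ^ 2 ≤
      (∫⁻ y : Pos d, ‖z.1 j - y j‖ₑ ^ 2 * ‖φ y‖ₑ ^ 2) + momentumForm ħ z.2 j φ := by
  by_cases ht : ∫⁻ y : Pos d, ‖z.1 j - y j‖ₑ ^ 2 * ‖φ y‖ₑ ^ 2 = ⊤
  · simp [ht]
  rw [momentumForm, ENNReal.add_iInf]
  refine le_iInf fun g => ?_
  rw [ENNReal.add_iInf]
  refine le_iInf fun hg => ?_
  set v : StateSpace d := ((z.2 j : ℝ) : ℂ) • φ + (Complex.I * (ħ : ℂ)) • g with hv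
  have hm : AEStronglyMeasurable (fun y : Pos d => ((z.1 j - y j : ℝ) : ℂ) * φ y) volume :=
    AEStronglyMeasurable.mul (Continuous.aestronglyMeasurable (by fun_prop))
      (Lp.aestronglyMeasurable _)
  have h1 : MemLp (fun y : Pos d => ((z.1 j - y j : ℝ) : ℂ) * φ y) 2 volume := by
    refine ⟨hm, ?_⟩
    rw [eLpNorm_lt_top_iff_lintegral_rpow_enorm_lt_top (by simp) (by simp)]
    refine lt_of_eq_of_lt ?_ (lt_top_iff_ne_top.2 ht)
    refine lintegral_congr fun k => ?_
    rw [enorm_mul, enorm_ofReal_complex, ENNReal.toReal_ofNat, ENNReal.rpow_ofNat, mul_pow]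
  have hu2 := (memLp_two_iff_integrable_sq_norm hm).1 h1
  have hs := integrable_conj_mul_re φ g
  have hxs : Integrable fun y : Pos d => (z.1 j - y j) * (starRingEnd ℂ (φ y) * g y).re := by
    have h2 : Integrable fun y : Pos d => starRingEnd ℂ (((z.1 j - y j : ℝ) : ℂ) * φ y) * g y :=
      h1.star.integrable_mul (Lp.memLp g)
    refine h2.re.congr (Eventually.of_forall fun y => ?_)
    simp only [map_mul, Complex.conj_ofReal, mul_assoc]
    exact Complex.re_ofReal_mul _ _
  have hys : Integrable fun y : Pos d => y j * (starRingEnd ℂ (φ y) * g y).re := by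
    refine ((hs.const_mul (z.1 j)).sub hxs).congr (Eventually.of_forall fun y => ?_)
    simp only [Pi.sub_apply]; ring
  have hI : ∫ y : Pos d, (z.1 j - y j) * (starRingEnd ℂ (φ y) * g y).re = 1 / 2 * ‖φ‖ ^ 2 := by
    have e : ∀ y : Pos d, (z.1 j - y j) * (starRingEnd ℂ (φ y) * g y).re =
      z.1 j * (starRingEnd ℂ (φ y) * g y).re - y j * (starRingEnd ℂ (φ y) * g y).re :=
      fun y => by ring
    simp_rw [e]
    rw [integral_sub (hs.const_mul _) hys, integral_const_mul, integral_conj_mul_partialDeriv_re hg,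
      integral_coord_mul_conj_mul_partialDeriv hg hys]
    ring
  have hpt : ∀ᵐ y : Pos d, 2 * ħ * ((z.1 j - y j) * (starRingEnd ℂ (φ y) * g y).re) ≤
      ‖((z.1 j - y j : ℝ) : ℂ) * φ y‖ ^ 2 + ‖v y‖ ^ 2 := by
    filter_upwards [Lp.coeFn_add (((z.2 j : ℝ) : ℂ) • φ) ((Complex.I * (ħ : ℂ)) • g),
      Lp.coeFn_smul ((z.2 j : ℝ) : ℂ) φ, Lp.coeFn_smul (Complex.I * (ħ : ℂ)) g] with y h1 h2 h3
    have hvy : v y = ((z.2 j : ℝ) : ℂ) * φ y + (Complex.I * (ħ : ℂ)) * g y := by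
      rw [hv, h1, Pi.add_apply, h2, h3]; rfl
    rw [hvy, ← Complex.normSq_eq_norm_sq, ← Complex.normSq_eq_norm_sq]
    simp only [Complex.normSq_apply, Complex.mul_re, Complex.mul_im, Complex.add_re,
      Complex.add_im, Complex.ofReal_re, Complex.ofReal_im, Complex.I_re, Complex.I_im,
      Complex.conj_re, Complex.conj_im]
    generalize z.1 j - y j = t
    -- The two squares are those of the real and imaginary parts of `tφ + iv`. The `ξ_j` part of the
    -- cross term is purely imaginary and drops out.
    nlinarith [sq_nonneg (t * (φ y).re + (-(z.2 j * (φ y).im) - ħ * (g y).re)),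
      sq_nonneg (t * (φ y).im + (z.2 j * (φ y).re - ħ * (g y).im))]
  have hv2 := integrable_norm_sq_coeFn v
  have hfin := integral_mono_ae (hxs.const_mul (2 * ħ)) (hu2.add hv2) hpt
  have e5 : ∫ y, ((fun y : Pos d => ‖((z.1 j - y j : ℝ) : ℂ) * φ y‖ ^ 2) +
      fun y => ‖v y‖ ^ 2) y = (∫ y : Pos d, ‖((z.1 j - y j : ℝ) : ℂ) * φ y‖ ^ 2) + ‖v‖ ^ 2 := by
    rw [norm_sq_eq_integral v, ← integral_add hu2 hv2]; rfl
  rw [e5, integral_const_mul, hI] at hfin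
  have e6 : ∫⁻ y : Pos d, ‖z.1 j - y j‖ₑ ^ 2 * ‖φ y‖ₑ ^ 2 =
      ENNReal.ofReal (∫ y : Pos d, ‖((z.1 j - y j : ℝ) : ℂ) * φ y‖ ^ 2) := by
    rw [ofReal_integral_eq_lintegral_ofReal hu2 (Eventually.of_forall fun y => sq_nonneg _)]
    refine lintegral_congr fun y => ?_
    rw [← enorm_sq_eq_ofReal, enorm_mul, enorm_ofReal_complex, mul_pow]
  rw [e6, enorm_sq_eq_ofReal, enorm_sq_eq_ofReal, ← ENNReal.ofReal_mul hħ.le,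
    ← ENNReal.ofReal_add (integral_nonneg fun y => sq_nonneg _) (sq_nonneg _)]
  exact ENNReal.ofReal_le_ofReal (by linarith)

/-- Heisenberg's inequality: `c_ħ(x, ξ) ≥ dħ/2`. -/
theorem heisenberg {ħ : ℝ} (hħ : 0 < ħ) (z : Phase d) (φ : StateSpace d) :
    ENNReal.ofReal (d * ħ / 2) * ‖φ‖ₑ ^ 2 ≤ costForm ħ z φ := by
  have h1 : positionForm z.1 φ = ∑ j, ∫⁻ y : Pos d, ‖z.1 j - y j‖ₑ ^ 2 * ‖φ y‖ₑ ^ 2 := by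
    unfold positionForm
    rw [← lintegral_finsetSum']
    · refine lintegral_congr fun y => ?_
      rw [enorm_sq_euclidean, Finset.sum_mul]; rfl
    · intro j _
      have hm : Measurable fun y : Pos d => ‖z.1 j - y j‖ₑ ^ 2 :=
        (Continuous.measurable (by fun_prop : Continuous fun y : Pos d => z.1 j - y j)).enorm.pow_const 2
      exact hm.aemeasurable.mul (aemeasurable_enorm_sq_coeFn φ)
  rw [costForm, h1, ← Finset.sum_add_distrib]
  calc _ = 2⁻¹ * ∑ _j : Fin d, ENNReal.ofReal ħ * ‖φ‖ₑ ^ 2 := by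
        rw [Finset.sum_const, Finset.card_univ, Fintype.card_fin, nsmul_eq_mul, ← mul_assoc,
          ← mul_assoc]
        congr 1
        rw [show (2⁻¹ : ℝ≥0∞) = ENNReal.ofReal (1 / 2) by
          rw [one_div, ENNReal.ofReal_inv_of_pos (by norm_num)]; simp, ← ENNReal.ofReal_natCast d,
          ← ENNReal.ofReal_mul (by norm_num), ← ENNReal.ofReal_mul (by positivity)]
        congr 1; ring
    _ ≤ _ := by gcongr with j; exact heisenberg_coord hħ z j φ

end Heisenberg

/-! ### Couplings built from Töplitz operators -/

section ToeplitzCouplings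

variable {d : ℕ}

/-- The orthogonal projection `|w⟩⟨w|` on a coherent state. -/
def coherentProj (ħ : ℝ) (w : Phase d) : StateSpace d →L[ℂ] StateSpace d :=
  InnerProductSpace.rankOne ℂ (coherentState ħ w) (coherentState ħ w)

theorem continuous_coherentProj {ħ : ℝ} (hħ : 0 < ħ) :
    Continuous (coherentProj ħ : Phase d → _) := by
  have h := continuous_coherentState (d := d) hħ
  refine continuous_iff_continuousAt.2 fun a => tendsto_iff_norm_sub_tendsto_zero.2 ?_
  have h0 : Tendsto (fun w => 2 * ‖coherentState ħ w - coherentState ħ a‖) (𝓝 a) (𝓝 0) := by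
    simpa using (tendsto_iff_norm_sub_tendsto_zero.1 (h.tendsto a)).const_mul 2
  refine squeeze_zero (fun _ => norm_nonneg _) (fun w => ?_) h0
  have h1 : coherentProj ħ w - coherentProj ħ a =
      InnerProductSpace.rankOne ℂ (coherentState ħ w - coherentState ħ a) (coherentState ħ w) +
      InnerProductSpace.rankOne ℂ (coherentState ħ a) (coherentState ħ w - coherentState ħ a) := by
    simp [coherentProj]
  rw [h1]
  refine (norm_add_le _ _).trans (le_of_eq ?_)
  rw [InnerProductSpace.norm_rankOne, InnerProductSpace.norm_rankOne, norm_coherentState hħ,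
    norm_coherentState hħ]
  ring

theorem norm_coherentProj {ħ : ℝ} (hħ : 0 < ħ) (w : Phase d) : ‖coherentProj ħ w‖ = 1 := by
  rw [coherentProj, InnerProductSpace.norm_rankOne, norm_coherentState hħ, mul_one]

theorem integrable_coherentProj {ħ : ℝ} (hħ : 0 < ħ) (ν : Measure (Phase d)) [IsFiniteMeasure ν] :
    Integrable (coherentProj ħ) ν :=
  (integrable_const (1 : ℝ)).mono' (continuous_coherentProj hħ).aestronglyMeasurable
    (Eventually.of_forall fun w => (norm_coherentProj hħ w).le)

theorem integrable_norm_inner_coherentState_sq {ħ : ℝ} (hħ : 0 < ħ) (ν : Measure (Phase d))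
    [IsFiniteMeasure ν] (f : StateSpace d) :
    Integrable (fun w => ‖⟪coherentState ħ w, f⟫_ℂ‖ ^ 2) ν := by
  refine (integrable_const (‖f‖ ^ 2)).mono'
    ((continuous_inner_coherentState_left hħ f).norm.pow 2).aestronglyMeasurable
    (Eventually.of_forall fun w => ?_)
  rw [Real.norm_of_nonneg (by positivity)]
  gcongr
  simpa [norm_coherentState hħ] using norm_inner_le_norm (𝕜 := ℂ) (coherentState ħ w) f

theorem inner_integral_coherentProj {ħ : ℝ} (hħ : 0 < ħ) (ν : Measure (Phase d))
    [IsFiniteMeasure ν] (f : StateSpace d) :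
    ⟪f, (∫ w, coherentProj ħ w ∂ν) f⟫_ℂ =
      ((∫ w, ‖⟪coherentState ħ w, f⟫_ℂ‖ ^ 2 ∂ν : ℝ) : ℂ) := by
  have hi := integrable_coherentProj hħ ν
  rw [ContinuousLinearMap.integral_apply hi, ← integral_inner (hi.apply_continuousLinearMap f),
    ← integral_complex_ofReal]
  refine integral_congr_ae (Eventually.of_forall fun w => ?_)
  simp only [coherentProj, InnerProductSpace.rankOne_apply, inner_smul_right]
  rw [← inner_conj_symm f, Complex.mul_conj, Complex.normSq_eq_norm_sq]

theorem isPositive_integral_coherentProj {ħ : ℝ} (hħ : 0 < ħ) (ν : Measure (Phase d))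
    [IsFiniteMeasure ν] : (∫ w, coherentProj ħ w ∂ν).IsPositive := by
  rw [ContinuousLinearMap.isPositive_iff_complex]
  intro f
  rw [← inner_conj_symm, inner_integral_coherentProj hħ, Complex.conj_ofReal]
  exact ⟨by simp, by
    rw [RCLike.re_eq_complex_re, Complex.ofReal_re]
    exact integral_nonneg fun w => sq_nonneg _⟩

theorem re_inner_integral_coherentProj {ħ : ℝ} (hħ : 0 < ħ) (ν : Measure (Phase d))
    [IsFiniteMeasure ν] (f : StateSpace d) :
    ENNReal.ofReal (RCLike.re ⟪f, (∫ w, coherentProj ħ w ∂ν) f⟫_ℂ) =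
      ∫⁻ w, ‖⟪coherentState ħ w, f⟫_ℂ‖ₑ ^ 2 ∂ν := by
  rw [inner_integral_coherentProj hħ, RCLike.re_eq_complex_re, Complex.ofReal_re,
    ofReal_integral_eq_lintegral_ofReal (integrable_norm_inner_coherentState_sq hħ ν f)
      (Eventually.of_forall fun w => sq_nonneg _)]
  simp_rw [enorm_sq_eq_ofReal]

theorem measurable_enorm_inner_coherentState_sq {ħ : ℝ} (hħ : 0 < ħ) (f : StateSpace d) :
    Measurable fun w : Phase d => ‖⟪coherentState ħ w, f⟫_ℂ‖ₑ ^ 2 :=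
  (continuous_inner_coherentState_left hħ f).measurable.enorm.pow_const 2

/-- The trace of `T A T*` for the superposition `A` of coherent states. -/
theorem tsum_enorm_clm_posSqrt_coherent {ħ : ℝ} (hħ : 0 < ħ) (ν : Measure (Phase d))
    [IsFiniteMeasure ν] (T : StateSpace d →L[ℂ] StateSpace d) :
    ∑' i, ‖T (posSqrt (∫ w, coherentProj ħ w ∂ν) (stdBasis d i))‖ₑ ^ 2 =
      ∫⁻ w, ‖T (coherentState ħ w)‖ₑ ^ 2 ∂ν := by
  rw [tsum_enorm_clm_posSqrt _ (isPositive_integral_coherentProj hħ ν)]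
  simp_rw [re_inner_integral_coherentProj hħ]
  rw [← lintegral_tsum fun i => (measurable_enorm_inner_coherentState_sq hħ _).aemeasurable]
  refine lintegral_congr fun w => ?_
  simp_rw [ContinuousLinearMap.adjoint_inner_right]
  exact hilbertBasis_enorm_sq' _ _

theorem opTrace_integral_coherentProj {ħ : ℝ} (hħ : 0 < ħ) (ν : Measure (Phase d))
    [IsFiniteMeasure ν] : opTrace (∫ w, coherentProj ħ w ∂ν) = ν Set.univ := by
  rw [opTrace_eq_tsum_posSqrt (isPositive_integral_coherentProj hħ ν)]
  have h := tsum_enorm_clm_posSqrt_coherent hħ ν (ContinuousLinearMap.id ℂ _)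
  simp only [ContinuousLinearMap.id_apply] at h
  rw [h]
  simp [← ofReal_norm, norm_coherentState hħ]

/-- The trace formula `tsum_enorm_clm_posSqrt_coherent` needs a bounded operator. A weight truncated
at height `n` supplies one, and `lintegral_sq_eq_iSup` removes the truncation afterwards. -/
theorem exists_mulCLM {b : Pos d → ℝ} (hb : Continuous b) {C : ℝ} (hC : ∀ y, ‖b y‖ ≤ C) :
    ∃ M : StateSpace d →L[ℂ] StateSpace d, ∀ h : StateSpace d,
      ‖M h‖ₑ ^ 2 = ∫⁻ y, ‖b y‖ₑ ^ 2 * ‖h y‖ₑ ^ 2 := by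
  have hb' : MemLp (fun y => (b y : ℂ)) ∞ (volume : Measure (Pos d)) :=
    memLp_top_of_bound (by fun_prop) C (Eventually.of_forall fun y => by simpa using hC y)
  refine ⟨(ContinuousLinearMap.mul ℂ ℂ).holderL volume ∞ 2 2 (hb'.toLp _), fun h => ?_⟩
  rw [enorm_Lp_two_sq]
  refine lintegral_congr_ae ?_
  filter_upwards [(ContinuousLinearMap.mul ℂ ℂ).coeFn_holder (r := 2) (hb'.toLp _) h,
    hb'.coeFn_toLp] with y h1 h2
  have h3 : ((ContinuousLinearMap.mul ℂ ℂ).holderL volume ∞ 2 2 (hb'.toLp _)) h y =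
    (ContinuousLinearMap.mul ℂ ℂ).holder 2 (hb'.toLp _) h y := rfl
  rw [h3, h1, h2, ContinuousLinearMap.mul_apply', enorm_mul, enorm_ofReal_complex, mul_pow]

theorem lintegral_sq_eq_iSup {b : Pos d → ℝ} (hb : Continuous b) (hb0 : ∀ y, 0 ≤ b y)
    (h : StateSpace d) :
    ∫⁻ y, ‖b y‖ₑ ^ 2 * ‖h y‖ₑ ^ 2 =
      ⨆ n : ℕ, ∫⁻ y, ‖min (b y) n‖ₑ ^ 2 * ‖h y‖ₑ ^ 2 := by
  have hmon : ∀ y, Monotone fun n : ℕ => ‖min (b y) n‖ₑ ^ 2 * ‖h y‖ₑ ^ 2 := by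
    intro y n m hnm
    dsimp only
    have h1 : (0 : ℝ) ≤ min (b y) n := le_min (hb0 y) (Nat.cast_nonneg n)
    rw [Real.enorm_eq_ofReal h1, Real.enorm_eq_ofReal (le_min (hb0 y) (Nat.cast_nonneg m))]
    gcongr
  rw [← lintegral_iSup']
  · refine lintegral_congr fun y => le_antisymm ?_ (iSup_le fun n => ?_)
    · obtain ⟨n, hn⟩ := exists_nat_ge (b y)
      refine le_iSup_of_le n ?_
      rw [min_eq_left hn]
    · rw [Real.enorm_eq_ofReal (le_min (hb0 y) (Nat.cast_nonneg n)), Real.enorm_eq_ofReal (hb0 y)]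
      gcongr
      exact min_le_left _ _
  · intro n
    have hm : Measurable fun y : Pos d => ‖min (b y) n‖ₑ ^ 2 :=
      (Continuous.measurable (by fun_prop : Continuous fun y => min (b y) (n : ℝ))).enorm.pow_const 2
    exact hm.aemeasurable.mul (aemeasurable_enorm_sq_coeFn h)
  · exact Eventually.of_forall hmon

/-- A multiplication form (in a suitable representation) evaluated on a superposition. -/
theorem tsum_mulForm_le {ħ : ℝ} (hħ : 0 < ħ) (ν : Measure (Phase d)) [IsFiniteMeasure ν]
    (U : StateSpace d →L[ℂ] StateSpace d) {b : Pos d → ℝ} (hb : Continuous b)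
    (hb0 : ∀ y, 0 ≤ b y) :
    ∑' i, ∫⁻ y, ‖b y‖ₑ ^ 2 * ‖U (posSqrt (∫ w, coherentProj ħ w ∂ν) (stdBasis d i)) y‖ₑ ^ 2 ≤
      ∫⁻ w, (∫⁻ y, ‖b y‖ₑ ^ 2 * ‖U (coherentState ħ w) y‖ₑ ^ 2) ∂ν := by
  -- Only finite partial sums are treated, since they commute with the monotone supremum over
  -- truncation levels. Each truncated partial sum is then at most the full truncated trace.
  rw [ENNReal.tsum_eq_iSup_sum]
  refine iSup_le fun s => ?_
  simp_rw [lintegral_sq_eq_iSup hb hb0]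
  rw [ENNReal.finsetSum_iSup_of_monotone]
  · refine iSup_le fun n => ?_
    obtain ⟨M, hM⟩ := exists_mulCLM (d := d) (b := fun y => min (b y) n) (by fun_prop) (C := n)
      (fun y => by
        rw [Real.norm_of_nonneg (le_min (hb0 y) (Nat.cast_nonneg n))]
        exact min_le_right _ _)
    simp_rw [← hM]
    refine (ENNReal.sum_le_tsum s).trans ?_
    have h := tsum_enorm_clm_posSqrt_coherent hħ ν (M ∘L U)
    simp only [ContinuousLinearMap.comp_apply] at h
    rw [h]
    refine lintegral_mono fun w => ?_
    simp_rw [hM]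
    exact le_iSup (fun n : ℕ => ∫⁻ y, ‖min (b y) n‖ₑ ^ 2 * ‖U (coherentState ħ w) y‖ₑ ^ 2) n
  · intro i n m hnm
    refine lintegral_mono fun y => ?_
    rw [Real.enorm_eq_ofReal (le_min (hb0 y) (Nat.cast_nonneg n)),
      Real.enorm_eq_ofReal (le_min (hb0 y) (Nat.cast_nonneg m))]
    gcongr

/-- The cost form is a multiplication form in position plus one in momentum, so `tsum_mulForm_le`
applies with `U` the identity and then with `U` the Fourier transform. On each coherent state the
two parts recombine by `costForm_coherentState`. -/
theorem costTrace_coherent_le {ħ : ℝ} (hħ : 0 < ħ) (z : Phase d) (ν : Measure (Phase d))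
    [IsFiniteMeasure ν] :
    costTrace ħ z (∫ w, coherentProj ħ w ∂ν) ≤
      ∫⁻ w, ENNReal.ofReal (quadCost z w + d * ħ / 2) ∂ν := by
  have h1 := tsum_mulForm_le hħ ν (ContinuousLinearMap.id ℂ _) (b := fun y => ‖z.1 - y‖)
    (by fun_prop) (fun y => norm_nonneg _)
  have h2 := tsum_mulForm_le hħ ν (Lp.fourierTransformₗᵢ (Pos d) ℂ).toContinuousLinearEquiv.toContinuousLinearMap
    (b := fun y => ‖z.2 - (2 * Real.pi * ħ) • y‖) (by fun_prop) (fun y => norm_nonneg _)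
  simp only [enorm_norm, ContinuousLinearMap.id_apply] at h1 h2
  have e : ∀ w, ENNReal.ofReal (quadCost z w + d * ħ / 2) =
      2⁻¹ * ((∫⁻ y, ‖z.1 - y‖ₑ ^ 2 * ‖coherentState ħ w y‖ₑ ^ 2) +
      ∫⁻ k, ‖z.2 - (2 * Real.pi * ħ) • k‖ₑ ^ 2 *
        ‖(𝓕 (coherentState ħ w) : StateSpace d) k‖ₑ ^ 2) := fun w => by
    rw [← costForm_eq hħ, costForm_coherentState hħ]
  have e1 : ∀ w, ∫⁻ y, ‖z.1 - y‖ₑ ^ 2 * ‖coherentState ħ w y‖ₑ ^ 2 =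
      ENNReal.ofReal (‖z.1 - w.1‖ ^ 2 + d * ħ / 2) := fun w => by
    rw [← lintegral_norm_sub_sq_gaussWeight hħ]
    refine lintegral_congr_ae ?_
    filter_upwards [coherentState_coeFn hħ w] with y hy
    rw [hy, enorm_coherentFun_sq hħ]
  have hm : Measurable fun w : Phase d => ∫⁻ y, ‖z.1 - y‖ₑ ^ 2 * ‖coherentState ħ w y‖ₑ ^ 2 := by
    simp_rw [e1]
    exact Measurable.ennreal_ofReal (Continuous.measurable (by fun_prop))
  rw [costTrace_eq]
  simp_rw [e, costForm_eq hħ]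
  rw [ENNReal.tsum_mul_left, ENNReal.tsum_add, lintegral_const_mul' _ _ (by simp),
    lintegral_add_left hm]
  gcongr
  exact h2

theorem hybridE_sq (ħ : ℝ) (p : Phase d → ℝ) (R : StateSpace d →L[ℂ] StateSpace d) :
    hybridE ħ p R ^ 2 =
      ⨅ (Q : Phase d → (StateSpace d →L[ℂ] StateSpace d)) (_ : IsCoupling p R Q),
        ∫⁻ z, costTrace ħ z (Q z) := by
  rw [hybridE, ← ENNReal.rpow_natCast, ← ENNReal.rpow_mul]
  norm_num

theorem distMK_sq (μ ν : Measure (Phase d)) :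
    distMK μ ν ^ 2 = ⨅ (π : Measure (Phase d × Phase d)) (_ : IsMeasureCoupling μ ν π),
      ∫⁻ zw, ENNReal.ofReal (quadCost zw.1 zw.2) ∂π := by
  rw [distMK, ← ENNReal.rpow_natCast, ← ENNReal.rpow_mul]
  norm_num

theorem IsProbabilityDensity.lintegral_eq_one {p : Phase d → ℝ} (hp : IsProbabilityDensity p) :
    ∫⁻ z, ENNReal.ofReal (p z) = 1 := by
  rw [← ofReal_integral_eq_lintegral_ofReal hp.integrable hp.nonneg, hp.integral_eq_one,
    ENNReal.ofReal_one]

theorem IsProbabilityDensity.aemeasurable_ofReal {p : Phase d → ℝ} (hp : IsProbabilityDensity p) :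
    AEMeasurable (fun z => ENNReal.ofReal (p z)) :=
  hp.integrable.aestronglyMeasurable.aemeasurable.ennreal_ofReal

theorem IsProbabilityDensity.isProbabilityMeasure {p : Phase d → ℝ} (hp : IsProbabilityDensity p) :
    IsProbabilityMeasure (densityMeasure p) :=
  ⟨by rw [densityMeasure, withDensity_apply _ MeasurableSet.univ, Measure.restrict_univ,
    hp.lintegral_eq_one]⟩

theorem toeplitz_eq {ħ : ℝ} (hħ : 0 < ħ) (μ : Measure (Phase d)) :
    toeplitz ħ (ENNReal.ofReal ((2 * Real.pi * ħ) ^ d) • μ) = ∫ w, coherentProj ħ w ∂μ := by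
  have h : 0 < (2 * Real.pi * ħ) ^ d := by positivity
  rw [toeplitz, integral_smul_measure, ENNReal.toReal_ofReal h.le, smul_smul,
    inv_mul_cancel₀ h.ne', one_smul]
  rfl

theorem continuous_quadCost : Continuous fun zw : Phase d × Phase d => quadCost zw.1 zw.2 := by
  unfold quadCost; fun_prop

theorem isDensityOperator_toeplitz {ħ : ℝ} (hħ : 0 < ħ) (μ : Measure (Phase d))
    [IsProbabilityMeasure μ] :
    IsDensityOperator (toeplitz ħ (ENNReal.ofReal ((2 * Real.pi * ħ) ^ d) • μ)) := by
  rw [toeplitz_eq hħ]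
  exact ⟨isPositive_integral_coherentProj hħ μ, by rw [opTrace_integral_coherentProj hħ]; simp⟩

/-- From a classical coupling `π = p(z)dz π_z(dw)`, take `Q(z) = p(z) ∫ |w⟩⟨w| π_z(dw)`. The second
marginal gives `∫ Q = ∫ |w⟩⟨w| μ(dw)`, and the cost of `Q` is at most that of `π` plus `dħ/2`. If no
coupling exists, the right-hand side is `∞`. -/
theorem hybridE_toeplitz_sq_le {ħ : ℝ} (hħ : 0 < ħ) {p : Phase d → ℝ}
    (hp : IsProbabilityDensity p) (μ : Measure (Phase d)) :
    hybridE ħ p (toeplitz ħ (ENNReal.ofReal ((2 * Real.pi * ħ) ^ d) • μ)) ^ 2 ≤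
      distMK (densityMeasure p) μ ^ 2 + ENNReal.ofReal ((1 / 2) * d * ħ) := by
  have := hp.isProbabilityMeasure
  rw [hybridE_sq, distMK_sq, toeplitz_eq hħ, ENNReal.iInf_add]
  refine le_iInf fun π => ?_
  rw [ENNReal.iInf_add]
  refine le_iInf fun hπ => ?_
  obtain ⟨hπ1, hπ2⟩ := hπ
  have : IsProbabilityMeasure π := by
    refine ⟨?_⟩
    rw [← Set.preimage_univ (f := (Prod.fst : Phase d × Phase d → Phase d)),
      ← Measure.map_apply measurable_fst MeasurableSet.univ, hπ1, measure_univ]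
  have hdis : densityMeasure p ⊗ₘ π.condKernel = π := by
    rw [← hπ1]; exact π.disintegrate π.condKernel
  have hsm : StronglyMeasurable fun z => ∫ w, coherentProj ħ w ∂(π.condKernel z) :=
    StronglyMeasurable.integral_kernel (continuous_coherentProj hħ).stronglyMeasurable
  -- The weight `p z` is absorbed into the measure, so that `Q z` is itself a superposition of
  -- coherent projections by a finite measure.
  have hQ : ∀ z, 0 ≤ p z → p z • ∫ w, coherentProj ħ w ∂(π.condKernel z) =
      ∫ w, coherentProj ħ w ∂(ENNReal.ofReal (p z) • π.condKernel z) := fun z hz => by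
    rw [integral_smul_measure, ENNReal.toReal_ofReal hz]
  have hfin : ∀ z, IsFiniteMeasure (ENNReal.ofReal (p z) • π.condKernel z) := fun z =>
    Measure.smul_finite _ ENNReal.ofReal_ne_top
  have hcoup : IsCoupling p (∫ w, coherentProj ħ w ∂μ)
      (fun z => p z • ∫ w, coherentProj ħ w ∂(π.condKernel z)) := by
    refine ⟨hp.integrable.aestronglyMeasurable.smul hsm.aestronglyMeasurable, ?_, ?_, ?_⟩
    · filter_upwards [hp.nonneg] with z hz
      rw [hQ z hz]
      exact isPositive_integral_coherentProj hħ _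
    · filter_upwards [hp.nonneg] with z hz
      rw [hQ z hz, opTrace_integral_coherentProj hħ]
      simp
    · have h1 : ∫ z, p z • ∫ w, coherentProj ħ w ∂(π.condKernel z) =
          ∫ z, ∫ w, coherentProj ħ w ∂(π.condKernel z) ∂(densityMeasure p) := by
        rw [densityMeasure, integral_withDensity_eq_integral_toReal_smul₀ hp.aemeasurable_ofReal
          (Eventually.of_forall fun _ => ENNReal.ofReal_lt_top)]
        refine integral_congr_ae ?_
        filter_upwards [hp.nonneg] with z hz
        rw [ENNReal.toReal_ofReal hz]
      have h2 : Integrable (fun zw : Phase d × Phase d => coherentProj ħ zw.2)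
          (densityMeasure p ⊗ₘ π.condKernel) := by
        have hc : Continuous fun zw : Phase d × Phase d => coherentProj ħ zw.2 :=
          (continuous_coherentProj (d := d) hħ).comp continuous_snd
        refine (integrable_const (1 : ℝ)).mono' hc.aestronglyMeasurable
          (Eventually.of_forall fun w => (norm_coherentProj hħ _).le)
      have h3 : AEStronglyMeasurable (coherentProj (d := d) ħ) (π.map Prod.snd) :=
        (continuous_coherentProj (d := d) hħ).aestronglyMeasurable
      rw [h1, ← Measure.integral_compProd h2, hdis, ← hπ2,
        integral_map measurable_snd.aemeasurable h3]
  refine (iInf₂_le _ hcoup).trans ?_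
  have hmc : Measurable fun zw : Phase d × Phase d =>
      ENNReal.ofReal (quadCost zw.1 zw.2 + d * ħ / 2) :=
    (continuous_quadCost.add continuous_const).measurable.ennreal_ofReal
  calc ∫⁻ z, costTrace ħ z (p z • ∫ w, coherentProj ħ w ∂(π.condKernel z))
      ≤ ∫⁻ z, ENNReal.ofReal (p z) * ∫⁻ w, ENNReal.ofReal (quadCost z w + d * ħ / 2)
          ∂(π.condKernel z) := by
        refine lintegral_mono_ae ?_
        filter_upwards [hp.nonneg] with z hz
        rw [hQ z hz]
        refine (costTrace_coherent_le hħ z _).trans ?_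
        rw [lintegral_smul_measure, smul_eq_mul]
    _ = ∫⁻ z, ∫⁻ w, ENNReal.ofReal (quadCost z w + d * ħ / 2)
          ∂(π.condKernel z) ∂(densityMeasure p) := by
        rw [densityMeasure, lintegral_withDensity_eq_lintegral_mul₀ hp.aemeasurable_ofReal
          (Measurable.lintegral_kernel_prod_right' hmc).aemeasurable]
        rfl
    _ = ∫⁻ zw, ENNReal.ofReal (quadCost zw.1 zw.2 + d * ħ / 2) ∂π := by
        conv_rhs => rw [← hdis]
        rw [Measure.lintegral_compProd hmc]
    _ = _ := by
        have : ∀ zw : Phase d × Phase d, ENNReal.ofReal (quadCost zw.1 zw.2 + d * ħ / 2) =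
            ENNReal.ofReal (quadCost zw.1 zw.2) + ENNReal.ofReal ((1 / 2) * d * ħ) := fun zw => by
          rw [← ENNReal.ofReal_add (quadCost_nonneg _ _) (by positivity)]
          congr 1; ring
        simp_rw [this]
        rw [lintegral_add_right _ measurable_const, lintegral_const, measure_univ, mul_one]

/-- Heisenberg's inequality on the vectors `Q(z)^{1/2}eᵢ` sums to a cost of at least `dħ/2` times
`trace Q(z) = p(z)`, and `p` has integral `1`. -/
theorem le_hybridE_sq {p : Phase d → ℝ} (hp : IsProbabilityDensity p) {ħ : ℝ} (hħ : 0 < ħ)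
    (R : StateSpace d →L[ℂ] StateSpace d) :
    ENNReal.ofReal ((1 / 2) * d * ħ) ≤ hybridE ħ p R ^ 2 := by
  rw [hybridE_sq]
  refine le_iInf₂ fun Q hQ => ?_
  have h1 : ∀ᵐ z, ENNReal.ofReal ((1 / 2) * d * ħ) * ENNReal.ofReal (p z) ≤
      costTrace ħ z (Q z) := by
    filter_upwards [hQ.isPositive, hQ.trace_eq] with z hz ht
    rw [← ht, opTrace_eq_tsum_posSqrt hz, costTrace_eq, ← ENNReal.tsum_mul_left]
    refine ENNReal.tsum_le_tsum fun i => ?_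
    refine le_trans (le_of_eq ?_) (heisenberg hħ z _)
    congr 2
    ring
  calc ENNReal.ofReal ((1 / 2) * d * ħ)
      = ∫⁻ z, ENNReal.ofReal ((1 / 2) * d * ħ) * ENNReal.ofReal (p z) := by
        rw [lintegral_const_mul'' _ hp.aemeasurable_ofReal, hp.lintegral_eq_one, mul_one]
    _ ≤ _ := lintegral_mono_ae h1

end ToeplitzCouplings

/-! ### Integral kernels of density operators -/

section IntegralKernels

variable {d : ℕ}

theorem memLp_tensor (f g : StateSpace d) :
    MemLp (fun z : Pos d × Pos d => f z.1 * starRingEnd ℂ (g z.2)) 2 volume := by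
  have hf := (Lp.memLp f).aestronglyMeasurable
  have hg := (Lp.memLp g).aestronglyMeasurable
  have h1 : AEStronglyMeasurable (fun z : Pos d × Pos d => f z.1 * starRingEnd ℂ (g z.2))
      volume :=
    hf.comp_fst.mul (RCLike.continuous_conj.comp_aestronglyMeasurable hg.comp_snd)
  rw [memLp_two_iff_integrable_sq_norm h1]
  have := ((memLp_two_iff_integrable_sq_norm hf).1 (Lp.memLp f)).mul_prod
    ((memLp_two_iff_integrable_sq_norm hg).1 (Lp.memLp g))
  refine this.congr (Eventually.of_forall fun z => ?_)
  simp [mul_pow]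

/-- The kernel `f(x) conj g(y)` of the rank one operator `|f⟩⟨g|`. -/
def tensor (f g : StateSpace d) : Lp ℂ 2 (volume : Measure (Pos d × Pos d)) :=
  (memLp_tensor f g).toLp _

theorem tensor_coeFn (f g : StateSpace d) :
    tensor f g =ᵐ[volume] fun z : Pos d × Pos d => f z.1 * starRingEnd ℂ (g z.2) :=
  MemLp.coeFn_toLp _

theorem enorm_tensor (f g : StateSpace d) : ‖tensor f g‖ₑ = ‖f‖ₑ * ‖g‖ₑ := by
  refine ENNReal.pow_right_strictMono two_ne_zero |>.injective ?_
  simp only [mul_pow, enorm_Lp_two_sq]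
  rw [Lp.enorm_def, eLpNorm_eq_lintegral_rpow_enorm_toReal (by simp) (by simp),
    ← ENNReal.rpow_natCast, ← ENNReal.rpow_mul]
  have h : ∫⁻ z : Pos d × Pos d, ‖tensor f g z‖ₑ ^ 2 =
      ∫⁻ z : Pos d × Pos d, ‖f z.1‖ₑ ^ 2 * ‖g z.2‖ₑ ^ 2 := by
    refine lintegral_congr_ae ?_
    filter_upwards [tensor_coeFn f g] with z hz
    rw [hz, enorm_mul, mul_pow, RCLike.enorm_conj]
  have h2 : ∫⁻ z : Pos d × Pos d, ‖f z.1‖ₑ ^ 2 * ‖g z.2‖ₑ ^ 2 =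
      (∫⁻ y, ‖f y‖ₑ ^ 2) * ∫⁻ y, ‖g y‖ₑ ^ 2 :=
    lintegral_prod_mul (aemeasurable_enorm_sq_coeFn f) (aemeasurable_enorm_sq_coeFn g)
  rw [← h2, ← h]
  simp

theorem integrable_conj_mul_kernel {r : Pos d × Pos d → ℂ} (hr : MemLp r 2 volume)
    (f g : StateSpace d) :
    Integrable (fun z : Pos d × Pos d => starRingEnd ℂ (f z.1) * (r z * g z.2)) volume := by
  refine (L2.integrable_inner (𝕜 := ℂ) (tensor f g) (hr.toLp r)).congr ?_
  filter_upwards [tensor_coeFn f g, hr.coeFn_toLp] with z h1 h2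
  rw [h1, h2]
  simp only [RCLike.inner_apply, map_mul, RCLike.conj_conj]
  ring

/-- Pairing a kernel in `L²` with `f ⊗ ḡ` reads off the matrix element `⟨f, · g⟩` of the operator it
defines; kernels are thus compared with operators through matrix elements. -/
theorem inner_tensor_toLp {r : Pos d × Pos d → ℂ} (hr : MemLp r 2 volume) (f g : StateSpace d) :
    ⟪tensor f g, hr.toLp r⟫_ℂ = ∫ x, starRingEnd ℂ (f x) * ∫ y, r (x, y) * g y := by
  rw [L2.inner_def]
  have h : ∫ z : Pos d × Pos d, ⟪tensor f g z, hr.toLp r z⟫_ℂ =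
      ∫ z : Pos d × Pos d, starRingEnd ℂ (f z.1) * (r z * g z.2) := by
    refine integral_congr_ae ?_
    filter_upwards [tensor_coeFn f g, hr.coeFn_toLp] with z h1 h2
    rw [h1, h2]
    simp only [RCLike.inner_apply, map_mul, RCLike.conj_conj]
    ring
  rw [h, Measure.volume_eq_prod, integral_prod _ (integrable_conj_mul_kernel hr f g)]
  simp_rw [integral_const_mul]

theorem inner_tensor_tensor (f g u v : StateSpace d) :
    ⟪tensor f g, tensor u v⟫_ℂ = ⟪f, u⟫_ℂ * ⟪v, g⟫_ℂ := by
  rw [tensor, tensor, ← tensor, inner_tensor_toLp, inner_Lp_eq, inner_Lp_eq, ← integral_mul_const]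
  congr 1
  ext x
  simp_rw [mul_assoc, integral_const_mul]

theorem locallyIntegrable_integral_kernel {r : Pos d × Pos d → ℂ} (hr : MemLp r 2 volume)
    (g : StateSpace d) : LocallyIntegrable fun x => ∫ y, r (x, y) * g y := by
  rw [locallyIntegrable_iff]
  intro k hk
  have hm : MemLp (k.indicator fun _ => (1 : ℂ)) 2 (volume : Measure (Pos d)) :=
    memLp_indicator_const 2 hk.measurableSet 1 (Or.inr hk.measure_lt_top.ne)
  have h := (integrable_conj_mul_kernel hr (hm.toLp _) g).integral_prod_left
  rw [← integrable_indicator_iff hk.measurableSet]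
  refine h.congr ?_
  filter_upwards [hm.coeFn_toLp] with x hx
  simp only [hx, integral_const_mul]
  by_cases hxk : x ∈ k <;> simp [hxk]

theorem hasSum_inner_posSqrt {R : StateSpace d →L[ℂ] StateSpace d} (hR : R.IsPositive)
    (f g : StateSpace d) :
    HasSum (fun i => ⟪f, posSqrt R (stdBasis d i)⟫_ℂ * ⟪posSqrt R (stdBasis d i), g⟫_ℂ)
      ⟪f, R g⟫_ℂ := by
  have h := (stdBasis d).hasSum_inner_mul_inner (posSqrt R f) (posSqrt R g)
  rw [inner_posSqrt_left, posSqrt_apply_apply hR] at h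
  simpa only [inner_posSqrt_left] using h

/-- A square integrable kernel of a density operator, from its spectral decomposition. -/
def spectralKernel (R : StateSpace d →L[ℂ] StateSpace d) :
    Lp ℂ 2 (volume : Measure (Pos d × Pos d)) :=
  ∑' i, tensor (posSqrt R (stdBasis d i)) (posSqrt R (stdBasis d i))

theorem IsDensityOperator.tsum_enorm_tensor {R : StateSpace d →L[ℂ] StateSpace d}
    (hR : IsDensityOperator R) :
    ∑' i, ‖tensor (posSqrt R (stdBasis d i)) (posSqrt R (stdBasis d i))‖ₑ = 1 := by
  simp_rw [enorm_tensor, ← sq]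
  rw [← opTrace_eq_tsum_posSqrt hR.isPositive, hR.trace_eq_one]

/-- Trace one makes the series of rank one kernels converge absolutely in `L²`. Its matrix elements
are those of `R` by `hasSum_inner_posSqrt`, and testing against conjugates of Schwartz functions
recovers `R φ` almost everywhere. -/
theorem IsDensityOperator.isIntegralKernel_spectralKernel
    {R : StateSpace d →L[ℂ] StateSpace d} (hR : IsDensityOperator R) :
    IsIntegralKernel R (spectralKernel R) := by
  have hK := Lp.memLp (spectralKernel R)
  refine ⟨hK, fun φ => ?_⟩
  refine ae_eq_of_integral_schwartz ((Lp.memLp (R φ)).locallyIntegrable (by norm_num))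
    (locallyIntegrable_integral_kernel hK φ) fun g => ?_
  have hg2 : MemLp (fun x => starRingEnd ℂ (g x)) 2 (volume : Measure (Pos d)) :=
    (g.memLp 2 volume).star
  have hs : HasSum (fun i => tensor (posSqrt R (stdBasis d i)) (posSqrt R (stdBasis d i)))
      (spectralKernel R) :=
    (Summable.of_enorm (by rw [hR.tsum_enorm_tensor]; simp)).hasSum
  have h1 := hs.mapL (innerSL ℂ (tensor (hg2.toLp _) φ))
  simp only [innerSL_apply_apply, inner_tensor_tensor] at h1
  have h2 := h1.unique (hasSum_inner_posSqrt hR.isPositive (hg2.toLp _) φ)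
  have h3 := inner_tensor_toLp hK (hg2.toLp _) φ
  rw [Lp.toLp_coeFn, h2, inner_Lp_eq] at h3
  have h4 : ∀ u : Pos d → ℂ, ∫ x, starRingEnd ℂ (hg2.toLp _ x) * u x = ∫ x, g x * u x := by
    intro u
    refine integral_congr_ae ?_
    filter_upwards [hg2.coeFn_toLp] with x hx
    rw [hx, RCLike.conj_conj]
  rw [h4, h4] at h3
  exact h3

theorem memLp_slice {r : Pos d × Pos d → ℂ} (hr : MemLp r 2 volume) :
    ∀ᵐ x : Pos d, MemLp (fun y => r (x, y)) 2 volume := by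
  have h1 := ((memLp_two_iff_integrable_sq_norm hr.aestronglyMeasurable).1 hr).prod_right_ae
  filter_upwards [h1, hr.aestronglyMeasurable.prodMk_left] with x hx hm
  exact (memLp_two_iff_integrable_sq_norm hm).2 hx

theorem ae_eq_of_ae_ae_eq {r s : Pos d × Pos d → ℂ} (hr : AEStronglyMeasurable r volume)
    (hs : AEStronglyMeasurable s volume) (h : ∀ᵐ x, ∀ᵐ y, r (x, y) = s (x, y)) :
    r =ᵐ[volume] s := by
  have hm : AEMeasurable (fun z => ‖r z - s z‖ₑ) volume := (hr.sub hs).enorm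
  have h0 : ∫⁻ z, ‖r z - s z‖ₑ = 0 := by
    rw [Measure.volume_eq_prod, lintegral_prod _ hm]
    refine (lintegral_congr_ae ?_).trans lintegral_zero
    filter_upwards [h] with x hx
    refine (lintegral_congr_ae ?_).trans lintegral_zero
    filter_upwards [hx] with y hy
    simp [hy]
  rw [lintegral_eq_zero_iff' hm] at h0
  filter_upwards [h0] with z hz
  simpa [sub_eq_zero] using hz

/-- For almost every `x`, the slices `r(x, ·)` and `s(x, ·)` have the same coefficients in a
countable basis. Uniqueness transfers bounds from `spectralKernel` to the kernel chosen in
`integralKernel`. -/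
theorem IsIntegralKernel.ae_eq {R : StateSpace d →L[ℂ] StateSpace d} {r s : Pos d × Pos d → ℂ}
    (hr : IsIntegralKernel R r) (hs : IsIntegralKernel R s) : r =ᵐ[volume] s := by
  refine ae_eq_of_ae_ae_eq hr.1.aestronglyMeasurable hs.1.aestronglyMeasurable ?_
  have h1 : ∀ᵐ x, ∀ i, ∫ y, r (x, y) * stdBasis d i y = ∫ y, s (x, y) * stdBasis d i y :=
    ae_all_iff.2 fun i => (hr.2 _).symm.trans (hs.2 _)
  filter_upwards [h1, memLp_slice hr.1, memLp_slice hs.1] with x hx hrx hsx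
  have key : ∀ {u : Pos d → ℂ} (hu : MemLp u 2 volume) i,
      ⟪hu.star.toLp _, stdBasis d i⟫_ℂ = ∫ y, u y * stdBasis d i y := by
    intro u hu i
    rw [inner_Lp_eq]
    refine integral_congr_ae ?_
    filter_upwards [hu.star.coeFn_toLp] with y hy
    rw [hy]
    simp
  have h2 : hrx.star.toLp _ = hsx.star.toLp _ := by
    refine (stdBasis d).repr.injective (lp.ext (funext fun i => ?_))
    rw [HilbertBasis.repr_apply_apply, HilbertBasis.repr_apply_apply, ← inner_conj_symm, key hrx,
      hx i, ← key hsx, inner_conj_symm]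
  rw [MemLp.toLp_eq_toLp_iff] at h2
  filter_upwards [h2] with y hy
  exact star_injective hy

theorem ennreal_two_mul_le_add_sq (a b : ℝ≥0∞) : 2 * (a * b) ≤ a ^ 2 + b ^ 2 := by
  wlog h : a ≤ b generalizing a b
  · rw [mul_comm a, add_comm]
    exact this b a (le_of_not_ge h)
  obtain ⟨c, rfl⟩ := exists_add_of_le h
  calc 2 * (a * (a + c)) ≤ 2 * (a * (a + c)) + c ^ 2 := le_self_add
    _ = _ := by ring

theorem IsDensityOperator.isIntegralKernel {R : StateSpace d →L[ℂ] StateSpace d}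
    (hR : IsDensityOperator R) : IsIntegralKernel R (integralKernel R) := by
  have h : ∃ r, IsIntegralKernel R r := ⟨_, hR.isIntegralKernel_spectralKernel⟩
  rw [integralKernel, dif_pos h]
  exact h.choose_spec

/-- The integral kernel of a density operator is controlled by the position density `ρ`. -/
theorem IsDensityOperator.exists_kernel_bound {R : StateSpace d →L[ℂ] StateSpace d}
    (hR : IsDensityOperator R) :
    ∃ ρ : Pos d → ℝ≥0∞, Measurable ρ ∧ ∫⁻ x, ρ x = 1 ∧
      ∀ᵐ z : Pos d × Pos d, 2 * ‖integralKernel R z‖ₑ ≤ ρ z.1 + ρ z.2 := by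
  set ψ := fun i => posSqrt R (stdBasis d i) with hψ
  have hψm : ∀ i, Measurable fun x => ‖ψ i x‖ₑ ^ 2 := fun i =>
    (Lp.stronglyMeasurable (ψ i)).measurable.enorm.pow_const 2
  -- The witness is the formal diagonal of `R`, whose integral is the trace. The bound follows from
  -- the pointwise almost everywhere convergence of the series and `2|ψᵢ(x)ψᵢ(y)| ≤ |ψᵢ(x)|² +
  -- |ψᵢ(y)|²`.
  refine ⟨fun x => ∑' i, ‖ψ i x‖ₑ ^ 2, Measurable.tsum hψm, ?_, ?_⟩
  · rw [lintegral_tsum fun i => (hψm i).aemeasurable]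
    simp_rw [← enorm_Lp_two_sq, hψ]
    rw [← opTrace_eq_tsum_posSqrt hR.isPositive, hR.trace_eq_one]
  · have h1 := Lp.hasSum_coeFn_tsum (f := fun i => tensor (ψ i) (ψ i))
      (by rw [hR.tsum_enorm_tensor]; simp)
    have h2 : ∀ᵐ z : Pos d × Pos d, ∀ i, tensor (ψ i) (ψ i) z =
        ψ i z.1 * starRingEnd ℂ (ψ i z.2) := ae_all_iff.2 fun i => tensor_coeFn _ _
    filter_upwards [h1, h2, hR.isIntegralKernel.ae_eq hR.isIntegralKernel_spectralKernel]
      with z hz1 hz2 hz3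
    rw [hz3, spectralKernel, ← hz1.tsum_eq, ← ENNReal.tsum_add]
    calc 2 * ‖∑' i, tensor (ψ i) (ψ i) z‖ₑ ≤ 2 * ∑' i, ‖tensor (ψ i) (ψ i) z‖ₑ := by
          gcongr
          exact enorm_tsum_le_tsum_enorm
      _ = ∑' i, 2 * ‖tensor (ψ i) (ψ i) z‖ₑ := ENNReal.tsum_mul_left.symm
      _ ≤ _ := by
          refine ENNReal.tsum_le_tsum fun i => ?_
          rw [hz2, enorm_mul, RCLike.enorm_conj]
          exact ennreal_two_mul_le_add_sq _ _

end IntegralKernels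

/-! ### Testing the Wigner function -/

section WignerFunctions

variable {d : ℕ}

/-- The change of variables `(x, y) ↦ (x + ħy/2, x - ħy/2)` of the Wigner transform. -/
def wignerMap (ħ : ℝ) (v : Pos d × Pos d) : Pos d × Pos d :=
  (v.1 + (ħ / 2) • v.2, v.1 - (ħ / 2) • v.2)

theorem continuous_wignerMap (ħ : ℝ) : Continuous (wignerMap ħ : Pos d × Pos d → _) := by
  unfold wignerMap
  fun_prop

/-- Computed by Fubini: the substitution in `y` gives `(2/ħ)^d`, the one in `x` gives `(1/2)^d`, and
the product is `ħ^{-d}`. -/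
theorem lintegral_comp_wignerMap {ħ : ℝ} (hħ : 0 < ħ) {F : Pos d × Pos d → ℝ≥0∞}
    (hF : Measurable F) : ∫⁻ v, F (wignerMap ħ v) = ENNReal.ofReal ((ħ ^ d)⁻¹) * ∫⁻ v, F v := by
  have hm : Measurable fun v : Pos d × Pos d => F (wignerMap ħ v) :=
    hF.comp (continuous_wignerMap ħ).measurable
  have h1 : ∀ x : Pos d, ∫⁻ y, F (wignerMap ħ (x, y)) =
      ENNReal.ofReal ((2 / ħ) ^ d) * ∫⁻ y, F (x + x - y, y) := by
    intro x
    have h := lintegral_comp_inv_smul (d := d) (r := -(2 / ħ)) (by simp; positivity)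
      fun u => F (x - u, x + u)
    rw [abs_neg, abs_of_pos (by positivity)] at h
    have h' := lintegral_add_left_eq_self (μ := volume) (fun u : Pos d => F (x + x - u, u)) x
    rw [← h']
    convert h using 4 with y
    · simp only [wignerMap, Prod.mk.injEq]
      constructor
      · rw [inv_neg, inv_div, neg_smul, sub_neg_eq_add]
      · rw [inv_neg, inv_div, neg_smul, ← sub_eq_add_neg]
    · rw [add_sub_add_left_eq_sub]
  have hm2 : Measurable fun v : Pos d × Pos d => F (v.1 + v.1 - v.2, v.2) :=
    hF.comp (by fun_prop)
  have h2 : ∀ y : Pos d, ∫⁻ x, F (x + x - y, y) =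
      ENNReal.ofReal ((1 / 2) ^ d) * ∫⁻ x, F (x, y) := by
    intro y
    have h := lintegral_comp_inv_smul (d := d) (r := 1 / 2) (by norm_num)
      fun u => F (u - y, y)
    rw [abs_of_pos (by positivity), lintegral_sub_right_eq_self (fun u => F (u, y))] at h
    rw [← h]
    refine lintegral_congr fun x => ?_
    congr 2
    module
  rw [Measure.volume_eq_prod, lintegral_prod _ hm.aemeasurable]
  simp_rw [h1]
  rw [lintegral_const_mul' _ _ ENNReal.ofReal_ne_top,
    lintegral_lintegral_swap hm2.aemeasurable]
  simp_rw [h2]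
  rw [lintegral_const_mul' _ _ ENNReal.ofReal_ne_top, ← mul_assoc,
    ← ENNReal.ofReal_mul (by positivity), lintegral_prod_symm _ hF.aemeasurable, ← mul_pow,
    ← inv_pow]
  congr 3
  field_simp

theorem map_wignerMap {ħ : ℝ} (hħ : 0 < ħ) :
    (volume : Measure (Pos d × Pos d)).map (wignerMap ħ) =
      ENNReal.ofReal ((ħ ^ d)⁻¹) • volume := by
  ext s hs
  have h := lintegral_comp_wignerMap hħ (measurable_one.indicator hs : Measurable
    (s.indicator (1 : Pos d × Pos d → ℝ≥0∞)))
  have h3 : (fun v => s.indicator (1 : Pos d × Pos d → ℝ≥0∞) (wignerMap ħ v)) =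
      (wignerMap ħ ⁻¹' s).indicator 1 := by
    ext v
    by_cases hv : wignerMap ħ v ∈ s <;> simp [hv]
  rw [h3, lintegral_indicator_one ((continuous_wignerMap ħ).measurable hs),
    lintegral_indicator_one hs] at h
  rw [Measure.map_apply (continuous_wignerMap ħ).measurable hs, h]
  rfl

theorem quasiMeasurePreserving_wignerMap {ħ : ℝ} (hħ : 0 < ħ) :
    Measure.QuasiMeasurePreserving (wignerMap ħ : Pos d × Pos d → _) volume volume :=
  ⟨(continuous_wignerMap ħ).measurable, by
    rw [map_wignerMap hħ]; exact Measure.smul_absolutelyContinuous⟩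

/-- The kernel `r(x + ħy/2, x - ħy/2)`, whose Fourier transform in `y` is the Wigner function. -/
def wignerKernel (ħ : ℝ) (R : StateSpace d →L[ℂ] StateSpace d) (v : Pos d × Pos d) : ℂ :=
  integralKernel R (wignerMap ħ v)

variable {R : StateSpace d →L[ℂ] StateSpace d}

theorem IsDensityOperator.aestronglyMeasurable_wignerKernel (hR : IsDensityOperator R) {ħ : ℝ}
    (hħ : 0 < ħ) : AEStronglyMeasurable (wignerKernel ħ R) volume :=
  hR.isIntegralKernel.1.aestronglyMeasurable.comp_quasiMeasurePreserving
    (quasiMeasurePreserving_wignerMap hħ)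

theorem ennreal_le_of_two_mul_le {a b : ℝ≥0∞} (h : 2 * a ≤ b + b) : a ≤ b := by
  rw [← two_mul] at h
  exact (ENNReal.mul_le_mul_iff_right two_ne_zero (by simp)).1 h

theorem lintegral_comp_add_smul {t : ℝ} (ht : t ≠ 0) (ρ : Pos d → ℝ≥0∞) (x : Pos d) :
    ∫⁻ y, ρ (x + t • y) = ENNReal.ofReal (|t⁻¹| ^ d) * ∫⁻ y, ρ y := by
  have h := lintegral_comp_inv_smul (d := d) (r := t⁻¹) (inv_ne_zero ht) fun u => ρ (x + u)
  rw [lintegral_add_left_eq_self ρ x, inv_inv] at h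
  exact h

/-- Makes the integral defining the Wigner function absolutely convergent for almost every `x`, but
the bound degenerates as `ħ → 0`. -/
theorem IsDensityOperator.lintegral_wignerKernel_right (hR : IsDensityOperator R) {ħ : ℝ}
    (hħ : 0 < ħ) :
    ∀ᵐ x : Pos d, ∫⁻ y, ‖wignerKernel ħ R (x, y)‖ₑ ≤ ENNReal.ofReal ((2 / ħ) ^ d) := by
  obtain ⟨ρ, hρm, hρ1, hρ⟩ := hR.exists_kernel_bound
  have h := Measure.ae_ae_of_ae_prod ((quasiMeasurePreserving_wignerMap hħ).ae hρ)
  filter_upwards [h] with x hx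
  refine ennreal_le_of_two_mul_le ?_
  rw [← lintegral_const_mul' _ _ (by simp)]
  refine (lintegral_mono_ae hx).trans (le_of_eq ?_)
  simp only [wignerMap]
  have hm : Measurable fun y : Pos d => ρ (x + (ħ / 2) • y) := hρm.comp (by fun_prop)
  rw [lintegral_add_left hm]
  simp_rw [sub_eq_add_neg, ← neg_smul]
  rw [lintegral_comp_add_smul (by positivity), lintegral_comp_add_smul (by simp; positivity), hρ1,
    inv_neg, abs_neg, abs_of_pos (by positivity), mul_one, inv_div]

/-- In the variable `x` the two arguments of the kernel are mere translates, so the bound by `ρ`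
costs no power of `ħ`. This uniformity drives the comparison of the Wigner and Husimi functions. -/
theorem IsDensityOperator.lintegral_wignerKernel_left (hR : IsDensityOperator R) {ħ : ℝ}
    (hħ : 0 < ħ) : ∀ᵐ y : Pos d, ∫⁻ x, ‖wignerKernel ħ R (x, y)‖ₑ ≤ 1 := by
  obtain ⟨ρ, hρm, hρ1, hρ⟩ := hR.exists_kernel_bound
  have h := Measure.ae_ae_of_ae_prod ((Measure.measurePreserving_swap (μ := volume)
    (ν := volume)).quasiMeasurePreserving.ae ((quasiMeasurePreserving_wignerMap hħ).ae hρ))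
  filter_upwards [h] with y hy
  refine ennreal_le_of_two_mul_le ?_
  rw [← lintegral_const_mul' _ _ (by simp)]
  refine (lintegral_mono_ae hy).trans (le_of_eq ?_)
  simp only [wignerMap, Prod.fst_swap, Prod.snd_swap]
  have hm : Measurable fun x : Pos d => ρ (x + (ħ / 2) • y) := hρm.comp (by fun_prop)
  rw [lintegral_add_left hm, lintegral_add_right_eq_self ρ, lintegral_sub_right_eq_self ρ, hρ1]

/-- The phase factor `exp(-iξ·y)`. -/
def phaseFactor (ξ y : Pos d) : ℂ := Complex.exp (-Complex.I * ((⟪ξ, y⟫_ℝ : ℝ) : ℂ))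

theorem norm_phaseFactor (ξ y : Pos d) : ‖phaseFactor ξ y‖ = 1 := by
  rw [phaseFactor, Complex.norm_exp]
  simp

theorem enorm_phaseFactor (ξ y : Pos d) : ‖phaseFactor ξ y‖ₑ = 1 := by
  rw [← ofReal_norm, norm_phaseFactor, ENNReal.ofReal_one]

theorem continuous_phaseFactor : Continuous fun v : Pos d × Pos d => phaseFactor v.1 v.2 := by
  unfold phaseFactor
  fun_prop

theorem wigner_eq (ħ : ℝ) (R : StateSpace d →L[ℂ] StateSpace d) (z : Phase d) :
    wigner ħ R z = (((2 * Real.pi) ^ d)⁻¹ : ℝ) •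
      ∫ y, phaseFactor z.2 y * wignerKernel ħ R (z.1, y) := rfl

theorem IsDensityOperator.aestronglyMeasurable_wigner (hR : IsDensityOperator R) {ħ : ℝ}
    (hħ : 0 < ħ) : AEStronglyMeasurable (wigner ħ R) volume := by
  obtain ⟨k, hk, hke⟩ := hR.aestronglyMeasurable_wignerKernel hħ
  have hm : StronglyMeasurable fun q : Phase d × Pos d =>
      phaseFactor q.1.2 q.2 * k (q.1.1, q.2) := by
    have h1 : Continuous fun q : Phase d × Pos d => phaseFactor q.1.2 q.2 :=
      continuous_phaseFactor.comp
        (show Continuous fun q : Phase d × Pos d => (q.1.2, q.2) by fun_prop)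
    have h2 : Measurable fun q : Phase d × Pos d => (q.1.1, q.2) := by fun_prop
    exact h1.stronglyMeasurable.mul (hk.comp_measurable h2)
  have hi : StronglyMeasurable fun z : Phase d => ∫ y, phaseFactor z.2 y * k (z.1, y) :=
    hm.integral_prod_right (ν := volume)
  refine ⟨fun z => (((2 * Real.pi) ^ d)⁻¹ : ℝ) • ∫ y, phaseFactor z.2 y * k (z.1, y),
    hi.fun_const_smul _, ?_⟩
  have h2 := Measure.quasiMeasurePreserving_fst (μ := (volume : Measure (Pos d)))
    (ν := (volume : Measure (Pos d))) |>.ae (Measure.ae_ae_of_ae_prod hke)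
  filter_upwards [h2] with z hz
  rw [wigner_eq]
  congr 1
  refine integral_congr_ae ?_
  filter_upwards [hz] with y hy
  rw [hy]

theorem IsDensityOperator.enorm_wigner_le (hR : IsDensityOperator R) {ħ : ℝ} (hħ : 0 < ħ) :
    ∀ᵐ z, ‖wigner ħ R z‖ₑ ≤ ENNReal.ofReal (((Real.pi * ħ) ^ d)⁻¹) := by
  have h2 := Measure.quasiMeasurePreserving_fst (μ := (volume : Measure (Pos d)))
    (ν := (volume : Measure (Pos d))) |>.ae (hR.lintegral_wignerKernel_right hħ)
  filter_upwards [h2] with z hz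
  rw [wigner_eq, enorm_smul]
  calc _ ≤ ‖(((2 * Real.pi) ^ d)⁻¹ : ℝ)‖ₑ * ∫⁻ y, ‖phaseFactor z.2 y * wignerKernel ħ R (z.1, y)‖ₑ := by
        gcongr
        exact enorm_integral_le_lintegral_enorm _
    _ = ‖(((2 * Real.pi) ^ d)⁻¹ : ℝ)‖ₑ * ∫⁻ y, ‖wignerKernel ħ R (z.1, y)‖ₑ := by
        simp_rw [enorm_mul, enorm_phaseFactor, one_mul]
    _ ≤ ‖(((2 * Real.pi) ^ d)⁻¹ : ℝ)‖ₑ * ENNReal.ofReal ((2 / ħ) ^ d) := by gcongr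
    _ = _ := by
        rw [Real.enorm_of_nonneg (by positivity), ← ENNReal.ofReal_mul (by positivity), ← inv_pow,
          ← inv_pow, ← mul_pow]
        congr 2
        field_simp

/-- The Fourier transform in the momentum variable. -/
def momentumFourier (θ : Phase d → ℂ) (v : Pos d × Pos d) : ℂ :=
  ∫ ξ, phaseFactor ξ v.2 * θ (v.1, ξ)

theorem stronglyMeasurable_momentumFourier {θ : Phase d → ℂ} (hθ : StronglyMeasurable θ) :
    StronglyMeasurable (momentumFourier θ) := by
  have hm : StronglyMeasurable fun q : (Pos d × Pos d) × Pos d =>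
      phaseFactor q.2 q.1.2 * θ (q.1.1, q.2) := by
    have h1 : Continuous fun q : (Pos d × Pos d) × Pos d => phaseFactor q.2 q.1.2 :=
      continuous_phaseFactor.comp
        (show Continuous fun q : (Pos d × Pos d) × Pos d => (q.2, q.1.2) by fun_prop)
    have h2 : Measurable fun q : (Pos d × Pos d) × Pos d => (q.1.1, q.2) := by fun_prop
    exact h1.stronglyMeasurable.mul (hθ.comp_measurable h2)
  exact hm.integral_prod_right (ν := volume)

theorem enorm_momentumFourier_le (θ : Phase d → ℂ) (v : Pos d × Pos d) :
    ‖momentumFourier θ v‖ₑ ≤ ∫⁻ ξ, ‖θ (v.1, ξ)‖ₑ := by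
  refine (enorm_integral_le_lintegral_enorm _).trans (le_of_eq ?_)
  simp_rw [enorm_mul, enorm_phaseFactor, one_mul]

theorem IsDensityOperator.integrable_wignerKernel_mul (hR : IsDensityOperator R) {ħ : ℝ}
    (hħ : 0 < ħ) {θ : Phase d → ℂ} (hθ : StronglyMeasurable θ) (hθi : Integrable θ) :
    Integrable (fun v => wignerKernel ħ R v * momentumFourier θ v) := by
  have hm := (hR.aestronglyMeasurable_wignerKernel hħ).mul
    (stronglyMeasurable_momentumFourier hθ).aestronglyMeasurable
  refine ⟨hm, ?_⟩
  have hme : AEMeasurable (fun v => ‖wignerKernel ħ R v * momentumFourier θ v‖ₑ) volume :=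
    hm.enorm
  rw [HasFiniteIntegral, Measure.volume_eq_prod, lintegral_prod _ hme]
  have hθe : Measurable fun z => ‖θ z‖ₑ := hθ.measurable.enorm
  calc ∫⁻ x, ∫⁻ y, ‖wignerKernel ħ R (x, y) * momentumFourier θ (x, y)‖ₑ
      ≤ ∫⁻ x, ENNReal.ofReal ((2 / ħ) ^ d) * ∫⁻ ξ, ‖θ (x, ξ)‖ₑ := by
        refine lintegral_mono_ae ?_
        filter_upwards [hR.lintegral_wignerKernel_right hħ,
          (hR.aestronglyMeasurable_wignerKernel hħ).prodMk_left] with x hx hxm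
        calc _ ≤ ∫⁻ y, ‖wignerKernel ħ R (x, y)‖ₑ * ∫⁻ ξ, ‖θ (x, ξ)‖ₑ := by
              refine lintegral_mono fun y => ?_
              rw [enorm_mul]
              gcongr
              exact enorm_momentumFourier_le θ (x, y)
          _ = (∫⁻ y, ‖wignerKernel ħ R (x, y)‖ₑ) * ∫⁻ ξ, ‖θ (x, ξ)‖ₑ :=
              lintegral_mul_const'' _ hxm.enorm
          _ ≤ _ := by gcongr
    _ = ENNReal.ofReal ((2 / ħ) ^ d) * ∫⁻ z, ‖θ z‖ₑ := by
        rw [lintegral_const_mul' _ _ ENNReal.ofReal_ne_top, Measure.volume_eq_prod,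
          lintegral_prod _ hθe.aemeasurable]
    _ < ⊤ := ENNReal.mul_lt_top ENNReal.ofReal_lt_top hθi.2

theorem IsDensityOperator.integrable_wigner_mul (hR : IsDensityOperator R) {ħ : ℝ}
    (hħ : 0 < ħ) {θ : Phase d → ℂ} (hθi : Integrable θ) :
    Integrable (fun z => wigner ħ R z * θ z) := by
  refine hθi.bdd_mul (c := ((Real.pi * ħ) ^ d)⁻¹) (hR.aestronglyMeasurable_wigner hħ) ?_
  filter_upwards [hR.enorm_wigner_le hħ] with z hz
  rwa [← ofReal_norm, ENNReal.ofReal_le_ofReal_iff (by positivity)] at hz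

/-- Testing the Wigner function amounts to testing the kernel with a partial Fourier transform. -/
theorem IsDensityOperator.integral_wigner_mul (hR : IsDensityOperator R) {ħ : ℝ}
    (hħ : 0 < ħ) {θ : Phase d → ℂ} (hθ : StronglyMeasurable θ) (hθi : Integrable θ) :
    ∫ z, wigner ħ R z * θ z =
      (((2 * Real.pi) ^ d)⁻¹ : ℝ) • ∫ v, wignerKernel ħ R v * momentumFourier θ v := by
  rw [Measure.volume_eq_prod, integral_prod _ (hR.integrable_wigner_mul hħ hθi),
    integral_prod _ (hR.integrable_wignerKernel_mul hħ hθ hθi), ← integral_smul]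
  refine integral_congr_ae ?_
  filter_upwards [hR.lintegral_wignerKernel_right hħ,
    (hR.aestronglyMeasurable_wignerKernel hħ).prodMk_left, hθi.prod_right_ae] with x hx hxm hθx
  have hk : Integrable fun y => wignerKernel ħ R (x, y) :=
    ⟨hxm, hx.trans_lt ENNReal.ofReal_lt_top⟩
  have hi : Integrable (fun q : Pos d × Pos d =>
      phaseFactor q.1 q.2 * (θ (x, q.1) * wignerKernel ħ R (x, q.2))) (volume.prod volume) := by
    refine (hθx.mul_prod hk).bdd_mul (c := 1) continuous_phaseFactor.aestronglyMeasurable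
      (Eventually.of_forall fun q => (norm_phaseFactor _ _).le)
  simp only [wigner_eq, momentumFourier, smul_mul_assoc, integral_smul]
  congr 1
  simp_rw [← integral_mul_const, ← integral_const_mul]
  calc _ = ∫ ξ, ∫ y, phaseFactor ξ y * (θ (x, ξ) * wignerKernel ħ R (x, y)) := by
        congr 1; ext ξ; congr 1; ext y; ring
    _ = ∫ y, ∫ ξ, phaseFactor ξ y * (θ (x, ξ) * wignerKernel ħ R (x, y)) :=
        integral_integral_swap hi
    _ = _ := by
        congr 1; ext ξ; congr 1; ext y; ring

end WignerFunctions

/-! ### The Husimi function as a coherent state expectation -/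

section HusimiFunctions

variable {d : ℕ} {R : StateSpace d →L[ℂ] StateSpace d}

instance : (volume : Measure (Phase d)).IsAddHaarMeasure :=
  inferInstanceAs ((volume : Measure (Pos d)).prod volume).IsAddHaarMeasure

/-- At time `ħ/4` the heat kernel has covariance `ħ/2` in each variable, exactly that of the modulus
squared of a coherent state. -/
theorem heatKernel_eq {ħ : ℝ} (hħ : 0 < ħ) (v : Phase d) :
    heatKernel (ħ / 4) v = gaussWeight ħ v.1 * gaussWeight ħ v.2 := by
  have h1 : ((Real.pi * ħ) ^ d)⁻¹ =
      (Real.pi * ħ) ^ (-(d : ℝ) / 2) * (Real.pi * ħ) ^ (-(d : ℝ) / 2) := by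
    rw [← Real.rpow_add (by positivity), add_halves, Real.rpow_neg (by positivity),
      Real.rpow_natCast]
  have h2 : Real.exp (-(‖v.1‖ ^ 2 + ‖v.2‖ ^ 2) / ħ) =
      Real.exp (-‖v.1‖ ^ 2 / ħ) * Real.exp (-‖v.2‖ ^ 2 / ħ) := by
    rw [← Real.exp_add]
    congr 1
    ring
  rw [heatKernel, gaussWeight, gaussWeight, show 4 * Real.pi * (ħ / 4) = Real.pi * ħ by ring,
    mul_div_cancel₀ ħ (by norm_num : (4 : ℝ) ≠ 0), h1, h2]
  ring

theorem continuous_heatKernel (t : ℝ) : Continuous (heatKernel t : Phase d → ℝ) := by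
  unfold heatKernel
  fun_prop

theorem heatKernel_sub_comm (t : ℝ) (z w : Phase d) : heatKernel t (z - w) = heatKernel t (w - z) := by
  simp only [heatKernel, Prod.fst_sub, Prod.snd_sub, norm_sub_rev w.1, norm_sub_rev w.2]

theorem integrable_heatKernel {ħ : ℝ} (hħ : 0 < ħ) :
    Integrable (heatKernel (ħ / 4) : Phase d → ℝ) := by
  rw [funext (heatKernel_eq hħ)]
  exact (integrable_gaussWeight hħ).mul_prod (integrable_gaussWeight hħ)

theorem integral_phaseFactor_mul_gaussWeight {ħ : ℝ} (hħ : 0 < ħ) (y : Pos d) :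
    ∫ ξ, phaseFactor ξ y * (gaussWeight ħ ξ : ℂ) = (Real.exp (-(ħ / 4) * ‖y‖ ^ 2) : ℂ) := by
  have hb : 0 < ((1 / ħ : ℝ) : ℂ).re := by simpa using hħ
  have h := GaussianFourier.integral_cexp_neg_mul_sq_norm_add (V := Pos d) hb (-Complex.I) y
  have h0 := GaussianFourier.integral_cexp_neg_mul_sq_norm_add (V := Pos d) hb 0 y
  have h1 : ∫ ξ : Pos d, Complex.exp (-((1 / ħ : ℝ) : ℂ) * (‖ξ‖ : ℂ) ^ 2) =
      ((Real.pi : ℂ) / ((1 / ħ : ℝ) : ℂ)) ^ (Module.finrank ℝ (Pos d) / 2 : ℂ) := by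
    simpa using h0
  set C : ℝ := (Real.pi * ħ) ^ (-(d : ℝ) / 2) with hC
  have h2 : (C : ℂ) * ∫ ξ : Pos d, Complex.exp (-((1 / ħ : ℝ) : ℂ) * (‖ξ‖ : ℂ) ^ 2) = 1 := by
    have h3 := integral_gaussWeight (d := d) hħ
    simp_rw [gaussWeight_eq] at h3
    rw [integral_const_mul, ← hC] at h3
    have h4 := congrArg (fun t : ℝ => (t : ℂ)) h3
    simp only [Complex.ofReal_mul, ← integral_complex_ofReal, Complex.ofReal_one] at h4
    rw [← h4]
    congr 2
    ext ξ
    push_cast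
    rfl
  have h5 : ∀ ξ : Pos d, phaseFactor ξ y * (gaussWeight ħ ξ : ℂ) =
      (C : ℂ) * Complex.exp (-((1 / ħ : ℝ) : ℂ) * (‖ξ‖ : ℂ) ^ 2 + -Complex.I * ⟪y, ξ⟫_ℝ) := by
    intro ξ
    rw [phaseFactor, gaussWeight_eq, real_inner_comm, Complex.exp_add, Complex.ofReal_mul, ← hC]
    push_cast
    ring
  simp_rw [h5]
  rw [integral_const_mul, h, ← h1, ← mul_assoc, h2, one_mul, Complex.ofReal_exp]
  congr 1
  have : (ħ : ℂ) ≠ 0 := by exact_mod_cast hħ.ne'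
  push_cast
  rw [neg_sq, Complex.I_sq]
  field_simp

theorem phaseFactor_sub (a b y : Pos d) :
    phaseFactor (a - b) y = phaseFactor a y * phaseFactor b (-y) := by
  simp only [phaseFactor, ← Complex.exp_add, inner_sub_left, inner_neg_right]
  congr 1
  push_cast
  ring

theorem momentumFourier_heatKernel {ħ : ℝ} (hħ : 0 < ħ) (z : Phase d) (v : Pos d × Pos d) :
    momentumFourier (fun w => (heatKernel (ħ / 4) (z - w) : ℂ)) v =
      gaussWeight ħ (z.1 - v.1) * (phaseFactor z.2 v.2 * Real.exp (-(ħ / 4) * ‖v.2‖ ^ 2)) := by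
  have h := integral_phaseFactor_mul_gaussWeight hħ (-v.2)
  rw [norm_neg] at h
  rw [momentumFourier, ← h, ← integral_sub_left_eq_self (fun ξ => phaseFactor ξ v.2 *
    (heatKernel (ħ / 4) (z - (v.1, ξ)) : ℂ)) volume z.2, ← integral_const_mul,
    ← integral_const_mul]
  congr 1
  ext ξ
  rw [heatKernel_eq hħ, phaseFactor_sub]
  simp only [Prod.fst_sub, Prod.snd_sub, sub_sub_cancel, Complex.ofReal_mul]
  ring

/-- The right-hand side is that of `momentumFourier_heatKernel`, and this coincidence identifies the
Husimi function with a coherent state expectation. The parallelogram law separates midpoint and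
difference in the Gaussian exponents. -/
theorem conj_coherentFun_mul {ħ : ℝ} (hħ : 0 < ħ) (z : Phase d) (v : Pos d × Pos d) :
    starRingEnd ℂ (coherentFun ħ z (wignerMap ħ v).1) * coherentFun ħ z (wignerMap ħ v).2 =
      gaussWeight ħ (z.1 - v.1) * (phaseFactor z.2 v.2 * Real.exp (-(ħ / 4) * ‖v.2‖ ^ 2)) := by
  have hC : (Real.pi * ħ) ^ (-(d : ℝ) / 2) =
      (Real.pi * ħ) ^ (-(d : ℝ) / 4) * (Real.pi * ħ) ^ (-(d : ℝ) / 4) := by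
    rw [← Real.rpow_add (by positivity)]
    congr 1
    ring
  have hp : ‖v.1 + (ħ / 2) • v.2 - z.1‖ ^ 2 + ‖v.1 - (ħ / 2) • v.2 - z.1‖ ^ 2 =
      2 * (‖z.1 - v.1‖ ^ 2 + (ħ / 2) ^ 2 * ‖v.2‖ ^ 2) := by
    have h := parallelogram_law_with_norm ℝ (v.1 - z.1) ((ħ / 2) • v.2)
    rw [norm_smul, Real.norm_of_nonneg (by positivity : 0 ≤ ħ / 2)] at h
    rw [norm_sub_rev z.1, add_sub_right_comm, sub_right_comm]
    linarith
  have he : Real.exp (-‖v.1 + (ħ / 2) • v.2 - z.1‖ ^ 2 / (2 * ħ)) *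
      Real.exp (-‖v.1 - (ħ / 2) • v.2 - z.1‖ ^ 2 / (2 * ħ)) =
      Real.exp (-‖z.1 - v.1‖ ^ 2 / ħ) * Real.exp (-(ħ / 4) * ‖v.2‖ ^ 2) := by
    rw [← Real.exp_add, ← Real.exp_add, ← add_div, ← neg_add, hp]
    congr 1
    field_simp
    ring
  have hphase : starRingEnd ℂ (Complex.exp (Complex.I *
        ((⟪z.2, v.1 + (ħ / 2) • v.2 - z.1⟫_ℝ / ħ : ℝ) : ℂ))) *
      Complex.exp (Complex.I * ((⟪z.2, v.1 - (ħ / 2) • v.2 - z.1⟫_ℝ / ħ : ℝ) : ℂ)) =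
      phaseFactor z.2 v.2 := by
    rw [← Complex.exp_conj, ← Complex.exp_add, phaseFactor, map_mul, Complex.conj_I,
      Complex.conj_ofReal]
    congr 1
    simp only [inner_sub_right, inner_add_right, inner_smul_right]
    have : (ħ : ℂ) ≠ 0 := by exact_mod_cast hħ.ne'
    push_cast
    field_simp
    ring
  simp only [wignerMap, coherentFun, gaussWeight, map_mul, Complex.conj_ofReal, hC, ← hphase]
  have he' := congrArg (fun t : ℝ => (t : ℂ)) he
  simp only [Complex.ofReal_mul] at he' ⊢
  linear_combination (((Real.pi * ħ) ^ (-(d : ℝ) / 4) : ℝ) : ℂ) ^ 2 *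
    (starRingEnd ℂ (Complex.exp (Complex.I *
        ((⟪z.2, v.1 + (ħ / 2) • v.2 - z.1⟫_ℝ / ħ : ℝ) : ℂ))) *
      Complex.exp (Complex.I * ((⟪z.2, v.1 - (ħ / 2) • v.2 - z.1⟫_ℝ / ħ : ℝ) : ℂ))) * he'

theorem IsDensityOperator.integral_kernel_coherentFun (hR : IsDensityOperator R) {ħ : ℝ}
    (hħ : 0 < ħ) (z : Phase d) :
    ∫ v : Pos d × Pos d, integralKernel R v *
      (starRingEnd ℂ (coherentFun ħ z v.1) * coherentFun ħ z v.2) =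
      ⟪coherentState ħ z, R (coherentState ħ z)⟫_ℂ := by
  have hr := hR.isIntegralKernel
  have hi := integrable_conj_mul_kernel hr.1 (coherentState ħ z) (coherentState ħ z)
  calc _ = ∫ v : Pos d × Pos d, starRingEnd ℂ (coherentState ħ z v.1) *
        (integralKernel R v * coherentState ħ z v.2) := by
        refine integral_congr_ae ?_
        have h1 := (Measure.quasiMeasurePreserving_fst (μ := (volume : Measure (Pos d)))
          (ν := (volume : Measure (Pos d)))).ae (coherentState_coeFn hħ z)
        have h2 := (Measure.quasiMeasurePreserving_snd (μ := (volume : Measure (Pos d)))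
          (ν := (volume : Measure (Pos d)))).ae (coherentState_coeFn hħ z)
        filter_upwards [h1, h2] with v hv1 hv2
        rw [hv1, hv2]
        ring
    _ = ∫ x, starRingEnd ℂ (coherentState ħ z x) * ∫ y, integralKernel R (x, y) *
          coherentState ħ z y := by
        rw [Measure.volume_eq_prod, integral_prod _ hi]
        simp_rw [integral_const_mul]
    _ = _ := by
        rw [inner_Lp_eq]
        refine integral_congr_ae ?_
        filter_upwards [hr.2 (coherentState ħ z)] with x hx
        rw [hx]

/-- The Husimi function is the coherent state expectation. -/
theorem IsDensityOperator.husimi_eq (hR : IsDensityOperator R) {ħ : ℝ} (hħ : 0 < ħ)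
    (z : Phase d) :
    husimi ħ R z = (((2 * Real.pi * ħ) ^ d)⁻¹ : ℝ) •
      ⟪coherentState ħ z, R (coherentState ħ z)⟫_ℂ := by
  have hc : Continuous fun w : Phase d => (heatKernel (ħ / 4) (z - w) : ℂ) :=
    Complex.continuous_ofReal.comp ((continuous_heatKernel _).comp (continuous_const.sub
      continuous_id))
  have hi : Integrable fun w : Phase d => (heatKernel (ħ / 4) (z - w) : ℂ) := by
    simp_rw [heatKernel_sub_comm _ z]
    exact ((integrable_heatKernel hħ).comp_sub_right z).ofReal
  have hcf : Continuous fun v : Pos d × Pos d =>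
      starRingEnd ℂ (coherentFun ħ z v.1) * coherentFun ħ z v.2 :=
    (Complex.continuous_conj.comp ((continuous_coherentFun ħ z).comp continuous_fst)).mul
      ((continuous_coherentFun ħ z).comp continuous_snd)
  have hm : AEStronglyMeasurable (fun v : Pos d × Pos d => integralKernel R v *
      (starRingEnd ℂ (coherentFun ħ z v.1) * coherentFun ħ z v.2))
      (volume.map (wignerMap ħ)) := by
    rw [map_wignerMap hħ]
    exact (hR.isIntegralKernel.1.aestronglyMeasurable.mul
      hcf.aestronglyMeasurable).smul_measure _
  -- The Wigner function is tested against a translated heat kernel and the variables are changed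
  -- back. The prefactor `(2π)^{-d}` and the Jacobian `ħ^{-d}` make up `(2πħ)^{-d}`.
  have h1 := hR.integral_wigner_mul hħ hc.stronglyMeasurable hi
  simp_rw [momentumFourier_heatKernel hħ, ← conj_coherentFun_mul hħ] at h1
  have h2 := integral_map (continuous_wignerMap ħ).measurable.aemeasurable hm
  rw [map_wignerMap hħ, integral_smul_measure, hR.integral_kernel_coherentFun hħ,
    ENNReal.toReal_ofReal (by positivity)] at h2
  simp_rw [husimi, mul_comm (Complex.ofReal _), h1]
  rw [mul_pow (2 * Real.pi), mul_inv, mul_smul, h2]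
  rfl

end HusimiFunctions

/-! ### Husimi transforms of couplings -/

section HusimiCouplings

variable {d : ℕ} {R : StateSpace d →L[ℂ] StateSpace d}

/-- The expectation of an operator in a coherent state. -/
def coherentExp (ħ : ℝ) (A : StateSpace d →L[ℂ] StateSpace d) (w : Phase d) : ℝ :=
  RCLike.re ⟪coherentState ħ w, A (coherentState ħ w)⟫_ℂ

theorem coherentExp_nonneg {A : StateSpace d →L[ℂ] StateSpace d} (hA : A.IsPositive) (ħ : ℝ)
    (w : Phase d) : 0 ≤ coherentExp ħ A w :=
  hA.re_inner_nonneg_right _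

theorem continuous_coherentExp {ħ : ℝ} (hħ : 0 < ħ) (A : StateSpace d →L[ℂ] StateSpace d) :
    Continuous (coherentExp ħ A) := by
  have h := continuous_coherentState (d := d) hħ
  exact RCLike.continuous_re.comp (h.inner (A.continuous.comp h))

theorem lintegral_coherentExp {A : StateSpace d →L[ℂ] StateSpace d} (hA : A.IsPositive) {ħ : ℝ}
    (hħ : 0 < ħ) :
    ∫⁻ w, ENNReal.ofReal (coherentExp ħ A w) =
      ENNReal.ofReal ((2 * Real.pi * ħ) ^ d) * opTrace A := by
  simp_rw [coherentExp, ← tsum_inner_posSqrt (stdBasis d) hA]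
  rw [lintegral_tsum fun i => (measurable_enorm_inner_coherentState_sq hħ _).aemeasurable]
  simp_rw [lintegral_enorm_inner_coherentState hħ]
  rw [ENNReal.tsum_mul_left, ← opTrace_eq_tsum_posSqrt hA]

/-- Since `⟨w|A|w⟩ = ∑ |⟨w|A^{1/2}eᵢ⟩|²`, this is `lintegral_quadCost_husimi` summed over the
vectors `A^{1/2}eᵢ`. -/
theorem lintegral_quadCost_coherentExp {A : StateSpace d →L[ℂ] StateSpace d} (hA : A.IsPositive)
    {ħ : ℝ} (hħ : 0 < ħ) (z : Phase d) :
    ∫⁻ w, ENNReal.ofReal (quadCost z w) * ENNReal.ofReal (coherentExp ħ A w) =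
      ENNReal.ofReal ((2 * Real.pi * ħ) ^ d) *
        (costTrace ħ z A + ENNReal.ofReal (d * ħ / 2) * opTrace A) := by
  simp_rw [coherentExp, ← tsum_inner_posSqrt (stdBasis d) hA, ← ENNReal.tsum_mul_left]
  have hm : ∀ i, Measurable fun w : Phase d => ENNReal.ofReal (quadCost z w) *
      ‖⟪coherentState ħ w, posSqrt A (stdBasis d i)⟫_ℂ‖ₑ ^ 2 := fun i =>
    (continuous_quadCost.comp (Continuous.prodMk_right z)).measurable.ennreal_ofReal.mul
      (measurable_enorm_inner_coherentState_sq hħ _)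
  rw [lintegral_tsum fun i => (hm i).aemeasurable]
  simp_rw [lintegral_quadCost_husimi hħ]
  rw [ENNReal.tsum_mul_left, ENNReal.tsum_add, ENNReal.tsum_mul_left,
    ← opTrace_eq_tsum_posSqrt hA, costTrace_eq]

theorem IsDensityOperator.husimi_eq_coherentExp (hR : IsDensityOperator R) {ħ : ℝ} (hħ : 0 < ħ)
    (z : Phase d) :
    husimi ħ R z = ((((2 * Real.pi * ħ) ^ d)⁻¹ * coherentExp ħ R z : ℝ) : ℂ) := by
  have h : ⟪coherentState ħ z, R (coherentState ħ z)⟫_ℂ = (coherentExp ħ R z : ℂ) := by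
    rw [coherentExp]
    exact (hR.isPositive.isSymmetric.coe_re_inner_self_apply _).symm
  rw [hR.husimi_eq hħ, h, Complex.real_smul, Complex.ofReal_mul]

theorem IsDensityOperator.husimi_re (hR : IsDensityOperator R) {ħ : ℝ} (hħ : 0 < ħ)
    (z : Phase d) : (husimi ħ R z).re = ((2 * Real.pi * ħ) ^ d)⁻¹ * coherentExp ħ R z := by
  rw [hR.husimi_eq_coherentExp hħ, Complex.ofReal_re]

theorem IsDensityOperator.husimi_re_nonneg (hR : IsDensityOperator R) {ħ : ℝ} (hħ : 0 < ħ)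
    (z : Phase d) : 0 ≤ (husimi ħ R z).re := by
  rw [hR.husimi_re hħ]
  exact mul_nonneg (by positivity) (coherentExp_nonneg hR.isPositive _ _)

theorem IsDensityOperator.continuous_husimi_re (hR : IsDensityOperator R) {ħ : ℝ} (hħ : 0 < ħ) :
    Continuous fun z => (husimi ħ R z).re := by
  simp_rw [hR.husimi_re hħ]
  exact continuous_const.mul (continuous_coherentExp hħ R)

theorem ofReal_mul_cancel_two_pi {ħ : ℝ} (hħ : 0 < ħ) (a : ℝ≥0∞) :
    ENNReal.ofReal (((2 * Real.pi * ħ) ^ d)⁻¹) *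
      (ENNReal.ofReal ((2 * Real.pi * ħ) ^ d) * a) = a := by
  rw [← mul_assoc, ← ENNReal.ofReal_mul (by positivity), inv_mul_cancel₀ (by positivity),
    ENNReal.ofReal_one, one_mul]

theorem IsDensityOperator.isProbabilityMeasure_husimiMeasure (hR : IsDensityOperator R) {ħ : ℝ}
    (hħ : 0 < ħ) : IsProbabilityMeasure (husimiMeasure ħ R) := by
  constructor
  rw [husimiMeasure, densityMeasure, withDensity_apply _ MeasurableSet.univ, Measure.restrict_univ]
  simp_rw [hR.husimi_re hħ]
  have h : 0 ≤ ((2 * Real.pi * ħ) ^ d)⁻¹ := by positivity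
  simp_rw [ENNReal.ofReal_mul h]
  rw [lintegral_const_mul' _ _ ENNReal.ofReal_ne_top, lintegral_coherentExp hR.isPositive hħ,
    hR.trace_eq_one, ofReal_mul_cancel_two_pi hħ]

theorem IsDensityOperator.integral_husimiMeasure (hR : IsDensityOperator R) {ħ : ℝ}
    (hħ : 0 < ħ) (f : Phase d → ℂ) :
    ∫ z, f z ∂(husimiMeasure ħ R) = ∫ z, husimi ħ R z * f z := by
  rw [husimiMeasure, densityMeasure, integral_withDensity_eq_integral_toReal_smul
    (hR.continuous_husimi_re hħ).measurable.ennreal_ofReal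
    (Eventually.of_forall fun _ => ENNReal.ofReal_lt_top)]
  congr 1
  ext z
  rw [ENNReal.toReal_ofReal (hR.husimi_re_nonneg hħ z), Complex.real_smul, hR.husimi_re hħ,
    ← hR.husimi_eq_coherentExp hħ]

/-- The Husimi transform of a coupling is a coupling of the Husimi transforms. -/
theorem exists_isMeasureCoupling {p : Phase d → ℝ} (hp : IsProbabilityDensity p)
    (hR : IsDensityOperator R) {ħ : ℝ} (hħ : 0 < ħ)
    {Q : Phase d → (StateSpace d →L[ℂ] StateSpace d)} (hQ : IsCoupling p R Q) :
    ∃ π, IsMeasureCoupling (densityMeasure p) (husimiMeasure ħ R) π ∧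
      ∫⁻ zw, ENNReal.ofReal (quadCost zw.1 zw.2) ∂π ≤
        (∫⁻ z, costTrace ħ z (Q z)) + ENNReal.ofReal ((1 / 2) * d * ħ) := by
  -- A strongly measurable representative makes `⟨w|Q'(z)|w⟩` jointly measurable in `(z, w)`.
  obtain ⟨Q', hQm, hQQ⟩ := hQ.aestronglyMeasurable
  have hpos : ∀ᵐ z, (Q' z).IsPositive := by
    filter_upwards [hQ.isPositive, hQQ] with z hz h
    rwa [← h]
  have htr : ∀ᵐ z, opTrace (Q' z) = ENNReal.ofReal (p z) := by
    filter_upwards [hQ.trace_eq, hQQ] with z hz h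
    rwa [← h]
  -- The operator norm is at most the trace, which is `p(z)`; matrix elements can therefore be taken
  -- under the Bochner integral.
  have hint : Integrable Q' := by
    refine hp.integrable.norm.mono' hQm.aestronglyMeasurable ?_
    filter_upwards [hpos, htr, hp.nonneg] with z h1 h2 h3
    have h4 := enorm_le_opTrace h1
    rw [h2, ← ofReal_norm, ENNReal.ofReal_le_ofReal_iff h3] at h4
    exact h4.trans (le_abs_self _)
  have hQR : ∫ z, Q' z = R := (integral_congr_ae hQQ).symm.trans hQ.integral_eq
  set c : ℝ≥0∞ := ENNReal.ofReal (((2 * Real.pi * ħ) ^ d)⁻¹) with hc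
  have hcs := continuous_coherentState (d := d) hħ
  have hem : Measurable fun zw : Phase d × Phase d => coherentExp ħ (Q' zw.1) zw.2 := by
    have h1 : StronglyMeasurable fun zw : Phase d × Phase d =>
        (Q' zw.1, coherentState ħ zw.2) :=
      (hQm.comp_measurable measurable_fst).prodMk
        (hcs.comp continuous_snd).stronglyMeasurable
    have h2 : StronglyMeasurable fun zw : Phase d × Phase d =>
        Q' zw.1 (coherentState ħ zw.2) :=
      isBoundedBilinearMap_apply.continuous.comp_stronglyMeasurable h1
    have h3 : StronglyMeasurable fun zw : Phase d × Phase d => coherentState ħ zw.2 :=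
      (hcs.comp continuous_snd).stronglyMeasurable
    exact (RCLike.continuous_re.comp_stronglyMeasurable (h3.inner h2)).measurable
  have hνm : Measurable fun zw : Phase d × Phase d =>
      c * ENNReal.ofReal (coherentExp ħ (Q' zw.1) zw.2) := hem.ennreal_ofReal.const_mul c
  -- The coupling has density `(2πħ)^{-d} ⟨w|Q'(z)|w⟩`. Integrating in `w` gives `trace Q'(z) =
  -- p(z)`; integrating in `z` gives `⟨w|R|w⟩`, hence the Husimi density.
  refine ⟨(volume : Measure (Phase d × Phase d)).withDensity
    fun zw => c * ENNReal.ofReal (coherentExp ħ (Q' zw.1) zw.2), ⟨?_, ?_⟩, ?_⟩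
  · ext s hs
    rw [Measure.map_apply measurable_fst hs, withDensity_apply _ (measurable_fst hs),
      densityMeasure, withDensity_apply _ hs, ← Set.prod_univ, Measure.volume_eq_prod,
      ← Measure.prod_restrict, Measure.restrict_univ, lintegral_prod _ hνm.aemeasurable]
    refine setLIntegral_congr_fun_ae hs ?_
    filter_upwards [hpos, htr] with z h1 h2 _
    rw [lintegral_const_mul' _ _ ENNReal.ofReal_ne_top, lintegral_coherentExp h1 hħ,
      ofReal_mul_cancel_two_pi hħ, h2]
  · ext s hs
    rw [Measure.map_apply measurable_snd hs, withDensity_apply _ (measurable_snd hs),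
      husimiMeasure, densityMeasure, withDensity_apply _ hs, ← Set.univ_prod,
      Measure.volume_eq_prod, ← Measure.prod_restrict, Measure.restrict_univ,
      lintegral_prod_symm _ hνm.aemeasurable]
    refine lintegral_congr fun w => ?_
    have hi : Integrable fun z => coherentExp ħ (Q' z) w := by
      have h1 : Integrable fun z => ⟪coherentState ħ w, Q' z (coherentState ħ w)⟫_ℂ :=
        (hint.apply_continuousLinearMap _).const_inner _
      exact h1.re
    have hi2 : ∫ z, coherentExp ħ (Q' z) w = coherentExp ħ R w := by
      simp only [coherentExp]
      rw [integral_re ((hint.apply_continuousLinearMap _).const_inner _),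
        integral_inner (hint.apply_continuousLinearMap _),
        ← ContinuousLinearMap.integral_apply hint, hQR]
    rw [lintegral_const_mul' _ _ ENNReal.ofReal_ne_top, ← ofReal_integral_eq_lintegral_ofReal hi,
      hi2, hR.husimi_re hħ, ENNReal.ofReal_mul (by positivity)]
    filter_upwards [hpos] with z hz
    exact coherentExp_nonneg hz _ _
  · have hqm : Measurable fun zw : Phase d × Phase d => ENNReal.ofReal (quadCost zw.1 zw.2) :=
      continuous_quadCost.measurable.ennreal_ofReal
    rw [lintegral_withDensity_eq_lintegral_mul _ hνm hqm, Measure.volume_eq_prod,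
      lintegral_prod _ (hνm.mul hqm).aemeasurable]
    have h1 : ∀ᵐ z, (∫⁻ w, ((fun zw : Phase d × Phase d =>
          c * ENNReal.ofReal (coherentExp ħ (Q' zw.1) zw.2)) *
          fun zw : Phase d × Phase d => ENNReal.ofReal (quadCost zw.1 zw.2)) (z, w)) =
        costTrace ħ z (Q z) + ENNReal.ofReal (d * ħ / 2) * ENNReal.ofReal (p z) := by
      filter_upwards [hpos, htr, hQQ] with z h1 h2 h3
      have h4 : ∀ w, ((fun zw : Phase d × Phase d =>
          c * ENNReal.ofReal (coherentExp ħ (Q' zw.1) zw.2)) *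
          fun zw : Phase d × Phase d => ENNReal.ofReal (quadCost zw.1 zw.2)) (z, w) =
          c * (ENNReal.ofReal (quadCost z w) * ENNReal.ofReal (coherentExp ħ (Q' z) w)) := by
        intro w
        simp only [Pi.mul_apply]
        ring
      simp_rw [h4]
      rw [lintegral_const_mul' _ _ ENNReal.ofReal_ne_top, lintegral_quadCost_coherentExp h1 hħ,
        ofReal_mul_cancel_two_pi hħ, h2, h3]
    rw [lintegral_congr_ae h1, lintegral_add_right' _ (hp.aemeasurable_ofReal.const_mul _),
      lintegral_const_mul' _ _ ENNReal.ofReal_ne_top, hp.lintegral_eq_one, mul_one,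
      show (1 / 2 : ℝ) * d * ħ = d * ħ / 2 by ring]

theorem distMK_husimiMeasure_sq_le {p : Phase d → ℝ} (hp : IsProbabilityDensity p)
    (hR : IsDensityOperator R) {ħ : ℝ} (hħ : 0 < ħ) :
    distMK (densityMeasure p) (husimiMeasure ħ R) ^ 2 ≤
      hybridE ħ p R ^ 2 + ENNReal.ofReal ((1 / 2) * d * ħ) := by
  rw [hybridE_sq, distMK_sq]
  simp_rw [ENNReal.iInf_add]
  refine le_iInf₂ fun Q hQ => ?_
  obtain ⟨π, hπ, hle⟩ := exists_isMeasureCoupling hp hR hħ hQ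
  exact (iInf₂_le π hπ).trans hle

end HusimiCouplings

/-! ### Fourier representation of test functions -/

section PhaseSpaceFourier

variable {d : ℕ} {R : StateSpace d →L[ℂ] StateSpace d}

/-- The Fourier transform on phase space, with the convention of `phaseFactor`. -/
def phaseFourier (ψ : Phase d → ℂ) (w : Phase d) : ℂ :=
  ∫ ζ : Phase d, phaseFactor w.1 ζ.1 * phaseFactor w.2 ζ.2 * ψ ζ

theorem norm_phaseFactor_mul (w ζ : Phase d) :
    ‖phaseFactor w.1 ζ.1 * phaseFactor w.2 ζ.2‖ = 1 := by
  rw [norm_mul, norm_phaseFactor, norm_phaseFactor, mul_one]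

theorem continuous_phaseFactor_mul : Continuous fun q : Phase d × Phase d =>
    phaseFactor q.1.1 q.2.1 * phaseFactor q.1.2 q.2.2 := by
  unfold phaseFactor
  fun_prop

theorem integrable_phaseFactor_mul {ψ : Phase d → ℂ} (hψ : Integrable ψ) (w : Phase d) :
    Integrable fun ζ : Phase d => phaseFactor w.1 ζ.1 * phaseFactor w.2 ζ.2 * ψ ζ :=
  hψ.bdd_mul (c := 1)
    (continuous_phaseFactor_mul.comp (Continuous.prodMk_right w)).aestronglyMeasurable
    (Eventually.of_forall fun ζ => (norm_phaseFactor_mul w ζ).le)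

theorem continuous_phaseFourier {ψ : Phase d → ℂ} (hψ : Integrable ψ) :
    Continuous (phaseFourier ψ) := by
  refine continuous_of_dominated (bound := fun ζ => ‖ψ ζ‖)
    (fun w => (integrable_phaseFactor_mul hψ w).aestronglyMeasurable)
    (fun w => Eventually.of_forall fun ζ => ?_) hψ.norm (Eventually.of_forall fun ζ => ?_)
  · rw [norm_mul, norm_phaseFactor_mul, one_mul]
  · exact (continuous_phaseFactor_mul.comp (Continuous.prodMk_left ζ)).mul continuous_const

theorem phaseFactor_eq_fourierChar (v w : Pos d) :
    phaseFactor v ((2 * Real.pi) • w) = Real.fourierChar (-⟪v, w⟫_ℝ) := by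
  rw [phaseFactor, Real.fourierChar_apply, inner_smul_right]
  congr 1
  push_cast
  ring

/-- Fourier inversion with the convention of `phaseFactor`. -/
theorem integral_phaseFactor_mul_inversion {h g : Pos d → ℂ} (hc : Continuous h)
    (hi : Integrable h) (hg : ∀ ξ, g ξ = ∫ y, phaseFactor ξ y * h y) (hgi : Integrable g)
    (y : Pos d) :
    ∫ ξ, phaseFactor ξ y * g ξ = ((2 * Real.pi) ^ d : ℝ) • h (-y) := by
  have hF : 𝓕 h = fun w => g ((2 * Real.pi) • w) := by
    ext w
    rw [Real.fourier_eq, hg]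
    congr 1
    ext v
    rw [Circle.smul_def, ← phaseFactor_eq_fourierChar, smul_eq_mul]
    simp only [phaseFactor, inner_smul_left, inner_smul_right, real_inner_comm]
    rfl
  have hFi : Integrable (𝓕 h) := by
    rw [hF]
    exact hgi.comp_smul (by positivity)
  have h1 := congrFun (hc.fourierInv_fourier_eq hi hFi) (-y)
  rw [← h1, Real.fourierInv_eq, hF]
  have h2 := Measure.integral_comp_smul (volume : Measure (Pos d))
    (fun ξ => phaseFactor ξ y * g ξ) (2 * Real.pi)
  rw [finrank_euclideanSpace_fin, abs_of_pos (by positivity)] at h2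
  have h3 : ∫ w, Real.fourierChar ⟪w, -y⟫_ℝ • g ((2 * Real.pi) • w) =
      ∫ ξ, phaseFactor ((2 * Real.pi) • ξ) y * g ((2 * Real.pi) • ξ) := by
    congr 1
    ext w
    rw [inner_neg_right, Circle.smul_def, ← phaseFactor_eq_fourierChar, smul_eq_mul]
    simp only [phaseFactor, inner_smul_left, inner_smul_right]
    rfl
  rw [h3, h2, smul_smul, mul_inv_cancel₀ (by positivity), one_smul]

/-- The Fourier transform is onto the Schwartz space. As `Phase d` carries the sup norm, the
transform is taken on `WithLp 2 (Phase d)`; `S` passes from the convention `e^{-2πi⟨·,·⟩}` to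
`e^{-i⟨·,·⟩}`, and `c` is the Jacobian of that scaling. -/
theorem exists_schwartz_phaseFourier_eq (θ : 𝓢(Phase d, ℂ)) :
    ∃ ψ : 𝓢(Phase d, ℂ), ∀ w, θ w = phaseFourier ψ w := by
  let L : WithLp 2 (Phase d) ≃L[ℝ] Phase d := WithLp.prodContinuousLinearEquiv 2 ℝ (Pos d) (Pos d)
  let Θ : 𝓢(WithLp 2 (Phase d), ℂ) := SchwartzMap.compCLMOfContinuousLinearEquiv ℂ L θ
  let Ψ : 𝓢(WithLp 2 (Phase d), ℂ) := 𝓕⁻ Θ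
  let S : Phase d ≃L[ℝ] WithLp 2 (Phase d) := L.symm.trans
    (ContinuousLinearEquiv.smulLeft (Units.mk0 ((2 * Real.pi)⁻¹ : ℝ) (by positivity)))
  let c : ℝ := |((2 * Real.pi)⁻¹ : ℝ) ^ Module.finrank ℝ (WithLp 2 (Phase d))|
  refine ⟨(c : ℂ) • SchwartzMap.compCLMOfContinuousLinearEquiv ℂ S Ψ, fun w => ?_⟩
  have h1 : θ w = 𝓕 (Ψ : WithLp 2 (Phase d) → ℂ) (L.symm w) := by
    rw [← SchwartzMap.fourier_coe, FourierTransform.fourier_fourierInv_eq]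
    simp [Θ, SchwartzMap.compCLMOfContinuousLinearEquiv_apply]
  have h2 := Measure.integral_comp_smul (volume : Measure (WithLp 2 (Phase d)))
    (fun v => Real.fourierChar (-⟪v, L.symm w⟫_ℝ) • Ψ v) ((2 * Real.pi)⁻¹ : ℝ)
  have hc : c ≠ 0 := by simp only [c]; positivity
  rw [abs_inv, eq_inv_smul_iff₀ hc] at h2
  rw [h1, Real.fourier_eq, ← h2, phaseFourier, ← (WithLp.volume_preserving_toLp (Pos d) (Pos d)).integral_comp
    L.symm.toHomeomorph.measurableEmbedding, ← integral_smul]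
  congr 1
  ext ζ
  have h3 : (Real.fourierChar (-⟪((2 * Real.pi)⁻¹ : ℝ) • (WithLp.toLp 2 ζ : WithLp 2 (Phase d)),
      L.symm w⟫_ℝ) : ℂ) = phaseFactor w.1 ζ.1 * phaseFactor w.2 ζ.2 := by
    rw [Real.fourierChar_apply, phaseFactor, phaseFactor, ← Complex.exp_add, inner_smul_left]
    congr 1
    have h4 : ⟪(WithLp.toLp 2 ζ : WithLp 2 (Phase d)), L.symm w⟫_ℝ =
        ⟪w.1, ζ.1⟫_ℝ + ⟪w.2, ζ.2⟫_ℝ := by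
      rw [WithLp.prod_inner_apply]
      exact congrArg₂ (· + ·) (real_inner_comm _ _) (real_inner_comm _ _)
    rw [h4]
    have : (Real.pi : ℂ) ≠ 0 := by exact_mod_cast Real.pi_ne_zero
    push_cast
    simp only [conj_trivial]
    push_cast
    field_simp
    ring
  rw [Circle.smul_def, h3]
  simp only [smul_apply, Complex.real_smul, smul_eq_mul]
  rw [mul_left_comm]
  rfl

/-- The decay exponent `d + 1` exceeds the dimension of `Pos d`, so the bound is integrable. It
dominates the partial transforms of `ψ`, uniformly in the second variable. -/
theorem exists_schwartz_fst_bound (ψ : 𝓢(Phase d, ℂ)) :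
    ∃ b : Pos d → ℝ, Integrable b ∧ ∀ ζ : Phase d, ‖ψ ζ‖ ≤ b ζ.1 := by
  let k : ℕ := d + 1
  let C : ℝ := 2 ^ k * ((Finset.Iic (k, 0)).sup fun m => SchwartzMap.seminorm ℝ m.1 m.2) ψ
  refine ⟨fun η => C * (1 + ‖η‖) ^ (-(k : ℝ)), (integrable_one_add_norm ?_).const_mul C,
    fun ζ => ?_⟩
  · rw [finrank_euclideanSpace_fin]
    simp [k]
  · have h := SchwartzMap.one_add_le_sup_seminorm_apply (𝕜 := ℝ) (m := (k, 0)) (le_refl k)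
      (le_refl 0) ψ ζ
    rw [norm_iteratedFDeriv_zero] at h
    beta_reduce
    rw [Real.rpow_neg (by positivity), Real.rpow_natCast, ← div_eq_mul_inv,
      le_div_iff₀ (by positivity), mul_comm]
    refine le_trans ?_ h
    gcongr
    exact norm_fst_le ζ

/-- Fourier inversion in momentum bounds the partial transform of `phaseFourier ψ` at `(x, y)` by
`(2π)^d ∫ |ψ(η, -y)| dη`, independently of `x`. The `x`-integral of the kernel is at most `1`, so
the bound is uniform in `ħ`. -/
theorem IsDensityOperator.enorm_integral_wigner_mul_le (hR : IsDensityOperator R) {ħ : ℝ}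
    (hħ : 0 < ħ) {ψ : Phase d → ℂ} (hc : Continuous ψ) (hi : Integrable ψ) {b : Pos d → ℝ}
    (hb : Integrable b) (hψb : ∀ ζ : Phase d, ‖ψ ζ‖ ≤ b ζ.1)
    (hF : Integrable (phaseFourier ψ)) :
    ‖∫ w, wigner ħ R w * phaseFourier ψ w‖ₑ ≤ ∫⁻ ζ, ‖ψ ζ‖ₑ := by
  have hcp : 0 < (2 * Real.pi) ^ d := by positivity
  set K : Pos d → ℝ≥0∞ := fun y => ∫⁻ η, ‖ψ (η, y)‖ₑ with hK
  have hKm : Measurable K :=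
    Measurable.lintegral_prod_left' (f := fun ζ : Phase d => ‖ψ ζ‖ₑ) hc.enorm.measurable
  have hΘ : ∀ᵐ x : Pos d, ∀ y, ‖momentumFourier (phaseFourier ψ) (x, y)‖ₑ ≤
      ENNReal.ofReal ((2 * Real.pi) ^ d) * K (-y) := by
    filter_upwards [hF.prod_right_ae] with x hx y
    have hpc : Continuous fun η : Pos d => phaseFactor x η :=
      continuous_phaseFactor.comp (Continuous.prodMk_right x)
    -- Pointwise inversion requires a continuous function; the domination by `b` is used only here.
    have hh : Continuous fun y => ∫ η, phaseFactor x η * ψ (η, y) := by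
      refine continuous_of_dominated (bound := b)
        (fun y => (hpc.mul (hc.comp (Continuous.prodMk_left y))).aestronglyMeasurable)
        (fun y => Eventually.of_forall fun η => ?_) hb (Eventually.of_forall fun η => ?_)
      · rw [norm_mul, norm_phaseFactor, one_mul]
        exact hψb (η, y)
      · exact continuous_const.mul (hc.comp (Continuous.prodMk_right η))
    have hint : Integrable (fun ζ : Phase d => phaseFactor x ζ.1 * ψ ζ)
        ((volume : Measure (Pos d)).prod volume) :=
      hi.bdd_mul (c := 1) (hpc.comp continuous_fst).aestronglyMeasurable
        (Eventually.of_forall fun ζ => (norm_phaseFactor _ _).le)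
    have hinv := integral_phaseFactor_mul_inversion hh hint.integral_prod_right
      (g := fun ξ => phaseFourier ψ (x, ξ)) (fun ξ => by
        have h1 := integrable_phaseFactor_mul hi (x, ξ)
        rw [phaseFourier, Measure.volume_eq_prod, integral_prod_symm _ h1]
        congr 1
        ext y
        rw [← integral_const_mul]
        congr 1
        ext η
        ring) hx y
    rw [momentumFourier, hinv, enorm_smul, Real.enorm_of_nonneg hcp.le]
    gcongr
    refine (enorm_integral_le_lintegral_enorm _).trans (le_of_eq ?_)
    simp_rw [enorm_mul, enorm_phaseFactor, one_mul, hK]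
  have hθm := (continuous_phaseFourier hi).stronglyMeasurable
  have hkm := hR.aestronglyMeasurable_wignerKernel hħ
  have hmeas : AEMeasurable (fun v : Pos d × Pos d =>
      ‖wignerKernel ħ R v‖ₑ * (ENNReal.ofReal ((2 * Real.pi) ^ d) * K (-v.2))) volume :=
    hkm.enorm.mul ((hKm.comp measurable_snd.neg).const_mul _).aemeasurable
  rw [hR.integral_wigner_mul hħ hθm hF, enorm_smul, Real.enorm_of_nonneg (by positivity)]
  have key : ‖∫ v, wignerKernel ħ R v * momentumFourier (phaseFourier ψ) v‖ₑ ≤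
      ENNReal.ofReal ((2 * Real.pi) ^ d) * ∫⁻ ζ, ‖ψ ζ‖ₑ := by
    calc _ ≤ ∫⁻ v, ‖wignerKernel ħ R v * momentumFourier (phaseFourier ψ) v‖ₑ :=
          enorm_integral_le_lintegral_enorm _
      _ ≤ ∫⁻ v, ‖wignerKernel ħ R v‖ₑ * (ENNReal.ofReal ((2 * Real.pi) ^ d) * K (-v.2)) := by
          refine lintegral_mono_ae ?_
          have h2 := (Measure.quasiMeasurePreserving_fst (μ := (volume : Measure (Pos d)))
            (ν := (volume : Measure (Pos d)))).ae hΘ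
          filter_upwards [h2] with v hv
          rw [enorm_mul]
          gcongr
          exact hv v.2
      _ = ∫⁻ y, ∫⁻ x, ‖wignerKernel ħ R (x, y)‖ₑ *
            (ENNReal.ofReal ((2 * Real.pi) ^ d) * K (-y)) := by
          rw [Measure.volume_eq_prod, lintegral_prod_symm _ hmeas]
      _ ≤ ∫⁻ y, ENNReal.ofReal ((2 * Real.pi) ^ d) * K (-y) := by
          refine lintegral_mono_ae ?_
          have hsw := (hkm.comp_quasiMeasurePreserving (Measure.measurePreserving_swap
            (μ := (volume : Measure (Pos d)))
            (ν := (volume : Measure (Pos d)))).quasiMeasurePreserving).prodMk_left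
          filter_upwards [hR.lintegral_wignerKernel_left hħ, hsw] with y hy hym
          have hym' : AEMeasurable (fun x => ‖wignerKernel ħ R (x, y)‖ₑ) := hym.enorm
          rw [lintegral_mul_const'' _ hym']
          exact mul_le_of_le_one_left' hy
      _ = _ := by
          rw [lintegral_const_mul' _ _ ENNReal.ofReal_ne_top, lintegral_neg_eq_self K, hK,
            Measure.volume_eq_prod, lintegral_prod_symm _ hc.enorm.measurable.aemeasurable]
  calc _ ≤ ENNReal.ofReal (((2 * Real.pi) ^ d)⁻¹) *
        (ENNReal.ofReal ((2 * Real.pi) ^ d) * ∫⁻ ζ, ‖ψ ζ‖ₑ) := by gcongr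
    _ = _ := by
        rw [← mul_assoc, ← ENNReal.ofReal_mul (by positivity), inv_mul_cancel₀ hcp.ne',
          ENNReal.ofReal_one, one_mul]

end PhaseSpaceFourier

/-! ### Comparison of the Wigner and Husimi transforms -/

section HeatMultiplier

variable {d : ℕ} {R : StateSpace d →L[ℂ] StateSpace d}

/-- The characteristic function of the heat kernel at time `ħ/4`. -/
def heatMultiplier (ħ : ℝ) (ζ : Phase d) : ℝ :=
  Real.exp (-(ħ / 4) * ‖ζ.1‖ ^ 2) * Real.exp (-(ħ / 4) * ‖ζ.2‖ ^ 2)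

theorem continuous_heatMultiplier (ħ : ℝ) :
    Continuous (heatMultiplier ħ : Phase d → ℝ) := by
  unfold heatMultiplier
  fun_prop

theorem heatMultiplier_nonneg (ħ : ℝ) (ζ : Phase d) : 0 ≤ heatMultiplier ħ ζ := by
  unfold heatMultiplier
  positivity

theorem heatMultiplier_le_one {ħ : ℝ} (hħ : 0 < ħ) (ζ : Phase d) : heatMultiplier ħ ζ ≤ 1 := by
  unfold heatMultiplier
  rw [← Real.exp_add, Real.exp_le_one_iff]
  nlinarith [mul_nonneg hħ.le (sq_nonneg ‖ζ.1‖), mul_nonneg hħ.le (sq_nonneg ‖ζ.2‖)]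

theorem norm_heatMultiplier_sub_one_le {ħ : ℝ} (hħ : 0 < ħ) (ζ : Phase d) :
    ‖((heatMultiplier ħ ζ - 1 : ℝ) : ℂ)‖ ≤ 1 := by
  rw [Complex.norm_real, Real.norm_eq_abs, abs_le]
  constructor <;> linarith [heatMultiplier_nonneg ħ ζ, heatMultiplier_le_one hħ ζ]

theorem integral_phaseFactor_mul_heatKernel {ħ : ℝ} (hħ : 0 < ħ) (ζ : Phase d) :
    ∫ v : Phase d, (phaseFactor v.1 ζ.1 * phaseFactor v.2 ζ.2) * (heatKernel (ħ / 4) v : ℂ) =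
      (heatMultiplier ħ ζ : ℂ) := by
  have h : ∀ v : Phase d, (phaseFactor v.1 ζ.1 * phaseFactor v.2 ζ.2) *
      (heatKernel (ħ / 4) v : ℂ) = (phaseFactor v.1 ζ.1 * (gaussWeight ħ v.1 : ℂ)) *
        (phaseFactor v.2 ζ.2 * (gaussWeight ħ v.2 : ℂ)) := by
    intro v
    rw [heatKernel_eq hħ, Complex.ofReal_mul]
    ring
  simp_rw [h]
  rw [Measure.volume_eq_prod, integral_prod_mul (fun x => phaseFactor x ζ.1 * (gaussWeight ħ x : ℂ))
    (fun x => phaseFactor x ζ.2 * (gaussWeight ħ x : ℂ)),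
    integral_phaseFactor_mul_gaussWeight hħ, integral_phaseFactor_mul_gaussWeight hħ,
    heatMultiplier, Complex.ofReal_mul]

theorem phaseFactor_add (a b y : Pos d) :
    phaseFactor (a + b) y = phaseFactor a y * phaseFactor b y := by
  simp only [phaseFactor, ← Complex.exp_add, inner_add_left]
  congr 1
  push_cast
  ring

/-- The heat semigroup acts on a Fourier transform as a multiplier. -/
theorem integral_heatKernel_mul_phaseFourier {ħ : ℝ} (hħ : 0 < ħ) {ψ : Phase d → ℂ}
    (hi : Integrable ψ) (w : Phase d) :
    ∫ z, (heatKernel (ħ / 4) (z - w) : ℂ) * phaseFourier ψ z =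
      phaseFourier (fun ζ => (heatMultiplier ħ ζ : ℂ) * ψ ζ) w := by
  have hint : Integrable (fun q : Phase d × Phase d =>
      (phaseFactor (q.1 + w).1 q.2.1 * phaseFactor (q.1 + w).2 q.2.2) *
        ((heatKernel (ħ / 4) q.1 : ℂ) * ψ q.2)) (volume.prod volume) := by
    have hc : Continuous fun q : Phase d × Phase d =>
        phaseFactor (q.1 + w).1 q.2.1 * phaseFactor (q.1 + w).2 q.2.2 := by
      unfold phaseFactor
      fun_prop
    exact ((integrable_heatKernel hħ).ofReal.mul_prod hi).bdd_mul (c := 1) hc.aestronglyMeasurable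
      (Eventually.of_forall fun q => (norm_phaseFactor_mul _ _).le)
  rw [← integral_add_right_eq_self (fun z => (heatKernel (ħ / 4) (z - w) : ℂ) * phaseFourier ψ z) w]
  simp only [add_sub_cancel_right, phaseFourier]
  simp_rw [← integral_const_mul]
  calc _ = ∫ v, ∫ ζ, (phaseFactor (v + w).1 ζ.1 * phaseFactor (v + w).2 ζ.2) *
        ((heatKernel (ħ / 4) v : ℂ) * ψ ζ) := by
        congr 1; ext v; congr 1; ext ζ; ring
    _ = ∫ ζ, ∫ v, (phaseFactor (v + w).1 ζ.1 * phaseFactor (v + w).2 ζ.2) *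
        ((heatKernel (ħ / 4) v : ℂ) * ψ ζ) := integral_integral_swap hint
    _ = _ := by
        congr 1
        ext ζ
        rw [← integral_phaseFactor_mul_heatKernel hħ, mul_left_comm, ← integral_mul_const]
        congr 1
        ext v
        simp only [Prod.fst_add, Prod.snd_add, phaseFactor_add]
        ring

theorem integrable_heatKernel_mul {ħ : ℝ} (hħ : 0 < ħ) {θ : Phase d → ℂ} (hθ : Integrable θ) :
    Integrable (fun q : Phase d × Phase d => (heatKernel (ħ / 4) (q.2 - q.1) : ℂ) * θ q.2)
      (volume.prod volume) := by
  have h := hθ.convolution_integrand (ContinuousLinearMap.mul ℂ ℂ) (μ := volume)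
    (integrable_heatKernel hħ).ofReal (𝕜 := ℂ)
  refine h.congr (Eventually.of_forall fun q => ?_)
  simp only [ContinuousLinearMap.mul_apply', heatKernel_sub_comm _ q.1, mul_comm]
  rfl

/-- The heat semigroup moves to the test function because its kernel is even. Fubini needs only that
the Wigner function be essentially bounded for this `ħ`, not that it be integrable. -/
theorem IsDensityOperator.integral_husimi_mul (hR : IsDensityOperator R) {ħ : ℝ} (hħ : 0 < ħ)
    {θ : Phase d → ℂ} (hθ : Integrable θ) :
    ∫ z, husimi ħ R z * θ z =
      ∫ w, wigner ħ R w * ∫ z, (heatKernel (ħ / 4) (z - w) : ℂ) * θ z := by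
  have hint : Integrable (fun q : Phase d × Phase d => wigner ħ R q.1 *
      ((heatKernel (ħ / 4) (q.2 - q.1) : ℂ) * θ q.2)) (volume.prod volume) := by
    refine (integrable_heatKernel_mul hħ hθ).bdd_mul (c := ((Real.pi * ħ) ^ d)⁻¹)
      (hR.aestronglyMeasurable_wigner hħ).comp_fst ?_
    filter_upwards [(Measure.quasiMeasurePreserving_fst (μ := (volume : Measure (Phase d)))
      (ν := (volume : Measure (Phase d)))).ae (hR.enorm_wigner_le hħ)] with z hz
    rwa [← ofReal_norm, ENNReal.ofReal_le_ofReal_iff (by positivity)] at hz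
  simp_rw [husimi, ← integral_mul_const, ← integral_const_mul]
  refine Eq.trans ?_ (integral_integral_swap hint).symm
  congr 1; ext z; congr 1; ext w; ring

/-- The difference is the Wigner function tested against the transform of `(heatMultiplier ħ - 1)
ψ`, to which the bound uniform in `ħ` applies. -/
theorem IsDensityOperator.enorm_integral_husimi_sub_wigner_le (hR : IsDensityOperator R) {ħ : ℝ}
    (hħ : 0 < ħ) {θ ψ : 𝓢(Phase d, ℂ)} (h : ∀ w, θ w = phaseFourier ψ w) :
    ‖(∫ z, husimi ħ R z * θ z) - ∫ z, wigner ħ R z * θ z‖ₑ ≤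
      ∫⁻ ζ, ‖((heatMultiplier ħ ζ - 1 : ℝ) : ℂ) * ψ ζ‖ₑ := by
  have hψi : Integrable ψ := ψ.integrable
  have hθi : Integrable θ := θ.integrable
  have hmc : Continuous fun ζ : Phase d => ((heatMultiplier ħ ζ - 1 : ℝ) : ℂ) :=
    Complex.continuous_ofReal.comp ((continuous_heatMultiplier ħ).sub continuous_const)
  have hi1 : Integrable fun ζ : Phase d => ((heatMultiplier ħ ζ - 1 : ℝ) : ℂ) * ψ ζ :=
    hψi.bdd_mul (c := 1) hmc.aestronglyMeasurable
      (Eventually.of_forall fun ζ => norm_heatMultiplier_sub_one_le hħ ζ)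
  have hi2 : Integrable fun ζ : Phase d => (heatMultiplier ħ ζ : ℂ) * ψ ζ := by
    refine (hi1.add hψi).congr (Eventually.of_forall fun ζ => ?_)
    simp only [Pi.add_apply]
    push_cast
    ring
  have hθF : (θ : Phase d → ℂ) = phaseFourier ψ := funext h
  have hconv : Integrable fun w => ∫ z, (heatKernel (ħ / 4) (z - w) : ℂ) * θ z :=
    (integrable_heatKernel_mul hħ hθi).integral_prod_left
  have hdiff : ∀ w, (∫ z, (heatKernel (ħ / 4) (z - w) : ℂ) * θ z) - θ w =
      phaseFourier (fun ζ => ((heatMultiplier ħ ζ - 1 : ℝ) : ℂ) * ψ ζ) w := by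
    intro w
    rw [hθF, integral_heatKernel_mul_phaseFourier hħ hψi, phaseFourier, phaseFourier,
      phaseFourier, ← integral_sub (integrable_phaseFactor_mul hi2 w)
        (integrable_phaseFactor_mul hψi w)]
    congr 1
    ext ζ
    push_cast
    ring
  have hF : Integrable (phaseFourier fun ζ => ((heatMultiplier ħ ζ - 1 : ℝ) : ℂ) * ψ ζ) :=
    (hconv.sub hθi).congr (Eventually.of_forall hdiff)
  obtain ⟨b, hb, hψb⟩ := exists_schwartz_fst_bound ψ
  rw [hR.integral_husimi_mul hħ hθi, ← integral_sub (hR.integrable_wigner_mul hħ hconv)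
    (hR.integrable_wigner_mul hħ hθi)]
  simp_rw [← mul_sub, hdiff]
  refine hR.enorm_integral_wigner_mul_le hħ (hmc.mul ψ.continuous) hi1 hb (fun ζ => ?_) hF
  rw [norm_mul]
  exact (mul_le_of_le_one_left (norm_nonneg _) (norm_heatMultiplier_sub_one_le hħ ζ)).trans
    (hψb ζ)

/-- The Wigner and Husimi functions have the same classical limits. -/
theorem tendsto_integral_husimi {R : ℝ → StateSpace d →L[ℂ] StateSpace d}
    (hR : ∀ ħ, 0 < ħ → IsDensityOperator (R ħ)) {μ : 𝓢'(Phase d, ℂ)} (hμ : WignerTendsto R μ)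
    (θ : 𝓢(Phase d, ℂ)) :
    Tendsto (fun ħ => ∫ z, husimi ħ (R ħ) z * θ z) (𝓝[>] 0) (𝓝 (μ θ)) := by
  obtain ⟨ψ, hψ⟩ := exists_schwartz_phaseFourier_eq θ
  have hpos : ∀ᶠ ħ : ℝ in 𝓝[>] 0, 0 < ħ := eventually_mem_nhdsWithin
  -- The multiplier tends to `1` pointwise and differs from `1` by at most `1`, so `|ψ|` dominates.
  have hlim : Tendsto (fun ħ : ℝ => ∫⁻ ζ : Phase d, ‖((heatMultiplier ħ ζ - 1 : ℝ) : ℂ) * ψ ζ‖ₑ)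
      (𝓝[>] 0) (𝓝 (∫⁻ _ : Phase d, 0)) := by
    refine tendsto_lintegral_filter_of_dominated_convergence (fun ζ => ‖ψ ζ‖ₑ) ?_ ?_
      ψ.integrable.2.ne ?_
    · refine Eventually.of_forall fun ħ => ?_
      exact ((Complex.continuous_ofReal.comp ((continuous_heatMultiplier ħ).sub
        continuous_const)).mul ψ.continuous).enorm.measurable
    · filter_upwards [hpos] with ħ hħ
      refine Eventually.of_forall fun ζ => ?_
      rw [enorm_mul]
      refine mul_le_of_le_one_left' ?_
      rw [← ofReal_norm, ENNReal.ofReal_le_one]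
      exact norm_heatMultiplier_sub_one_le hħ ζ
    · refine Eventually.of_forall fun ζ => ?_
      have hc : Continuous fun ħ : ℝ => ‖((heatMultiplier ħ ζ - 1 : ℝ) : ℂ) * ψ ζ‖ₑ := by
        have : Continuous fun ħ : ℝ => heatMultiplier ħ ζ := by
          unfold heatMultiplier
          fun_prop
        exact ((Complex.continuous_ofReal.comp (this.sub continuous_const)).mul
          continuous_const).enorm
      have h0 := (hc.tendsto 0).mono_left (nhdsWithin_le_nhds (s := Set.Ioi 0))
      simpa [heatMultiplier] using h0
  rw [lintegral_zero] at hlim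
  have hdiff : Tendsto (fun ħ => (∫ z, husimi ħ (R ħ) z * θ z) - ∫ z, wigner ħ (R ħ) z * θ z)
      (𝓝[>] 0) (𝓝 0) := by
    rw [tendsto_zero_iff_enorm_tendsto_zero]
    refine tendsto_of_tendsto_of_tendsto_of_le_of_le' tendsto_const_nhds hlim
      (Eventually.of_forall fun _ => zero_le) ?_
    filter_upwards [hpos] with ħ hħ
    exact (hR ħ hħ).enorm_integral_husimi_sub_wigner_le hħ hψ
  simpa using hdiff.add (hμ θ)

end HeatMultiplier

/-! ### Tightness and weak limits -/

section WeakLimits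

variable {d : ℕ} {R : StateSpace d →L[ℂ] StateSpace d}

/-- The extension of a Schwartz function by `0` to the one-point compactification. -/
def onePointExtend (θ : 𝓢(Phase d, ℂ)) : BoundedContinuousFunction (OnePoint (Phase d)) ℂ :=
  BoundedContinuousFunction.mkOfCompact ⟨fun x => x.elim 0 θ, by
    rw [continuous_iff_continuousAt]
    intro x
    induction x using OnePoint.rec with
    | infty =>
      rw [OnePoint.continuousAt_infty', coclosedCompact_eq_cocompact]
      exact θ.tendsto_cocompact
    | coe x =>
      rw [OnePoint.continuousAt_coe]
      exact θ.continuous.continuousAt⟩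

theorem onePointExtend_infty (θ : 𝓢(Phase d, ℂ)) :
    onePointExtend θ OnePoint.infty = 0 := rfl

/-- Limits of probability measures against Schwartz functions are measures of mass at most `1`. -/
theorem exists_measure_of_tendsto_integral (P : ℕ → Measure (Phase d))
    (hP : ∀ n, IsProbabilityMeasure (P n)) (Λ : 𝓢(Phase d, ℂ) → ℂ)
    (h : ∀ θ : 𝓢(Phase d, ℂ), Tendsto (fun n => ∫ z, θ z ∂(P n)) atTop (𝓝 (Λ θ))) :
    ∃ m : Measure (Phase d), m Set.univ ≤ 1 ∧ ∀ θ, Λ θ = ∫ z, θ z ∂m := by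
  -- On the one-point compactification probability measures form a compact space. Mass may be lost
  -- to the point at infinity, where extended Schwartz functions vanish; the restriction of the
  -- limit thus represents `Λ` with mass at most `1`.
  let _ : MeasurableSpace (OnePoint (Phase d)) := borel _
  have : BorelSpace (OnePoint (Phase d)) := ⟨rfl⟩
  have he : MeasurableEmbedding ((↑) : Phase d → OnePoint (Phase d)) :=
    OnePoint.isOpenEmbedding_coe.measurableEmbedding
  have hpr : ∀ n, IsProbabilityMeasure ((P n).map ((↑) : Phase d → OnePoint (Phase d))) :=
    fun n => Measure.isProbabilityMeasure_map he.measurable.aemeasurable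
  let ν : ℕ → ProbabilityMeasure (OnePoint (Phase d)) := fun n => ⟨_, hpr n⟩
  -- An ultrafilter finer than `atTop` replaces the extraction of a subsequence; limits along
  -- `atTop` persist along it.
  obtain ⟨ν₀, -, hν⟩ := isCompact_univ.ultrafilter_le_nhds ((hyperfilter ℕ).map ν) (by simp)
  have hν' : Tendsto ν (hyperfilter ℕ) (𝓝 ν₀) := hν
  rw [ProbabilityMeasure.tendsto_iff_forall_integral_rclike_tendsto ℂ] at hν'
  refine ⟨(ν₀ : Measure (OnePoint (Phase d))).comap (↑), ?_, fun θ => ?_⟩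
  · rw [he.comap_apply]
    exact prob_le_one
  · have h1 : ∀ n, ∫ x, onePointExtend θ x ∂(ν n : Measure (OnePoint (Phase d))) =
        ∫ z, θ z ∂(P n) := fun n => he.integral_map _
    have h2 := hν' (onePointExtend θ)
    simp_rw [h1] at h2
    have h3 := (h θ).mono_left Nat.hyperfilter_le_atTop
    rw [tendsto_nhds_unique h3 h2]
    have h4 := he.integral_map (μ := (ν₀ : Measure (OnePoint (Phase d))).comap (↑))
      (onePointExtend θ)
    rw [he.map_comap, setIntegral_eq_integral_of_forall_compl_eq_zero] at h4
    · exact h4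
    · intro x hx
      rw [OnePoint.notMem_range_coe_iff] at hx
      rw [hx, onePointExtend_infty]

theorem lintegral_norm_sq_densityMeasure_lt_top {p : Phase d → ℝ} (hp : IsProbabilityDensity p)
    (hp2 : HasFiniteSecondMoment p) :
    ∫⁻ z, ENNReal.ofReal (‖z.1‖ ^ 2 + ‖z.2‖ ^ 2) ∂(densityMeasure p) < ⊤ := by
  have hm : Measurable fun z : Phase d => ENNReal.ofReal (‖z.1‖ ^ 2 + ‖z.2‖ ^ 2) := by fun_prop
  rw [densityMeasure, lintegral_withDensity_eq_lintegral_mul₀ hp.aemeasurable_ofReal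
    hm.aemeasurable]
  refine lt_of_le_of_lt (lintegral_mono fun z => ?_) hp2.2
  simp only [Pi.mul_apply]
  rw [← ofReal_norm, mul_comm, ← ENNReal.ofReal_mul (by positivity)]
  exact ENNReal.ofReal_le_ofReal (le_abs_self _)

/-- A coercive function on the product of two phase spaces. -/
def coerciveFun (q : Phase d × Phase d) : ℝ := ‖q.1.1‖ ^ 2 + ‖q.1.2‖ ^ 2 + quadCost q.1 q.2

theorem continuous_coerciveFun : Continuous (coerciveFun : Phase d × Phase d → ℝ) := by
  unfold coerciveFun
  exact (by fun_prop : Continuous fun q : Phase d × Phase d => ‖q.1.1‖ ^ 2 + ‖q.1.2‖ ^ 2).add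
    continuous_quadCost

/-- The first point has components of norm at most `t`, and the cost keeps the second within `√2 t ≤
2t` of it in each component, whence `3t`. -/
theorem norm_le_of_coerciveFun_le {q : Phase d × Phase d} {t : ℝ} (ht : 0 ≤ t)
    (h : coerciveFun q ≤ t ^ 2) : ‖q‖ ≤ 3 * t := by
  simp only [coerciveFun, quadCost] at h
  have ha : ‖q.1.1‖ ≤ t := abs_le_of_sq_le_sq' (by
    nlinarith [sq_nonneg ‖q.1.2‖, sq_nonneg ‖q.1.1 - q.2.1‖, sq_nonneg ‖q.1.2 - q.2.2‖]) ht |>.2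
  have hb : ‖q.1.2‖ ≤ t := abs_le_of_sq_le_sq' (by
    nlinarith [sq_nonneg ‖q.1.1‖, sq_nonneg ‖q.1.1 - q.2.1‖, sq_nonneg ‖q.1.2 - q.2.2‖]) ht |>.2
  have hc : ‖q.1.1 - q.2.1‖ ≤ 2 * t := abs_le_of_sq_le_sq' (by
    nlinarith [sq_nonneg ‖q.1.1‖, sq_nonneg ‖q.1.2‖, sq_nonneg ‖q.1.2 - q.2.2‖])
    (by positivity) |>.2
  have hd : ‖q.1.2 - q.2.2‖ ≤ 2 * t := abs_le_of_sq_le_sq' (by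
    nlinarith [sq_nonneg ‖q.1.1‖, sq_nonneg ‖q.1.2‖, sq_nonneg ‖q.1.1 - q.2.1‖])
    (by positivity) |>.2
  have he : ‖q.2.1‖ ≤ 3 * t := by
    have := norm_le_norm_add_norm_sub q.1.1 q.2.1
    linarith
  have hf : ‖q.2.2‖ ≤ 3 * t := by
    have := norm_le_norm_add_norm_sub q.1.2 q.2.2
    linarith
  refine norm_prod_le_iff.2 ⟨norm_prod_le_iff.2 ⟨?_, ?_⟩, norm_prod_le_iff.2 ⟨he, hf⟩⟩ <;> linarith

/-- Couplings of a fixed measure with finite second moment and bounded cost are tight. -/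
theorem isTightMeasureSet_of_quadCost {S : Set (Measure (Phase d × Phase d))}
    {ρ : Measure (Phase d)} {C : ℝ≥0∞} (hC : C ≠ ⊤)
    (hρ : ∫⁻ z, ENNReal.ofReal (‖z.1‖ ^ 2 + ‖z.2‖ ^ 2) ∂ρ < ⊤)
    (hS : ∀ π ∈ S, π.map Prod.fst = ρ)
    (hSC : ∀ π ∈ S, ∫⁻ q, ENNReal.ofReal (quadCost q.1 q.2) ∂π ≤ C) :
    IsTightMeasureSet S := by
  rw [isTightMeasureSet_iff_exists_isCompact_measure_compl_le]
  intro ε hε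
  set B : ℝ≥0∞ := ∫⁻ z, ENNReal.ofReal (‖z.1‖ ^ 2 + ‖z.2‖ ^ 2) ∂ρ + C with hB
  have hBt : B ≠ ⊤ := by simp [hB, hρ.ne, hC]
  have hint : ∀ π ∈ S, ∫⁻ q, ENNReal.ofReal (coerciveFun q) ∂π ≤ B := by
    intro π hπ
    have hm : Measurable fun q : Phase d × Phase d =>
        ENNReal.ofReal (‖q.1.1‖ ^ 2 + ‖q.1.2‖ ^ 2) := by fun_prop
    have hm' : Measurable fun z : Phase d => ENNReal.ofReal (‖z.1‖ ^ 2 + ‖z.2‖ ^ 2) := by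
      fun_prop
    have h1 : ∀ q : Phase d × Phase d, ENNReal.ofReal (coerciveFun q) =
        ENNReal.ofReal (‖q.1.1‖ ^ 2 + ‖q.1.2‖ ^ 2) + ENNReal.ofReal (quadCost q.1 q.2) :=
      fun q => ENNReal.ofReal_add (by positivity) (quadCost_nonneg _ _)
    simp_rw [h1]
    rw [lintegral_add_left hm, hB, ← hS π hπ, lintegral_map hm' measurable_fst]
    gcongr
    exact hSC π hπ
  -- Markov's inequality at level `N²` gives mass at most `B/N² ≤ ε` outside the compact sublevel
  -- set. Taking `N ≥ 1` ensures `N ≤ N²`.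
  obtain ⟨N, hN0, hN⟩ : ∃ N : ℕ, 0 < N ∧ B / ε ≤ (N : ℝ≥0∞) ^ 2 := by
    obtain ⟨N, hN⟩ := ENNReal.exists_nat_gt (ENNReal.div_ne_top hBt hε.ne')
    have h0 : 0 < N := by
      rcases Nat.eq_zero_or_pos N with h | h
      · simp [h] at hN
      · exact h
    refine ⟨N, h0, hN.le.trans ?_⟩
    exact le_self_pow₀ (by exact_mod_cast h0) two_ne_zero
  refine ⟨{q | coerciveFun q ≤ (N : ℝ) ^ 2}, ?_, fun π hπ => ?_⟩
  · refine (isCompact_closedBall (0 : Phase d × Phase d) (3 * N)).of_isClosed_subset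
      (isClosed_le continuous_coerciveFun continuous_const) fun q hq => ?_
    rw [mem_closedBall_zero_iff]
    exact norm_le_of_coerciveFun_le (Nat.cast_nonneg N) hq
  · have hsub : {q : Phase d × Phase d | coerciveFun q ≤ (N : ℝ) ^ 2}ᶜ ⊆
        {q | (N : ℝ≥0∞) ^ 2 ≤ ENNReal.ofReal (coerciveFun q)} := by
      intro q hq
      simp only [Set.mem_compl_iff, Set.mem_ofPred_eq, not_le] at hq ⊢
      rw [← ENNReal.ofReal_natCast, ← ENNReal.ofReal_pow (Nat.cast_nonneg N)]
      exact ENNReal.ofReal_le_ofReal hq.le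
    have hmark := mul_meas_ge_le_lintegral (μ := π)
      (continuous_coerciveFun (d := d)).measurable.ennreal_ofReal ((N : ℝ≥0∞) ^ 2)
    have hN2 : (N : ℝ≥0∞) ^ 2 ≠ 0 := by positivity
    have hN3 : (N : ℝ≥0∞) ^ 2 ≠ ⊤ := by simp
    calc π {q | coerciveFun q ≤ (N : ℝ) ^ 2}ᶜ
        ≤ π {q | (N : ℝ≥0∞) ^ 2 ≤ ENNReal.ofReal (coerciveFun q)} := measure_mono hsub
      _ ≤ B / (N : ℝ≥0∞) ^ 2 := by
          rw [ENNReal.le_div_iff_mul_le (Or.inl hN2) (Or.inl hN3), mul_comm]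
          exact hmark.trans (hint π hπ)
      _ ≤ ε := ENNReal.div_le_of_le_mul
          (by rwa [ENNReal.div_le_iff_le_mul (Or.inl hε.ne') (Or.inr hN2), mul_comm] at hN)

/-- Lower semicontinuity of the integral of a continuous nonnegative function. -/
theorem lintegral_ofReal_le_of_tendsto {X : Type*} [MeasurableSpace X] [TopologicalSpace X]
    [BorelSpace X] {l : Filter ℕ} [l.NeBot] {π : ℕ → ProbabilityMeasure X}
    {π₀ : ProbabilityMeasure X} (hπ : Tendsto π l (𝓝 π₀)) {f : X → ℝ} (hf : Continuous f)
    {a : ℕ → ℝ≥0∞} {b : ℝ≥0∞} (ha : Tendsto a l (𝓝 b))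
    (h : ∀ n, ∫⁻ x, ENNReal.ofReal (f x) ∂(π n : Measure X) ≤ a n) :
    ∫⁻ x, ENNReal.ofReal (f x) ∂(π₀ : Measure X) ≤ b := by
  -- Truncation at height `N` gives a bounded continuous function, whose integrals converge;
  -- monotone convergence in `N` removes the truncation.
  have hm : ∀ N : ℕ, ∫⁻ x, min (ENNReal.ofReal (f x)) N ∂(π₀ : Measure X) ≤ b := by
    intro N
    let g : BoundedContinuousFunction X NNReal :=
      BoundedContinuousFunction.mkOfBound ⟨fun x => min (f x).toNNReal N, by fun_prop⟩ N
        fun x y => by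
          rw [NNReal.dist_eq, abs_le]
          have h1 : ((min (f x).toNNReal N : NNReal) : ℝ) ≤ N := by
            exact_mod_cast min_le_right _ _
          have h2 : ((min (f y).toNNReal N : NNReal) : ℝ) ≤ N := by
            exact_mod_cast min_le_right _ _
          have h3 := NNReal.coe_nonneg (min (f x).toNNReal N)
          have h4 := NNReal.coe_nonneg (min (f y).toNNReal N)
          constructor <;> simp only [ContinuousMap.coe_mk] <;> linarith
    have hg : ∀ x, (g x : ℝ≥0∞) = min (ENNReal.ofReal (f x)) N := fun x => by
      change ((min (f x).toNNReal N : NNReal) : ℝ≥0∞) = _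
      rw [ENNReal.coe_min]
      rfl
    have ht := ProbabilityMeasure.tendsto_iff_forall_lintegral_tendsto.1 hπ g
    simp_rw [hg] at ht
    exact le_of_tendsto_of_tendsto' ht ha fun n =>
      (lintegral_mono fun x => min_le_left _ _).trans (h n)
  have hmeas : Measurable fun x => ENNReal.ofReal (f x) := hf.measurable.ennreal_ofReal
  have hsup : ∀ x, ENNReal.ofReal (f x) = ⨆ N : ℕ, min (ENNReal.ofReal (f x)) N := by
    intro x
    refine le_antisymm ?_ (iSup_le fun N => min_le_left _ _)
    obtain ⟨N, hN⟩ := ENNReal.exists_nat_gt (ENNReal.ofReal_ne_top (r := f x))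
    exact le_iSup_of_le N (by rw [min_eq_left hN.le])
  rw [lintegral_congr hsup, lintegral_iSup (fun N => hmeas.min measurable_const)
    (fun N M hNM x => min_le_min le_rfl (by exact_mod_cast hNM))]
  exact iSup_le hm

end WeakLimits

/-! ### The classical limit -/

section ClassicalLimit

variable {d : ℕ}

variable {p : Phase d → ℝ} {R : ℝ → StateSpace d →L[ℂ] StateSpace d} {μ : 𝓢'(Phase d, ℂ)}

theorem tendsto_integral_husimiMeasure (hR : ∀ ħ, 0 < ħ → IsDensityOperator (R ħ))
    (hμ : WignerTendsto R μ) {ħ : ℕ → ℝ} (hpos : ∀ n, 0 < ħ n) (hlim : Tendsto ħ atTop (𝓝 0))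
    (θ : 𝓢(Phase d, ℂ)) :
    Tendsto (fun n => ∫ z, θ z ∂(husimiMeasure (ħ n) (R (ħ n)))) atTop (𝓝 (μ θ)) := by
  have h1 : Tendsto ħ atTop (𝓝[>] 0) :=
    tendsto_nhdsWithin_iff.2 ⟨hlim, Eventually.of_forall hpos⟩
  refine ((tendsto_integral_husimi hR hμ θ).comp h1).congr fun n => ?_
  exact ((hR _ (hpos n)).integral_husimiMeasure (hpos n) _).symm

/-- Covers the case of an infinite lower limit, where nothing prevents mass from escaping to
infinity. The sequence `ħ = 1/(n + 1)` suffices. -/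
theorem exists_measure_of_wignerTendsto (hR : ∀ ħ, 0 < ħ → IsDensityOperator (R ħ))
    (hμ : WignerTendsto R μ) :
    ∃ m : Measure (Phase d), m Set.univ ≤ 1 ∧ ∀ θ : 𝓢(Phase d, ℂ), μ θ = ∫ z, θ z ∂m := by
  have hpos : ∀ n : ℕ, (0 : ℝ) < 1 / ((n : ℝ) + 1) := fun n => by positivity
  exact exists_measure_of_tendsto_integral _
    (fun n => (hR _ (hpos n)).isProbabilityMeasure_husimiMeasure (hpos n)) _
    (tendsto_integral_husimiMeasure hR hμ hpos tendsto_one_div_add_atTop_nhds_zero_nat)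

theorem exists_seq_hybridE_lt
    (hL : liminf (fun ħ : ℝ => hybridE ħ p (R ħ)) (𝓝[>] 0) < ⊤) :
    ∃ ħ : ℕ → ℝ, (∀ n, 0 < ħ n) ∧ Tendsto ħ atTop (𝓝 0) ∧
      ∀ n, hybridE (ħ n) p (R (ħ n)) <
        liminf (fun ħ : ℝ => hybridE ħ p (R ħ)) (𝓝[>] 0) + ((n : ℝ≥0∞) + 1)⁻¹ := by
  set L := liminf (fun ħ : ℝ => hybridE ħ p (R ħ)) (𝓝[>] 0) with hLdef
  have h : ∀ n : ℕ, ∃ ħ : ℝ, hybridE ħ p (R ħ) < L + ((n : ℝ≥0∞) + 1)⁻¹ ∧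
      0 < ħ ∧ ħ < 1 / ((n : ℝ) + 1) := by
    intro n
    have h1 : L < L + ((n : ℝ≥0∞) + 1)⁻¹ := ENNReal.lt_add_right hL.ne (by simp)
    have h2 : ∃ᶠ ħ in 𝓝[>] (0 : ℝ), hybridE ħ p (R ħ) < L + ((n : ℝ≥0∞) + 1)⁻¹ :=
      frequently_lt_of_liminf_lt (h := h1)
    exact (h2.and_eventually (Ioo_mem_nhdsGT (by positivity))).exists
  choose ħ h1 h2 h3 using h
  exact ⟨ħ, h2, squeeze_zero (fun n => (h2 n).le) (fun n => (h3 n).le)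
    tendsto_one_div_add_atTop_nhds_zero_nat, h1⟩

/-- Near-optimal couplings of `p` with the Husimi measures have bounded cost, hence are tight. A
limit point keeps the first marginal `p`, its second marginal represents `μ`, and its cost is at
most the squared lower limit. -/
theorem exists_probabilityMeasure_distMK_le (hp : IsProbabilityDensity p)
    (hp2 : HasFiniteSecondMoment p) (hR : ∀ ħ, 0 < ħ → IsDensityOperator (R ħ))
    (hμ : WignerTendsto R μ)
    (hL : liminf (fun ħ : ℝ => hybridE ħ p (R ħ)) (𝓝[>] 0) < ⊤) :
    ∃ m : Measure (Phase d), IsProbabilityMeasure m ∧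
      (∀ θ : 𝓢(Phase d, ℂ), μ θ = ∫ z, θ z ∂m) ∧
      distMK (densityMeasure p) m ≤ liminf (fun ħ : ℝ => hybridE ħ p (R ħ)) (𝓝[>] 0) := by
  obtain ⟨ħ, hpos, hlim, hlt⟩ := exists_seq_hybridE_lt hL
  set L := liminf (fun ħ : ℝ => hybridE ħ p (R ħ)) (𝓝[>] 0) with hLdef
  let a : ℕ → ℝ≥0∞ := fun n => (L + ((n : ℝ≥0∞) + 1)⁻¹) ^ 2 +
    ENNReal.ofReal ((1 / 2) * d * ħ n)
  have ha : Tendsto a atTop (𝓝 (L ^ 2)) := by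
    have h1 : Tendsto (fun n : ℕ => ((n : ℝ≥0∞) + 1)⁻¹) atTop (𝓝 0) := by
      have := (tendsto_add_atTop_iff_nat 1).2 ENNReal.tendsto_inv_nat_nhds_zero
      simpa using this
    have h2 : Tendsto (fun n : ℕ => (L + ((n : ℝ≥0∞) + 1)⁻¹) ^ 2) atTop (𝓝 ((L + 0) ^ 2)) :=
      ((ENNReal.continuous_pow 2).tendsto _).comp (tendsto_const_nhds.add h1)
    have h3 : Tendsto (fun n : ℕ => ENNReal.ofReal ((1 / 2) * d * ħ n)) atTop (𝓝 0) := by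
      have := ENNReal.tendsto_ofReal (hlim.const_mul ((1 / 2) * (d : ℝ)))
      simpa using this
    have h4 := h2.add h3
    rwa [add_zero, add_zero] at h4
  have hπ : ∀ n, ∃ π, IsMeasureCoupling (densityMeasure p) (husimiMeasure (ħ n) (R (ħ n))) π ∧
      ∫⁻ q, ENNReal.ofReal (quadCost q.1 q.2) ∂π ≤ a n := by
    intro n
    -- The strict inequality yields an actual quantum coupling `Q` below the bound; no minimizer is
    -- needed.
    have h1 : hybridE (ħ n) p (R (ħ n)) ^ 2 < (L + ((n : ℝ≥0∞) + 1)⁻¹) ^ 2 :=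
      ENNReal.pow_right_strictMono two_ne_zero (hlt n)
    rw [hybridE_sq] at h1
    simp_rw [iInf_lt_iff] at h1
    obtain ⟨Q, hQ, hlt'⟩ := h1
    obtain ⟨π, hc, hle⟩ := exists_isMeasureCoupling hp (hR _ (hpos n)) (hpos n) hQ
    exact ⟨π, hc, hle.trans (by simp only [a]; gcongr)⟩
  choose π hcoup hcost using hπ
  have hpp := hp.isProbabilityMeasure
  have hprob : ∀ n, IsProbabilityMeasure (π n) := fun n => by
    have h1 := (hcoup n).1
    refine ⟨?_⟩
    rw [← Set.preimage_univ (f := (Prod.fst : Phase d × Phase d → Phase d)),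
      ← Measure.map_apply measurable_fst MeasurableSet.univ, h1, measure_univ]
  let P : ℕ → ProbabilityMeasure (Phase d × Phase d) := fun n => ⟨π n, hprob n⟩
  -- A bound uniform in `n`: `(n + 1)⁻¹ ≤ 1`, and the convergent sequence `ħ n` is bounded.
  obtain ⟨C, hC, hCa⟩ : ∃ C : ℝ≥0∞, C ≠ ⊤ ∧ ∀ n, a n ≤ C := by
    refine ⟨(L + 1) ^ 2 + ⨆ n, ENNReal.ofReal ((1 / 2) * d * ħ n), ?_, fun n => ?_⟩
    · obtain ⟨M, hM⟩ := hlim.bddAbove_range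
      refine ENNReal.add_ne_top.2 ⟨by simp [hL.ne], ?_⟩
      refine ne_top_of_le_ne_top (ENNReal.ofReal_ne_top (r := (1 / 2) * d * M)) (iSup_le fun n => ?_)
      gcongr
      exact hM ⟨n, rfl⟩
    · simp only [a]
      gcongr
      · rw [ENNReal.inv_le_one]
        exact le_add_self
      · exact le_iSup (fun n => ENNReal.ofReal ((1 / 2) * d * ħ n)) n
  have htight : IsTightMeasureSet {((ν : ProbabilityMeasure (Phase d × Phase d)) :
      Measure (Phase d × Phase d)) | ν ∈ Set.range P} := by
    refine isTightMeasureSet_of_quadCost hC (lintegral_norm_sq_densityMeasure_lt_top hp hp2)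
      ?_ ?_
    · rintro _ ⟨_, ⟨n, rfl⟩, rfl⟩
      exact (hcoup n).1
    · rintro _ ⟨_, ⟨n, rfl⟩, rfl⟩
      exact (hcost n).trans (hCa n)
  obtain ⟨P₀, -, hP₀⟩ := (isCompact_closure_of_isTightMeasureSet htight).ultrafilter_le_nhds
    ((hyperfilter ℕ).map P) (by
      rw [le_principal_iff]
      exact Filter.mem_of_superset (Filter.range_mem_map) subset_closure)
  have hP : Tendsto P (hyperfilter ℕ) (𝓝 P₀) := hP₀
  have hfst := ProbabilityMeasure.tendsto_map_of_tendsto_of_continuous P P₀ hP continuous_fst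
  have hfst' : (P₀ : Measure (Phase d × Phase d)).map Prod.fst = densityMeasure p := by
    have hconst : ∀ n, (P n).map (f := Prod.fst) continuous_fst.measurable.aemeasurable =
        (⟨densityMeasure p, hpp⟩ : ProbabilityMeasure (Phase d)) := fun n =>
      Subtype.ext (hcoup n).1
    simp_rw [hconst] at hfst
    have h1 := tendsto_nhds_unique hfst tendsto_const_nhds
    exact congrArg (fun ν : ProbabilityMeasure (Phase d) => (ν : Measure (Phase d))) h1
  refine ⟨(P₀ : Measure (Phase d × Phase d)).map Prod.snd,
    Measure.isProbabilityMeasure_map measurable_snd.aemeasurable, fun θ => ?_, ?_⟩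
  · have hsnd := ProbabilityMeasure.tendsto_map_of_tendsto_of_continuous P P₀ hP continuous_snd
    rw [ProbabilityMeasure.tendsto_iff_forall_integral_rclike_tendsto ℂ] at hsnd
    have h1 := hsnd θ.toBoundedContinuousFunction
    have h2 := (tendsto_integral_husimiMeasure hR hμ hpos hlim θ).mono_left
      Nat.hyperfilter_le_atTop
    refine tendsto_nhds_unique h2 (h1.congr fun n => ?_)
    change ∫ z, θ z ∂((π n).map Prod.snd) = _
    rw [(hcoup n).2]
  · refine (ENNReal.pow_right_strictMono two_ne_zero).le_iff_le.1 ?_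
    beta_reduce
    rw [distMK_sq]
    refine (iInf₂_le (P₀ : Measure (Phase d × Phase d)) ⟨hfst', rfl⟩).trans ?_
    exact lintegral_ofReal_le_of_tendsto hP continuous_quadCost
      (ha.mono_left Nat.hyperfilter_le_atTop) hcost

end ClassicalLimit

end HybridTransport

end

end

theorem theorem2p4 (d : ℕ) (p : HybridTransport.Phase d → ℝ)
    (hp : HybridTransport.IsProbabilityDensity p)
    (hp2 : HybridTransport.HasFiniteSecondMoment p) :
    -- the general lower bound
    (∀ ħ : ℝ, 0 < ħ →
      ∀ R : HybridTransport.StateSpace d →L[ℂ] HybridTransport.StateSpace d,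
        HybridTransport.IsDensityOperator R →
        ENNReal.ofReal ((1 / 2) * d * ħ) ≤ HybridTransport.hybridE ħ p R ^ 2) ∧
    -- (1) the upper bound for Töplitz operators
    (∀ ħ : ℝ, 0 < ħ →
      ∀ μ : Measure (HybridTransport.Phase d), IsProbabilityMeasure μ →
        HybridTransport.IsDensityOperator
          (HybridTransport.toeplitz ħ (ENNReal.ofReal ((2 * Real.pi * ħ) ^ d) • μ)) ∧
        HybridTransport.hybridE ħ p
            (HybridTransport.toeplitz ħ (ENNReal.ofReal ((2 * Real.pi * ħ) ^ d) • μ)) ^ 2 ≤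
          HybridTransport.distMK (HybridTransport.densityMeasure p) μ ^ 2 +
            ENNReal.ofReal ((1 / 2) * d * ħ)) ∧
    -- (2) the lower bound by the Husimi transform
    (∀ ħ : ℝ, 0 < ħ →
      ∀ R : HybridTransport.StateSpace d →L[ℂ] HybridTransport.StateSpace d,
        HybridTransport.IsDensityOperator R →
        HybridTransport.distMK (HybridTransport.densityMeasure p)
            (HybridTransport.husimiMeasure ħ R) ^ 2 ≤
          HybridTransport.hybridE ħ p R ^ 2 + ENNReal.ofReal ((1 / 2) * d * ħ)) ∧
    -- (3) the classical limit
    (∀ (R : ℝ → (HybridTransport.StateSpace d →L[ℂ] HybridTransport.StateSpace d))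
      (μ : 𝓢'(HybridTransport.Phase d, ℂ)),
        (∀ ħ : ℝ, 0 < ħ → HybridTransport.IsDensityOperator (R ħ)) →
        HybridTransport.WignerTendsto R μ →
        ∃ m : Measure (HybridTransport.Phase d),
          m Set.univ ≤ 1 ∧
          (∀ φ : 𝓢(HybridTransport.Phase d, ℂ), μ φ = ∫ z, φ z ∂m) ∧
          (liminf (fun ħ : ℝ => HybridTransport.hybridE ħ p (R ħ)) (𝓝[>] 0) < ⊤ →
            IsProbabilityMeasure m) ∧
          HybridTransport.distMK (HybridTransport.densityMeasure p) m ≤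
            liminf (fun ħ : ℝ => HybridTransport.hybridE ħ p (R ħ)) (𝓝[>] 0)) := by
  refine ⟨fun ħ hħ R _ => HybridTransport.le_hybridE_sq hp hħ R,
    fun ħ hħ μ _ => ⟨HybridTransport.isDensityOperator_toeplitz hħ μ,
      HybridTransport.hybridE_toeplitz_sq_le hħ hp μ⟩,
    fun ħ hħ R hR => HybridTransport.distMK_husimiMeasure_sq_le hp hR hħ,
    fun R μ hR hμ => ?_⟩
  -- With an infinite lower limit the distance bound is void and the claim of mass one is vacuous.
  by_cases hL : liminf (fun ħ : ℝ => HybridTransport.hybridE ħ p (R ħ)) (𝓝[>] 0) < ⊤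
  · obtain ⟨m, hm, hθ, hle⟩ :=
      HybridTransport.exists_probabilityMeasure_distMK_le hp hp2 hR hμ hL
    exact ⟨m, prob_le_one, hθ, fun _ => hm, hle⟩
  · obtain ⟨m, hm, hθ⟩ := HybridTransport.exists_measure_of_wignerTendsto hR hμ
    refine ⟨m, hm, hθ, fun h => absurd h hL, ?_⟩
    rw [not_lt_top_iff.1 hL]
    exact le_top
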